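/- Let $\nu\ge1$, let $\{u_j\}_{j\ge1}$ be a stationary Poisson process on $\mathbb R^\nu$ with unit intensity, and let $\{\Xi_j\}_{j\ge1}$ be i.i.d. random closed sets in $\mathbb R^\nu$ (measurable for the Borel $\sigma$-algebra of the Fell topology), independent of $\{u_j\}$, with the law of a generic grain $\Xi$. Put $$\mathcal X=\bigcup_j(u_j+\Xi_j),\qquad X(t)=\sum_j \mathbb 1(t\in u_j+\Xi_j),\qquad \mu=\mathrm E\,\mathrm{Leb}(\Xi).$$ Let $1<\alpha<2$ and $c_\Xi>0$, and assume that $$\mathrm P(\mathrm{Leb}(\Xi)>x)\sim c_\Xi x^{-\alpha}\quad(x\to\infty),\qquad \mathrm E\,\mathrm{Leb}(\Xi\cap\{|t|>\lambda\})=o(\lambda^{(1-\alpha)\nu/\alpha})\quad(\lambda\to\infty).$$ For $\phi\in L^1(\mathbb R^\nu)\cap L^\infty(\mathbb R^\nu)$ and $k\ge1$ let $$X_\lambda(\phi)=\int_{\mathbb R^\nu}\phi(t/\lambda)X(t)\,dt,\qquad \widehat X_{\lambda,k}(\phi)=\int_{\mathbb R^\nu}\phi(t/\lambda)\,\mathbb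 1(X(t)\ge k)\,dt,$$ and let $L_\alpha(\phi)$ be the $\alpha$-stable stochastic integral with law given by $$\log\mathrm E\,e^{i\theta L_\alpha(\phi)}=i c_\Xi\int_{\mathbb R^\nu}\theta\phi(s)\Big\{\int_0^\infty(e^{i\theta\phi(s)x}-1)x^{-\alpha}\,dx\Big\}ds,\qquad\theta\in\mathbb R.$$ Then $X(t)<\infty$ almost surely for every $t$, the integrals above are almost surely absolutely convergent for $\lambda>0$ and have finite means, the law of $L_\alpha(\phi)$ exists (and is a nondegenerate $\alpha$-stable law unless $\phi=0$ a.e.), and, as $\lambda\to\infty$, for every $\phi\in L^1\cap L^\infty$, $$\lambda^{-\nu/\alpha}\big(X_\lambda(\phi)-\mathrm E X_\lambda(\phi)\big)\ \xrightarrow{d}\ L_\alpha(\phi),$$ and, for every $k\ge1$, $$\lambda^{-\nu/\alpha}\big(\widehat X_{\lambda,k}(\phi)-\mathrm E\widehat X_{\lambda,k}(\phi)\big)\ \xrightarrow{d}\ e^{-\mu}\frac{\mu^{k-1}}{(k-1)!}\,L_\alpha(\phi).$$ In particular, for every bounded Borel set $A\subset\mathbb R^\nu$ with $\mathrm{Leb}(A)>0$,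 with $\widehat p_{\lambda,A}=\mathrm{Leb}(\mathcal X\cap\lambda A)/\mathrm{Leb}(\lambda A)$ and $p=\mathrm E\,\mathrm{Leb}(\mathcal X\cap\,]0,1]^\nu)$, $$\lambda^{\nu-\nu/\alpha}(\widehat p_{\lambda,A}-p)\ \xrightarrow{d}\ e^{-\mu}L_\alpha(A)/\mathrm{Leb}(A),$$ where $L_\alpha(A)=L_\alpha(\mathbb 1_A)$ has the $\alpha$-stable distribution with characteristic function $$\mathrm E\,e^{i\theta L_\alpha(A)}=\exp\Big\{i\theta c_\Xi\,\mathrm{Leb}(A)\int_0^\infty(e^{i\theta x}-1)x^{-\alpha}\,dx\Big\}.$$ -/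

import Mathlib

open MeasureTheory ProbabilityTheory Filter Topology TopologicalSpace Asymptotics
open scoped ENNReal NNReal Pointwise

/-- The Fell topology on the closed subsets of a topological space: it is generated by the sets
`{F | F ∩ G ≠ ∅}` with `G` open and the sets `{F | F ∩ K = ∅}` with `K` compact. -/
@[reducible]
def fellTopology (E : Type*) [TopologicalSpace E] : TopologicalSpace (Closeds E) :=
  TopologicalSpace.generateFrom
    ({S | ∃ G : Set E, IsOpen G ∧ S = {F : Closeds E | ((F : Set E) ∩ G).Nonempty}} ∪
      {S | ∃ K : Set E, IsCompact K ∧ S = {F : Closeds E | Disjoint (F : Set E) K}})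

/-- The space of closed sets carries the Borel `σ`-algebra of the Fell topology. -/
instance fellMeasurableSpace (E : Type*) [TopologicalSpace E] : MeasurableSpace (Closeds E) :=
  @borel (Closeds E) (fellTopology E)

noncomputable section

/-- The number of indices `j` with `u j ω ∈ B`. -/
def pointCount {Ω E : Type*} (u : ℕ → Ω → E) (B : Set E) (ω : Ω) : ℝ≥0∞ :=
  ∑' j, B.indicator (fun _ => (1 : ℝ≥0∞)) (u j ω)

/-- The random points `u 0, u 1, …` form a Poisson process with intensity measure `Λ`: the number
of points in a Borel set `B` with `Λ B < ∞` is Poisson distributed with mean `Λ B`, and the numbers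
of points in pairwise disjoint such sets are independent. -/
structure IsPoissonProcess {Ω E : Type*} [MeasurableSpace Ω] [MeasurableSpace E]
    (P : Measure Ω) (Λ : Measure E) (u : ℕ → Ω → E) : Prop where
  measurable : ∀ j, Measurable (u j)
  map_pointCount : ∀ B : Set E, MeasurableSet B → Λ B < ∞ →
    P.map (pointCount u B) = (poissonMeasure (Λ B).toNNReal).map (fun n : ℕ => (n : ℝ≥0∞))
  indep : ∀ B : ℕ → Set E, (∀ i, MeasurableSet (B i)) → (∀ i, Λ (B i) < ∞) →
    (Pairwise fun i j => Disjoint (B i) (B j)) →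
    iIndepFun (fun i ω => pointCount u (B i) ω) P

/-- The data of a Boolean model in `ℝ^ν`: a stationary Poisson process `u` of unit intensity, and
an i.i.d. sequence `Ξs` of random closed sets with the law of the generic grain `Ξ`,
independent of `u`. -/
structure IsBooleanModel {Ω : Type*} [MeasurableSpace Ω] (P : Measure Ω) {ν : ℕ}
    (u : ℕ → Ω → EuclideanSpace ℝ (Fin ν)) (Ξs : ℕ → Ω → Closeds (EuclideanSpace ℝ (Fin ν)))
    (Ξ : Ω → Closeds (EuclideanSpace ℝ (Fin ν))) : Prop where
  poisson : IsPoissonProcess P volume u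
  measurable_generic : Measurable Ξ
  measurable_grain : ∀ j, Measurable (Ξs j)
  identDistrib : ∀ j, IdentDistrib (Ξs j) Ξ P P
  iIndep : iIndepFun Ξs P
  indep : IndepFun (fun ω j => u j ω) (fun ω j => Ξs j ω) P

section Model

variable {Ω : Type*} {ν : ℕ}

/-- The Boolean set `⋃ⱼ (uⱼ + Ξⱼ)`. -/
def booleanSet (u : ℕ → Ω → EuclideanSpace ℝ (Fin ν))
    (Ξs : ℕ → Ω → Closeds (EuclideanSpace ℝ (Fin ν))) (ω : Ω) : Set (EuclideanSpace ℝ (Fin ν)) :=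
  ⋃ j, u j ω +ᵥ (Ξs j ω : Set (EuclideanSpace ℝ (Fin ν)))

/-- The random grain field `X(t) = ∑ⱼ 1(t ∈ uⱼ + Ξⱼ)`. -/
def grainField (u : ℕ → Ω → EuclideanSpace ℝ (Fin ν))
    (Ξs : ℕ → Ω → Closeds (EuclideanSpace ℝ (Fin ν))) (ω : Ω) (t : EuclideanSpace ℝ (Fin ν)) :
    ℝ≥0∞ :=
  ∑' j, (u j ω +ᵥ (Ξs j ω : Set (EuclideanSpace ℝ (Fin ν)))).indicator (fun _ => (1 : ℝ≥0∞)) t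

/-- The indicator `1(X(t) ≥ k)` of the excursion set `{X ≥ k}`. -/
def excursion (u : ℕ → Ω → EuclideanSpace ℝ (Fin ν))
    (Ξs : ℕ → Ω → Closeds (EuclideanSpace ℝ (Fin ν))) (k : ℕ) (ω : Ω)
    (t : EuclideanSpace ℝ (Fin ν)) : ℝ :=
  {s | (k : ℝ≥0∞) ≤ grainField u Ξs ω s}.indicator (fun _ => (1 : ℝ)) t

/-- `∫ φ(t / r) Y(t) dt` for a real function `Y` on `ℝ^ν`. -/
def scaledIntegral (Y φ : EuclideanSpace ℝ (Fin ν) → ℝ) (r : ℝ) : ℝ :=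
  ∫ t, φ (r⁻¹ • t) * Y t

/-- `X_r(φ) = ∫ φ(t / r) X(t) dt`. -/
def fieldIntegral (u : ℕ → Ω → EuclideanSpace ℝ (Fin ν))
    (Ξs : ℕ → Ω → Closeds (EuclideanSpace ℝ (Fin ν))) (φ : EuclideanSpace ℝ (Fin ν) → ℝ)
    (r : ℝ) (ω : Ω) : ℝ :=
  scaledIntegral (fun t => (grainField u Ξs ω t).toReal) φ r

/-- `X̂_{r,k}(φ) = ∫ φ(t / r) 1(X(t) ≥ k) dt`. -/
def excursionIntegral (u : ℕ → Ω → EuclideanSpace ℝ (Fin ν))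
    (Ξs : ℕ → Ω → Closeds (EuclideanSpace ℝ (Fin ν))) (k : ℕ)
    (φ : EuclideanSpace ℝ (Fin ν) → ℝ) (r : ℝ) (ω : Ω) : ℝ :=
  scaledIntegral (excursion u Ξs k ω) φ r

/-- The mean grain volume `μ = E Leb(Ξ)`. -/
def meanGrainVolume [MeasurableSpace Ω] (P : Measure Ω)
    (Ξ : Ω → Closeds (EuclideanSpace ℝ (Fin ν))) : ℝ :=
  (∫⁻ ω, volume (Ξ ω : Set (EuclideanSpace ℝ (Fin ν))) ∂P).toReal

/-- The volume fraction `p = E Leb(𝒳 ∩ ]0, 1]^ν)` of the Boolean set `𝒳`. -/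
def volumeFraction [MeasurableSpace Ω] (P : Measure Ω) (u : ℕ → Ω → EuclideanSpace ℝ (Fin ν))
    (Ξs : ℕ → Ω → Closeds (EuclideanSpace ℝ (Fin ν))) : ℝ :=
  ∫ ω, volume.real (booleanSet u Ξs ω ∩ {t | ∀ i, 0 < t i ∧ t i ≤ 1}) ∂P

/-- The sample volume fraction `p̂_{r,A} = Leb(𝒳 ∩ rA) / Leb(rA)`. -/
def sampleVolumeFraction (u : ℕ → Ω → EuclideanSpace ℝ (Fin ν))
    (Ξs : ℕ → Ω → Closeds (EuclideanSpace ℝ (Fin ν))) (A : Set (EuclideanSpace ℝ (Fin ν)))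
    (r : ℝ) (ω : Ω) : ℝ :=
  volume.real (booleanSet u Ξs ω ∩ r • A) / volume.real (r • A)

end Model

/-- The inner integral `∫₀^∞ (e^{iyx} - 1) x^{-α} dx`. -/
def stableKernel (α y : ℝ) : ℂ :=
  ∫ x in Set.Ioi (0 : ℝ), (Complex.exp (Complex.I * y * x) - 1) * ((x ^ (-α) : ℝ) : ℂ)

/-- The log-characteristic function of the stable integral `L_α(φ)`:
`j(θ; φ) = i c ∫ θ φ(s) {∫₀^∞ (e^{iθφ(s)x} - 1) x^{-α} dx} ds`. -/
def stableLogCharFun {ν : ℕ} (c α : ℝ) (φ : EuclideanSpace ℝ (Fin ν) → ℝ) (θ : ℝ) : ℂ :=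
  Complex.I * c * ∫ s, ((θ * φ s : ℝ) : ℂ) * stableKernel α (θ * φ s)

/-- `S` is the law of the stable integral `L_α(φ)`, that is, the (unique) probability law
on `ℝ` with log-characteristic function `j(·; φ)`. -/
def IsStableIntegralLaw {ν : ℕ} (c α : ℝ) (φ : EuclideanSpace ℝ (Fin ν) → ℝ)
    (S : ProbabilityMeasure ℝ) : Prop :=
  ∀ θ : ℝ, charFun (S : Measure ℝ) θ = Complex.exp (stableLogCharFun c α φ θ)

/-- `S` is a (nondegenerate) `α`-stable law: for independent `Z₁, Z₂` with law `S` and `a, b > 0`,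
`a Z₁ + b Z₂` has the law of `(a^α + b^α)^{1/α} Z₁ + d` for some real `d`. -/
def IsAlphaStable (α : ℝ) (S : Measure ℝ) : Prop :=
  (∀ m : ℝ, S ≠ Measure.dirac m) ∧
  ∀ a b : ℝ, 0 < a → 0 < b → ∃ d : ℝ,
    Measure.conv (S.map fun x => a * x) (S.map fun x => b * x) =
      S.map fun x => (a ^ α + b ^ α) ^ (1 / α) * x + d

end

/-!
The germs with their grains form an independently marked Poisson process, so all laws of linear
functionals of the model follow from its characteristic functional
(`IsMarkedPoisson.integral_exp_tsum`). For the field itself it reads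
`E exp(i(X(f) - E X(f))) = exp ∫ (e^{iz} - 1 - iz)`, where `z = ∫_F f(x + y) dy` is the integral of
`f` over the translated grain `x + F`, and `(x, F)` is integrated against Lebesgue measure times the
law of the grain (`IsBooleanModel.integral_exp_mul_grainField`).

For `f = r^{-ν/α} φ(· / r)` the grains are small compared with the scale `r`, so `z` may be replaced
by `φ(x / r) Leb(F) r^{-ν/α}`. The error is controlled by the continuity of translation in `L¹`,
where the grains are small, and by the assumption on the volume of the grain far from the origin
(`lintegral_enorm_centredExp_smear_sub_le`). After the replacement only the tail of `Leb(Ξ)` enters: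
integration by parts turns the exponent into an integral against this tail, and dominated
convergence, with the bound `C x^{-α}` for the rescaled tails, gives the logarithmic characteristic
function of the stable integral (`tendsto_integral_centredExp_mul`). The limit is continuous at the
origin, so by tightness it is the characteristic function of a law
(`exists_charFun_eq_of_tendsto`), and convergence in distribution follows from Lévy's theorem. The
law is stable by the homogeneity of the exponent, and nondegenerate since `∫₀^∞ sin(x) x^{-α} dx` is
positive.

The indicator `1(X(t) ≥ k)` is a function of the Poisson variable `X(t)`. Its expansion in Charlier
polynomials has the constant term `P(X(t) ≥ k)` and the linear term
`e^{-μ} μ^{k-1} / (k-1)! · (X(t) - μ)`. The remainder has Charlier rank two, so its correlation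
between `s` and `t` is of the order of the square of the mean overlap `E Leb(Ξ ∩ (Ξ - (t - s)))`
(`IsBooleanModel.abs_integral_mul_natCount_le`): given the common points of the two Poisson
variables, the two factors are independent, and their conditional mean vanishes together with its
first difference on average. Since the overlap decays fast enough, the integral of the remainder is
negligible in mean square at the scale `r^{ν/α}` (`tendsto_lintegral_overlap_sq`), and Slutsky's
theorem applies. The Boolean set is the excursion set for `k = 1`.
-/

/-! ### Moments and generating function of the Poisson law -/

lemma hasSum_poisson_descFactorial (r : ℝ≥0) (k : ℕ) :
    HasSum (fun n : ℕ => Real.exp (-r) * r ^ n / n.factorial * (n.descFactorial k : ℝ))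
      ((r : ℝ) ^ k) := by
  rw [← hasSum_nat_add_iff' k]
  have h0 : ∑ i ∈ Finset.range k,
      Real.exp (-r) * r ^ i / i.factorial * (i.descFactorial k : ℝ) = 0 := by
    refine Finset.sum_eq_zero fun i hi => ?_
    rw [Nat.descFactorial_of_lt (Finset.mem_range.mp hi)]
    simp
  rw [h0, sub_zero]
  convert! (hasSum_one_poissonMeasure r).mul_left ((r : ℝ) ^ k) using 1
  · funext n
    have h := Nat.factorial_mul_descFactorial (Nat.le_add_left k n)
    rw [Nat.add_sub_cancel] at h
    have h' : ((n + k).factorial : ℝ) = n.factorial * (n + k).descFactorial k := by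
      exact_mod_cast h.symm
    have hd : ((n + k).descFactorial k : ℝ) ≠ 0 := by
      have := Nat.factorial_pos (n + k)
      intro h0
      rw [h0, mul_zero] at h'
      have h2 : ((n + k).factorial : ℝ) ≠ 0 := by exact_mod_cast this.ne'
      exact h2 h'
    have hn : (n.factorial : ℝ) ≠ 0 := by exact_mod_cast (Nat.factorial_pos n).ne'
    rw [h', pow_add]
    field_simp
  · simp

lemma integrable_descFactorial_poissonMeasure (r : ℝ≥0) (k : ℕ) :
    Integrable (fun n : ℕ => (n.descFactorial k : ℝ)) (poissonMeasure r) := by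
  rw [integrable_poissonMeasure_iff]
  simpa using (hasSum_poisson_descFactorial r k).summable

/-- The factorial moments of the Poisson law. -/
lemma integral_descFactorial_poissonMeasure (r : ℝ≥0) (k : ℕ) :
    ∫ n : ℕ, (n.descFactorial k : ℝ) ∂(poissonMeasure r) = (r : ℝ) ^ k := by
  rw [integral_poissonMeasure]
  simpa using (hasSum_poisson_descFactorial r k).tsum_eq

lemma lintegral_natCast_poissonMeasure (r : ℝ≥0) :
    ∫⁻ n : ℕ, (n : ℝ≥0∞) ∂(poissonMeasure r) = r := by
  have h := integral_descFactorial_poissonMeasure r 1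
  have hi := integrable_descFactorial_poissonMeasure r 1
  simp only [Nat.descFactorial_one, pow_one] at h hi
  have h2 := ofReal_integral_eq_lintegral_ofReal hi (ae_of_all _ fun n => Nat.cast_nonneg n)
  rw [h, ENNReal.ofReal_coe_nnreal] at h2
  rw [h2]
  simp

lemma integral_pow_poissonMeasure (r : ℝ≥0) (z : ℂ) :
    ∫ n : ℕ, z ^ n ∂(poissonMeasure r) = Complex.exp (r * (z - 1)) := by
  rw [integral_poissonMeasure]
  have h := (NormedSpace.expSeries_div_hasSum_exp ((r : ℂ) * z)).mul_left ((Real.exp (-r) : ℝ) : ℂ)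
  rw [← Complex.exp_eq_exp_ℂ, Complex.ofReal_exp, ← Complex.exp_add] at h
  have h2 : (r : ℂ) * (z - 1) = ((-(r : ℝ) : ℝ) : ℂ) + r * z := by push_cast; ring
  rw [h2, ← h.tsum_eq]
  congr with n
  simp only [Complex.real_smul]
  push_cast
  rw [mul_pow]
  ring

/-! ### The Poisson process: intensity and generating functional -/

section PoissonProcess

variable {Ω E : Type*} [MeasurableSpace Ω] [MeasurableSpace E] {P : Measure Ω}
  {Λ : Measure E} {u : ℕ → Ω → E}

lemma measurable_pointCount (hu : ∀ j, Measurable (u j)) {B : Set E} (hB : MeasurableSet B) :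
    Measurable (pointCount u B) :=
  Measurable.tsum fun j => (measurable_const.indicator hB).comp (hu j)

omit [MeasurableSpace Ω] [MeasurableSpace E] in
lemma pointCount_eq_encard (B : Set E) (ω : Ω) :
    pointCount u B ω = ((({j | u j ω ∈ B} : Set ℕ).encard : ℕ∞) : ℝ≥0∞) := by
  rw [← ENNReal.tsum_set_one, tsum_subtype ({j | u j ω ∈ B} : Set ℕ) fun _ => (1 : ℝ≥0∞)]
  rfl

namespace IsPoissonProcess

variable (hP : IsPoissonProcess P Λ u)
include hP

lemma lintegral_pointCount {B : Set E} (hB : MeasurableSet B) (hΛ : Λ B < ∞) :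
    ∫⁻ ω, pointCount u B ω ∂P = Λ B := by
  have h := lintegral_map (μ := P) (f := fun x : ℝ≥0∞ => x) measurable_id'
    (measurable_pointCount hP.measurable hB)
  rw [← h, hP.map_pointCount B hB hΛ, lintegral_map measurable_id' (by fun_prop),
    lintegral_natCast_poissonMeasure]
  exact ENNReal.coe_toNNReal hΛ.ne

/-- The intensity measure is the sum of the laws of the points. -/
lemma sum_map_eq [SigmaFinite Λ] : Measure.sum (fun j => P.map (u j)) = Λ := by
  have key : ∀ B, MeasurableSet B → Λ B < ∞ → Measure.sum (fun j => P.map (u j)) B = Λ B := by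
    intro B hB hΛ
    rw [Measure.sum_apply _ hB, ← hP.lintegral_pointCount hB hΛ]
    unfold pointCount
    have hm : ∀ j, AEMeasurable (fun ω => B.indicator (fun _ => (1 : ℝ≥0∞)) (u j ω)) P := fun j =>
      ((measurable_const.indicator hB).comp (hP.measurable j)).aemeasurable
    rw [lintegral_tsum hm]
    refine tsum_congr fun j => ?_
    rw [Measure.map_apply (hP.measurable j) hB]
    exact (lintegral_indicator_one (hP.measurable j hB)).symm
  refine Measure.ext fun B hB => ?_
  have hm := monotone_spanningSets Λ
  have e : B = ⋃ i, B ∩ spanningSets Λ i := by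
    rw [← Set.inter_iUnion, iUnion_spanningSets, Set.inter_univ]
  have hmB : Monotone fun i => B ∩ spanningSets Λ i :=
    fun i j hij => Set.inter_subset_inter_right _ (hm hij)
  rw [e, hmB.measure_iUnion, hmB.measure_iUnion]
  refine iSup_congr fun i => key _ (hB.inter (measurableSet_spanningSets Λ i)) ?_
  exact (measure_mono Set.inter_subset_right).trans_lt (measure_spanningSets_lt_top Λ i)

lemma ae_pointCount_lt_top {B : Set E} (hB : MeasurableSet B) (hΛ : Λ B < ∞) :
    ∀ᵐ ω ∂P, pointCount u B ω < ∞ := by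
  refine ae_lt_top (measurable_pointCount hP.measurable hB) ?_
  rw [hP.lintegral_pointCount hB hΛ]
  exact hΛ.ne

/-- Independence of the counts for a countable index type; it is embedded into `ℕ`, with the empty
set at the remaining indices. -/
lemma iIndepFun_pointCount {ι : Type*} [Countable ι] {B : ι → Set E}
    (hB : ∀ i, MeasurableSet (B i)) (hΛ : ∀ i, Λ (B i) < ∞)
    (hd : Pairwise fun i j => Disjoint (B i) (B j)) :
    iIndepFun (fun i ω => pointCount u (B i) ω) P := by
  obtain ⟨e, he⟩ := exists_injective_nat ι
  have hcase : ∀ n, (∃ i, e i = n ∧ Function.extend e B (fun _ => ∅) n = B i) ∨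
      Function.extend e B (fun _ => ∅) n = ∅ := by
    intro n
    by_cases h : ∃ i, e i = n
    · obtain ⟨i, rfl⟩ := h
      exact Or.inl ⟨i, rfl, he.extend_apply _ _ _⟩
    · exact Or.inr (Function.extend_apply' _ _ _ h)
  have h := hP.indep (Function.extend e B fun _ => ∅) ?_ ?_ ?_
  · have h2 := h.precomp he
    simpa only [he.extend_apply] using h2
  · intro n
    rcases hcase n with ⟨i, -, h⟩ | h <;> rw [h]
    exacts [hB i, MeasurableSet.empty]
  · intro n
    rcases hcase n with ⟨i, -, h⟩ | h <;> rw [h]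
    exacts [hΛ i, by simp]
  · intro m n hmn
    rcases hcase m with ⟨i, hi, h⟩ | h <;> rw [h]
    · rcases hcase n with ⟨j, hj, h'⟩ | h' <;> rw [h']
      · refine hd fun hij => hmn ?_
        rw [← hi, ← hj, hij]
      · exact Set.disjoint_empty _
    · exact Set.empty_disjoint _

end IsPoissonProcess

lemma tendsto_prod_ite_of_finite {S : Set ℕ} (hS : S.Finite) (z : ℂ) [DecidablePred (· ∈ S)] :
    Tendsto (fun n => ∏ j ∈ Finset.range n, if j ∈ S then z else 1) atTop (𝓝 (z ^ S.ncard)) := by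
  obtain ⟨N, hN⟩ := hS.bddAbove
  refine tendsto_const_nhds.congr' ?_
  filter_upwards [eventually_gt_atTop N] with n hn
  rw [Finset.prod_ite, Finset.prod_const, Finset.prod_const_one, mul_one]
  congr 1
  rw [← Set.ncard_coe_finset]
  congr 1
  ext j
  simp only [Finset.coe_filter, Finset.mem_range, Set.mem_ofPred_eq]
  exact ⟨fun h => ⟨(hN h).trans_lt hn, h⟩, fun h => h.2⟩

lemma norm_prod_sub_prod_le_sum (n : ℕ) (a b : ℕ → ℂ) (ha : ∀ j, ‖a j‖ ≤ 1) (hb : ∀ j, ‖b j‖ ≤ 1) :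
    ‖∏ j ∈ Finset.range n, a j - ∏ j ∈ Finset.range n, b j‖ ≤
      ∑ j ∈ Finset.range n, ‖a j - b j‖ := by
  induction n with
  | zero => simp
  | succ n ih =>
    rw [Finset.prod_range_succ, Finset.prod_range_succ, Finset.sum_range_succ]
    have e : (∏ j ∈ Finset.range n, a j) * a n - (∏ j ∈ Finset.range n, b j) * b n =
        (∏ j ∈ Finset.range n, a j - ∏ j ∈ Finset.range n, b j) * a n +
          (∏ j ∈ Finset.range n, b j) * (a n - b n) := by ring
    have h1 : ‖∏ j ∈ Finset.range n, b j‖ ≤ 1 := by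
      rw [norm_prod]
      exact Finset.prod_le_one (fun _ _ => norm_nonneg _) fun j _ => hb j
    rw [e]
    refine (norm_add_le _ _).trans (add_le_add ?_ ?_)
    · rw [norm_mul]
      exact (mul_le_of_le_one_right (norm_nonneg _) (ha n)).trans ih
    · rw [norm_mul]
      exact mul_le_of_le_one_left (norm_nonneg _) h1

lemma norm_prod_range_le_one (n : ℕ) {a : ℕ → ℂ} (ha : ∀ j, ‖a j‖ ≤ 1) :
    ‖∏ j ∈ Finset.range n, a j‖ ≤ 1 := by
  rw [norm_prod]
  exact Finset.prod_le_one (fun _ _ => norm_nonneg _) fun j _ => ha j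

namespace IsPoissonProcess

variable (hP : IsPoissonProcess P Λ u)
include hP

/-- The generating function of the number of points in a set. -/
lemma integral_pow_pointCount {B : Set E} (hB : MeasurableSet B) (hΛ : Λ B < ∞) (z : ℂ) :
    ∫ ω, z ^ ⌊(pointCount u B ω).toReal⌋₊ ∂P = Complex.exp ((Λ B).toReal * (z - 1)) := by
  have hm : Measurable fun x : ℝ≥0∞ => z ^ ⌊x.toReal⌋₊ :=
    (measurable_of_countable fun n : ℕ => z ^ n).comp
      (Nat.measurable_floor.comp ENNReal.measurable_toReal)
  have h := integral_map (μ := P) (f := fun x : ℝ≥0∞ => z ^ ⌊x.toReal⌋₊)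
    (measurable_pointCount hP.measurable hB).aemeasurable hm.aestronglyMeasurable
  rw [← h, hP.map_pointCount B hB hΛ, integral_map (by fun_prop) hm.aestronglyMeasurable]
  simp only [ENNReal.toReal_natCast, Nat.floor_natCast]
  rw [integral_pow_poissonMeasure]
  rfl

/-- The generating functional of a Poisson process at a simple function: the product over the points
is a finite product of powers, whose exponents are independent Poisson variables. -/
lemma tendsto_integral_prod_simpleFunc [IsProbabilityMeasure P] (g : SimpleFunc E ℂ)
    (hg : Integrable g Λ) (hg1 : ∀ x, ‖1 + g x‖ ≤ 1) :
    Tendsto (fun n => ∫ ω, ∏ j ∈ Finset.range n, (1 + g (u j ω)) ∂P) atTop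
      (𝓝 (Complex.exp (∫ x, g x ∂Λ))) := by
  classical
  obtain ⟨T, hT⟩ : ∃ T, T = g.range.filter (· ≠ 0) := ⟨_, rfl⟩
  let B : T → Set E := fun c => g ⁻¹' {c.1}
  have hB : ∀ c, MeasurableSet (B c) := fun c => g.measurableSet_preimage _
  have hc0 : ∀ c : T, c.1 ≠ 0 := fun c =>
    (Finset.mem_filter.mp ((Finset.ext_iff.mp hT c.1).mp c.2)).2
  have hΛ : ∀ c, Λ (B c) < ∞ := fun c => g.measure_preimage_lt_top_of_integrable hg (hc0 c)
  have hd : Pairwise fun c d => Disjoint (B c) (B d) := by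
    intro c d hcd
    refine Set.disjoint_left.mpr fun x hx hx' => hcd (Subtype.ext ?_)
    exact (Set.mem_singleton_iff.mp hx).symm.trans (Set.mem_singleton_iff.mp hx')
  have hone : ∀ x, 1 + g x = ∏ c : T, if x ∈ B c then 1 + c.1 else 1 := by
    intro x
    by_cases hx : g x = 0
    · rw [Finset.prod_eq_one, hx, add_zero]
      intro c _
      rw [if_neg]
      intro h
      exact hc0 c ((Set.mem_singleton_iff.mp h).symm.trans hx)
    · have hmem : g x ∈ T := hT ▸
        Finset.mem_filter.mpr ⟨g.mem_range_self x, hx⟩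
      rw [Finset.prod_eq_single (⟨g x, hmem⟩ : T)]
      · rw [if_pos]
        exact Set.mem_singleton _
      · intro d _ hd'
        rw [if_neg]
        intro h
        exact hd' (Subtype.ext (Set.mem_singleton_iff.mp h).symm)
      · simp
  have hlim : ∀ᵐ ω ∂P, Tendsto (fun n => ∏ j ∈ Finset.range n, (1 + g (u j ω))) atTop
      (𝓝 (∏ c : T, (1 + c.1) ^ ⌊(pointCount u (B c) ω).toReal⌋₊)) := by
    have hfin : ∀ᵐ ω ∂P, ∀ c : T, pointCount u (B c) ω < ∞ :=
      ae_all_iff.mpr fun c => hP.ae_pointCount_lt_top (hB c) (hΛ c)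
    filter_upwards [hfin] with ω hω
    have e : ∀ n, ∏ j ∈ Finset.range n, (1 + g (u j ω)) =
        ∏ c : T, ∏ j ∈ Finset.range n, if j ∈ {j | u j ω ∈ B c} then 1 + c.1 else 1 := by
      intro n
      rw [Finset.prod_comm]
      exact Finset.prod_congr rfl fun j _ => hone _
    simp_rw [e]
    refine tendsto_finsetProd _ fun c _ => ?_
    have hc := hω c
    rw [pointCount_eq_encard] at hc ⊢
    have hS : ({j | u j ω ∈ B c} : Set ℕ).Finite := by
      rw [← Set.encard_lt_top_iff]
      simpa using hc
    have h := tendsto_prod_ite_of_finite hS (1 + c.1)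
    rwa [← hS.cast_ncard_eq, ENat.toENNReal_coe, ENNReal.toReal_natCast, Nat.floor_natCast]
  have hmeas : ∀ n, Measurable fun ω => ∏ j ∈ Finset.range n, (1 + g (u j ω)) := fun n =>
    Finset.measurable_fun_prod _ fun j _ =>
      measurable_const.add (g.measurable.comp (hP.measurable j))
  have h := tendsto_integral_of_dominated_convergence (μ := P) (fun _ => (1 : ℝ))
    (fun n => (hmeas n).aestronglyMeasurable) (integrable_const _)
    (fun n => ae_of_all _ fun ω => norm_prod_range_le_one n fun j => hg1 _) hlim
  convert h using 2
  have hm : ∀ z : ℂ, Measurable fun x : ℝ≥0∞ => z ^ ⌊x.toReal⌋₊ := fun z =>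
    (measurable_of_countable fun n : ℕ => z ^ n).comp
      (Nat.measurable_floor.comp ENNReal.measurable_toReal)
  have hind := (hP.iIndepFun_pointCount hB hΛ hd).comp
    (fun c : T => fun x : ℝ≥0∞ => (1 + c.1) ^ ⌊x.toReal⌋₊) fun c => hm _
  have h2 := hind.integral_fun_prod_eq_prod_integral fun c =>
    ((hm _).comp (measurable_pointCount hP.measurable (hB c))).aestronglyMeasurable
  simp only [Function.comp_def] at h2
  rw [h2]
  simp_rw [hP.integral_pow_pointCount (hB _) (hΛ _)]
  rw [← Complex.exp_sum, ← SimpleFunc.integral_eq_integral g hg,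
    SimpleFunc.integral_eq_sum_of_subset (s := T) hT.ge]
  congr 1
  rw [← Finset.sum_coe_sort]
  refine Finset.sum_congr rfl fun c _ => ?_
  simp only [Complex.real_smul, Measure.real]
  ring

/-- The intensity bounds the effect of changing the factors of a product over the points. -/
lemma norm_integral_prod_sub_le [IsProbabilityMeasure P] [SigmaFinite Λ] {s t : E → ℂ}
    (hs : Measurable s) (ht : Measurable t) (hs1 : ∀ x, ‖s x‖ ≤ 1) (ht1 : ∀ x, ‖t x‖ ≤ 1)
    (n : ℕ) :
    ‖∫ ω, ∏ j ∈ Finset.range n, s (u j ω) ∂P - ∫ ω, ∏ j ∈ Finset.range n, t (u j ω) ∂P‖ₑ ≤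
      ∫⁻ x, ‖s x - t x‖ₑ ∂Λ := by
  have hi : ∀ {s : E → ℂ}, Measurable s → (∀ x, ‖s x‖ ≤ 1) →
      Integrable (fun ω => ∏ j ∈ Finset.range n, s (u j ω)) P := by
    intro s hs hs1
    refine Integrable.of_bound (Finset.measurable_fun_prod _ fun j _ =>
      hs.comp (hP.measurable j)).aestronglyMeasurable 1 (ae_of_all _ fun ω => ?_)
    exact norm_prod_range_le_one n fun j => hs1 _
  rw [← integral_sub (hi hs hs1) (hi ht ht1)]
  refine (enorm_integral_le_lintegral_enorm _).trans ?_
  calc ∫⁻ ω, ‖∏ j ∈ Finset.range n, s (u j ω) - ∏ j ∈ Finset.range n, t (u j ω)‖ₑ ∂P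
      ≤ ∫⁻ ω, ∑' j, ‖s (u j ω) - t (u j ω)‖ₑ ∂P := by
        refine lintegral_mono fun ω => ?_
        refine le_trans ?_ (ENNReal.sum_le_tsum (Finset.range n))
        have h := norm_prod_sub_prod_le_sum n (fun j => s (u j ω)) (fun j => t (u j ω))
          (fun j => hs1 _) (fun j => ht1 _)
        rw [← ofReal_norm]
        refine (ENNReal.ofReal_le_ofReal h).trans ?_
        rw [ENNReal.ofReal_sum_of_nonneg fun _ _ => norm_nonneg _]
        exact (Finset.sum_congr rfl fun j _ => ofReal_norm _).le
    _ = ∫⁻ x, ‖s x - t x‖ₑ ∂Λ := by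
        have hm : Measurable fun x => ‖s x - t x‖ₑ := (hs.sub ht).enorm
        have hm' : ∀ j, AEMeasurable (fun ω => ‖s (u j ω) - t (u j ω)‖ₑ) P := fun j =>
          (hm.comp (hP.measurable j)).aemeasurable
        rw [lintegral_tsum hm', ← hP.sum_map_eq,
          lintegral_sum_measure]
        refine tsum_congr fun j => ?_
        rw [lintegral_map hm (hP.measurable j)]

/-- The generating functional of a Poisson process:
`E ∏ⱼ s(uⱼ) = exp ∫ (s - 1) dΛ` for `|s| ≤ 1` with `s - 1` integrable. -/
lemma tendsto_integral_prod [IsProbabilityMeasure P] [SigmaFinite Λ] {s : E → ℂ}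
    (hs : Measurable s) (hs1 : ∀ x, ‖s x‖ ≤ 1) (hsi : Integrable (fun x => s x - 1) Λ) :
    Tendsto (fun n => ∫ ω, ∏ j ∈ Finset.range n, s (u j ω) ∂P) atTop
      (𝓝 (Complex.exp (∫ x, (s x - 1) ∂Λ))) := by
  let D : Set ℂ := {z | ‖1 + z‖ ≤ 1}
  have h0 : (0 : ℂ) ∈ D := by simp [D]
  have hm : Measurable fun x => s x - 1 := hs.sub_const 1
  let g : ℕ → SimpleFunc E ℂ := SimpleFunc.approxOn (fun x => s x - 1) hm D 0 h0
  have hmem : ∀ᵐ x ∂Λ, s x - 1 ∈ closure D :=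
    ae_of_all _ fun x => subset_closure (by simpa [D] using hs1 x)
  have hg1 : ∀ m x, ‖1 + g m x‖ ≤ 1 := fun m x => SimpleFunc.approxOn_mem hm h0 m x
  have hgi : ∀ m, Integrable (g m) Λ := fun m =>
    SimpleFunc.integrable_approxOn hm hsi h0 (integrable_zero _ _ _) m
  have hlim : Tendsto (fun m => ∫⁻ x, ‖g m x - (s x - 1)‖ₑ ∂Λ) atTop (𝓝 0) :=
    SimpleFunc.tendsto_approxOn_L1_enorm hm h0 hmem (by simpa using hsi.2)
  have hexp : Tendsto (fun m => Complex.exp (∫ x, g m x ∂Λ)) atTop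
      (𝓝 (Complex.exp (∫ x, (s x - 1) ∂Λ))) :=
    (Complex.continuous_exp.tendsto _).comp
      (tendsto_integral_of_L1 _ hsi.1 (Eventually.of_forall hgi) hlim)
  -- `E ∏ⱼ (1 + g m)(uⱼ)` approximates `E ∏ⱼ s(uⱼ)` uniformly in the number of factors
  rw [Metric.tendsto_atTop']
  intro ε hε
  have hε3 : 0 < ε / 3 := by positivity
  obtain ⟨m, hm1, hm2⟩ := ((hlim.eventually (gt_mem_nhds (ENNReal.ofReal_pos.mpr hε3))).and
    (Metric.tendsto_nhds.mp hexp _ hε3)).exists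
  obtain ⟨N, hN⟩ := Metric.tendsto_atTop'.mp
    (hP.tendsto_integral_prod_simpleFunc (g m) (hgi m) (hg1 m)) _ hε3
  refine ⟨N, fun n hn => ?_⟩
  have h1 : dist (∫ ω, ∏ j ∈ Finset.range n, s (u j ω) ∂P)
      (∫ ω, ∏ j ∈ Finset.range n, (1 + g m (u j ω)) ∂P) < ε / 3 := by
    have h := hP.norm_integral_prod_sub_le (s := fun x => 1 + g m x) (t := s)
      (measurable_const.add (g m).measurable) hs (hg1 m) hs1 n
    have e : ∀ x, 1 + g m x - s x = g m x - (s x - 1) := fun x => by ring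
    simp_rw [e] at h
    have h2 := h.trans_lt hm1
    rw [← ofReal_norm, ENNReal.ofReal_lt_ofReal_iff hε3] at h2
    rwa [dist_comm, dist_eq_norm]
  have h3 := dist_triangle4 (∫ ω, ∏ j ∈ Finset.range n, s (u j ω) ∂P)
    (∫ ω, ∏ j ∈ Finset.range n, (1 + g m (u j ω)) ∂P) (Complex.exp (∫ x, g m x ∂Λ))
    (Complex.exp (∫ x, (s x - 1) ∂Λ))
  linarith [hN n hn]

end IsPoissonProcess

end PoissonProcess

/-! ### Independently marked Poisson processes -/

/-- The points `u j` of a Poisson process with intensity `Λ` carry i.i.d. marks `Y j` with law `Q`,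
independent of the points. -/
structure IsMarkedPoisson {Ω E F : Type*} [MeasurableSpace Ω] [MeasurableSpace E]
    [MeasurableSpace F] (P : Measure Ω) (Λ : Measure E) (Q : Measure F) (u : ℕ → Ω → E)
    (Y : ℕ → Ω → F) : Prop where
  poisson : IsPoissonProcess P Λ u
  measurable_mark : ∀ j, Measurable (Y j)
  map_mark : ∀ j, P.map (Y j) = Q
  iIndep : iIndepFun Y P
  indep : IndepFun (fun ω j => u j ω) (fun ω j => Y j ω) P

namespace IsMarkedPoisson

variable {Ω E F : Type*} [MeasurableSpace Ω] [MeasurableSpace E] [MeasurableSpace F]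
  {P : Measure Ω} {Λ : Measure E} {Q : Measure F} {u : ℕ → Ω → E} {Y : ℕ → Ω → F}

section

variable (h : IsMarkedPoisson P Λ Q u Y)
include h

lemma measurable_pair (j : ℕ) : Measurable fun ω => (u j ω, Y j ω) :=
  (h.poisson.measurable j).prodMk (h.measurable_mark j)

variable [IsProbabilityMeasure P]

lemma isProbabilityMeasure_mark : IsProbabilityMeasure Q := by
  rw [← h.map_mark 0]
  exact Measure.isProbabilityMeasure_map (h.measurable_mark 0).aemeasurable

variable [SigmaFinite Λ]

/-- The intensity measure of the marked process (Campbell's theorem). -/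
lemma sum_map_eq : Measure.sum (fun j => P.map fun ω => (u j ω, Y j ω)) = Λ.prod Q := by
  have := h.isProbabilityMeasure_mark
  rw [← h.poisson.sum_map_eq, Measure.prod_sum_left]
  congr 1
  funext j
  have hj : IndepFun (u j) (Y j) P :=
    h.indep.comp (measurable_pi_apply j) (measurable_pi_apply j)
  rw [(indepFun_iff_map_prod_eq_prod_map_map (h.poisson.measurable j).aemeasurable
    (h.measurable_mark j).aemeasurable).mp hj, h.map_mark]

lemma lintegral_tsum_eq {f : E × F → ℝ≥0∞} (hf : Measurable f) :
    ∫⁻ ω, ∑' j, f (u j ω, Y j ω) ∂P = ∫⁻ z, f z ∂(Λ.prod Q) := by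
  have hm : ∀ j, AEMeasurable (fun ω => f (u j ω, Y j ω)) P := fun j =>
    (hf.comp (h.measurable_pair j)).aemeasurable
  rw [lintegral_tsum hm, ← h.sum_map_eq, lintegral_sum_measure]
  exact tsum_congr fun j => (lintegral_map hf (h.measurable_pair j)).symm

lemma ae_summable {f : E × F → ℝ} (hf : Measurable f) (hfi : Integrable f (Λ.prod Q)) :
    ∀ᵐ ω ∂P, Summable fun j => ‖f (u j ω, Y j ω)‖ := by
  have hm : Measurable fun ω => ∑' j, ‖f (u j ω, Y j ω)‖ₑ :=
    Measurable.tsum fun j => hf.enorm.comp (h.measurable_pair j)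
  have hlt := ae_lt_top hm (by
    rw [h.lintegral_tsum_eq (f := fun z => ‖f z‖ₑ) hf.enorm]
    exact hfi.2.ne)
  filter_upwards [hlt] with ω hω
  have := ENNReal.summable_toReal hω.ne
  simpa using this

omit [SigmaFinite Λ] in
/-- Averaging over the marks first. -/
lemma integral_prod_eq {g : E × F → ℂ} (hg : Measurable g) (hg1 : ∀ z, ‖g z‖ ≤ 1) (n : ℕ) :
    ∫ ω, ∏ j ∈ Finset.range n, g (u j ω, Y j ω) ∂P =
      ∫ ω, ∏ j ∈ Finset.range n, (∫ y, g (u j ω, y) ∂Q) ∂P := by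
  have := h.isProbabilityMeasure_mark
  have hU : Measurable fun ω j => u j ω := measurable_pi_lambda _ h.poisson.measurable
  have hY : Measurable fun ω j => Y j ω := measurable_pi_lambda _ h.measurable_mark
  have hmap := (indepFun_iff_map_prod_eq_prod_map_map hU.aemeasurable hY.aemeasurable).mp h.indep
  have hG : Measurable fun z : (ℕ → E) × (ℕ → F) => ∏ j ∈ Finset.range n, g (z.1 j, z.2 j) :=
    Finset.measurable_fun_prod _ fun j _ => hg.comp
      (((measurable_pi_apply j).comp measurable_fst).prodMk
        ((measurable_pi_apply j).comp measurable_snd))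
  have hi : Measurable fun x : ℕ → E => ∏ j ∈ Finset.range n, ∫ y, g (x j, y) ∂Q :=
    Finset.measurable_fun_prod _ fun j _ =>
      (hg.stronglyMeasurable.integral_prod_right' (ν := Q)).measurable.comp
        (measurable_pi_apply j)
  have : IsProbabilityMeasure (P.map fun ω j => u j ω) :=
    Measure.isProbabilityMeasure_map hU.aemeasurable
  have : IsProbabilityMeasure (P.map fun ω j => Y j ω) :=
    Measure.isProbabilityMeasure_map hY.aemeasurable
  rw [← integral_map (φ := fun ω => (fun j => u j ω, fun j => Y j ω))
    (f := fun z : (ℕ → E) × (ℕ → F) => ∏ j ∈ Finset.range n, g (z.1 j, z.2 j))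
    (hU.prodMk hY).aemeasurable hG.aestronglyMeasurable, hmap, integral_prod]
  · rw [← integral_map (φ := fun ω j => u j ω)
      (f := fun x : ℕ → E => ∏ j ∈ Finset.range n, ∫ y, g (x j, y) ∂Q)
      hU.aemeasurable hi.aestronglyMeasurable]
    congr with x
    have hGx : Measurable fun y : ℕ → F => ∏ j ∈ Finset.range n, g (x j, y j) :=
      hG.comp (measurable_const.prodMk measurable_id)
    rw [integral_map hY.aemeasurable hGx.aestronglyMeasurable]
    have hgx : ∀ j, Measurable fun y => g (x j, y) := fun j =>
      hg.comp (measurable_const.prodMk measurable_id)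
    have hind := (h.iIndep.precomp (g := fun i : Fin n => (i : ℕ)) Fin.val_injective).comp
      (fun i y => g (x i, y)) fun i => hgx i
    have h2 := hind.integral_fun_prod_eq_prod_integral fun i =>
      ((hgx i).comp (h.measurable_mark i)).aestronglyMeasurable
    simp only [Function.comp_def] at h2
    simp_rw [Finset.prod_range]
    rw [h2]
    refine Finset.prod_congr rfl fun i _ => ?_
    rw [← h.map_mark i, integral_map (h.measurable_mark i).aemeasurable
      (hgx i).aestronglyMeasurable]
  · refine Integrable.of_bound hG.aestronglyMeasurable 1 (ae_of_all _ fun z => ?_)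
    exact norm_prod_range_le_one n fun j => hg1 _

/-- The generating functional of the marked process. -/
lemma tendsto_integral_prod {g : E × F → ℂ} (hg : Measurable g) (hg1 : ∀ z, ‖g z‖ ≤ 1)
    (hgi : Integrable (fun z => g z - 1) (Λ.prod Q)) :
    Tendsto (fun n => ∫ ω, ∏ j ∈ Finset.range n, g (u j ω, Y j ω) ∂P) atTop
      (𝓝 (Complex.exp (∫ z, (g z - 1) ∂(Λ.prod Q)))) := by
  have := h.isProbabilityMeasure_mark
  simp_rw [h.integral_prod_eq hg hg1]
  have hgx : ∀ x, Integrable (fun y => g (x, y)) Q := fun x =>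
    Integrable.of_bound (hg.comp (measurable_const.prodMk measurable_id)).aestronglyMeasurable 1
      (ae_of_all _ fun y => hg1 _)
  have he : ∀ x, ∫ y, g (x, y) ∂Q - 1 = ∫ y, (g (x, y) - 1) ∂Q := fun x => by
    rw [integral_sub (hgx x) (integrable_const _)]
    simp
  rw [integral_prod _ hgi]
  simp_rw [← he]
  refine h.poisson.tendsto_integral_prod (s := fun x => ∫ y, g (x, y) ∂Q)
    (hg.stronglyMeasurable.integral_prod_right' (ν := Q)).measurable (fun x => ?_) ?_
  · refine (norm_integral_le_of_norm_le_const (ae_of_all _ fun y => hg1 _)).trans ?_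
    simp
  · simp_rw [he]
    exact hgi.integral_prod_left

/-- The characteristic functional of the marked process:
`E exp(i ∑ⱼ f(uⱼ, Yⱼ)) = exp ∫ (e^{if} - 1) d(Λ ⊗ Q)`. -/
lemma integral_exp_tsum {f : E × F → ℝ} (hf : Measurable f) (hfi : Integrable f (Λ.prod Q)) :
    ∫ ω, Complex.exp ((∑' j, f (u j ω, Y j ω) : ℝ) * Complex.I) ∂P =
      Complex.exp (∫ z, (Complex.exp (f z * Complex.I) - 1) ∂(Λ.prod Q)) := by
  have hg : Measurable fun z => Complex.exp (f z * Complex.I) := by fun_prop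
  have hg1 : ∀ z, ‖Complex.exp (f z * Complex.I)‖ ≤ 1 := fun z =>
    (Complex.norm_exp_ofReal_mul_I _).le
  have hgi : Integrable (fun z => Complex.exp (f z * Complex.I) - 1) (Λ.prod Q) := by
    refine hfi.mono (hg.sub_const 1).aestronglyMeasurable (ae_of_all _ fun z => ?_)
    rw [mul_comm]
    exact Real.norm_exp_I_mul_ofReal_sub_one_le
  refine tendsto_nhds_unique ?_ (h.tendsto_integral_prod hg hg1 hgi)
  refine tendsto_integral_of_dominated_convergence (fun _ => (1 : ℝ))
    (fun n => (Finset.measurable_fun_prod _ fun j _ =>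
      hg.comp (h.measurable_pair j)).aestronglyMeasurable) (integrable_const _)
    (fun n => ae_of_all _ fun ω => norm_prod_range_le_one n fun j => hg1 _) ?_
  filter_upwards [h.ae_summable hf hfi] with ω hω
  have hs := hω.of_norm.hasSum.tendsto_sum_nat
  have hc : Continuous fun x : ℝ => Complex.exp (x * Complex.I) := by fun_prop
  refine ((hc.tendsto _).comp hs).congr fun n => ?_
  simp only [Function.comp_apply]
  push_cast
  rw [Finset.sum_mul, Complex.exp_sum]

/-- The mean of a sum over the marked process (Campbell's formula). -/
lemma integral_tsum_eq {f : E × F → ℝ} (hf : Measurable f) (hfi : Integrable f (Λ.prod Q)) :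
    Integrable (fun ω => ∑' j, f (u j ω, Y j ω)) P ∧
      ∫ ω, ∑' j, f (u j ω, Y j ω) ∂P = ∫ z, f z ∂(Λ.prod Q) := by
  have hmeas : ∀ j, AEStronglyMeasurable (fun ω => f (u j ω, Y j ω)) P := fun j =>
    (hf.comp (h.measurable_pair j)).aestronglyMeasurable
  have hfin : ∑' j, ∫⁻ ω, ‖f (u j ω, Y j ω)‖ₑ ∂P ≠ ∞ := by
    rw [← lintegral_tsum fun j => (hmeas j).enorm,
      h.lintegral_tsum_eq (f := fun z => ‖f z‖ₑ) hf.enorm]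
    exact hfi.2.ne
  constructor
  · refine ⟨(Measurable.tsum fun j => hf.comp (h.measurable_pair j)).aestronglyMeasurable, ?_⟩
    refine lt_of_le_of_lt (lintegral_mono fun ω => ?_)
      ((lintegral_tsum fun j => (hmeas j).enorm).trans_lt hfin.lt_top)
    exact enorm_tsum_le_tsum_enorm
  · have h1 := integral_tsum hmeas hfin
    rw [h1]
    have hfi' := hfi
    rw [← h.sum_map_eq] at hfi' ⊢
    rw [integral_sum_measure hfi']
    exact tsum_congr fun j =>
      (integral_map (h.measurable_pair j).aemeasurable hf.aestronglyMeasurable).symm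

end

/-- The real number of points of the marked process in `B`. -/
noncomputable def count (u : ℕ → Ω → E) (Y : ℕ → Ω → F) (B : Set (E × F)) (ω : Ω) : ℝ :=
  ∑' j, B.indicator (fun _ => (1 : ℝ)) (u j ω, Y j ω)

section

variable (h : IsMarkedPoisson P Λ Q u Y)
include h

lemma measurable_count {B : Set (E × F)} (hB : MeasurableSet B) : Measurable (count u Y B) :=
  Measurable.tsum fun j => (measurable_const.indicator hB).comp (h.measurable_pair j)

variable [IsProbabilityMeasure P] [SigmaFinite Λ]

/-- The joint characteristic function of the numbers of points in disjoint sets. -/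
lemma integral_exp_sum_count {ι : Type*} [Fintype ι] {B : ι → Set (E × F)}
    (hB : ∀ i, MeasurableSet (B i)) (hΛ : ∀ i, (Λ.prod Q) (B i) < ∞)
    (hd : Pairwise fun i j => Disjoint (B i) (B j)) (t : ι → ℝ) :
    ∫ ω, Complex.exp ((∑ i, t i * count u Y (B i) ω : ℝ) * Complex.I) ∂P =
      ∏ i, Complex.exp (((Λ.prod Q) (B i)).toReal * (Complex.exp (t i * Complex.I) - 1)) := by
  classical
  have := h.isProbabilityMeasure_mark
  have hone : ∀ i, Integrable ((B i).indicator fun _ => (1 : ℝ)) (Λ.prod Q) := fun i =>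
    (integrable_indicator_iff (hB i)).mpr (integrableOn_const (hΛ i).ne)
  have hm : ∀ i, Measurable ((B i).indicator fun _ => (1 : ℝ)) := fun i =>
    measurable_const.indicator (hB i)
  have hf := h.integral_exp_tsum (f := fun z => ∑ i, t i * (B i).indicator (fun _ => (1 : ℝ)) z)
    (Finset.measurable_fun_sum _ fun i _ => (hm i).const_mul _)
    (integrable_finsetSum _ fun i _ => (hone i).const_mul _)
  have hs : ∀ᵐ ω ∂P, ∀ i, Summable fun j => (B i).indicator (fun _ => (1 : ℝ)) (u j ω, Y j ω) :=
    ae_all_iff.mpr fun i => (h.ae_summable (hm i) (hone i)).mono fun ω hω => hω.of_norm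
  have e1 : ∀ᵐ ω ∂P, Complex.exp ((∑ i, t i * count u Y (B i) ω : ℝ) * Complex.I) =
      Complex.exp ((∑' j, ∑ i, t i * (B i).indicator (fun _ => (1 : ℝ)) (u j ω, Y j ω) : ℝ) *
        Complex.I) := by
    filter_upwards [hs] with ω hω
    rw [Summable.tsum_finsetSum fun i _ => (hω i).mul_left _]
    simp_rw [tsum_mul_left]
    rfl
  rw [integral_congr_ae e1, hf, ← Complex.exp_sum]
  congr 1
  have e2 : ∀ z, Complex.exp (((∑ i, t i * (B i).indicator (fun _ => (1 : ℝ)) z : ℝ) : ℂ) *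
      Complex.I) - 1 = ∑ i, (B i).indicator (fun _ => Complex.exp (t i * Complex.I) - 1) z := by
    intro z
    by_cases hz : ∃ i, z ∈ B i
    · obtain ⟨i, hi⟩ := hz
      have hne : ∀ k, k ≠ i → z ∉ B k := fun k hk hzk =>
        Set.disjoint_left.mp (hd hk) hzk hi
      rw [Finset.sum_eq_single i, Finset.sum_eq_single i]
      · simp [hi]
      · intro k _ hk
        simp [hne k hk]
      · simp
      · intro k _ hk
        simp [hne k hk]
      · simp
    · push Not at hz
      rw [Finset.sum_eq_zero, Finset.sum_eq_zero]
      · simp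
      · intro k _
        simp [hz k]
      · intro k _
        simp [hz k]
  simp_rw [e2]
  rw [integral_finsetSum]
  · refine Finset.sum_congr rfl fun i _ => ?_
    rw [integral_indicator_const _ (hB i)]
    rfl
  · intro i _
    exact (integrable_indicator_iff (hB i)).mpr (integrableOn_const (hΛ i).ne)

lemma map_count {B : Set (E × F)} (hB : MeasurableSet B) (hΛ : (Λ.prod Q) B < ∞) :
    P.map (count u Y B) =
      (poissonMeasure ((Λ.prod Q) B).toNNReal).map (fun n : ℕ => (n : ℝ)) := by
  have hc := h.measurable_count hB
  have : IsProbabilityMeasure (P.map (count u Y B)) :=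
    Measure.isProbabilityMeasure_map hc.aemeasurable
  refine Measure.ext_of_charFun ?_
  funext t
  rw [charFun_map_cast_poissonMeasure, charFun_apply_real,
    integral_map hc.aemeasurable (by fun_prop)]
  have h1 := h.integral_exp_sum_count (ι := Unit) (B := fun _ => B) (fun _ => hB) (fun _ => hΛ)
    (fun i j hij => absurd (Subsingleton.elim i j) hij) (fun _ => t)
  have e : ((((Λ.prod Q) B).toNNReal : ℝ≥0) : ℂ) = (((Λ.prod Q) B).toReal : ℂ) := rfl
  rw [e]
  simpa using h1

/-- The marked process is again Poisson: the numbers of marked points in disjoint sets are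
independent. -/
lemma iIndepFun_count {ι : Type*} [Fintype ι] {B : ι → Set (E × F)}
    (hB : ∀ i, MeasurableSet (B i)) (hΛ : ∀ i, (Λ.prod Q) (B i) < ∞)
    (hd : Pairwise fun i j => Disjoint (B i) (B j)) :
    iIndepFun (fun i => count u Y (B i)) P := by
  have hc : ∀ i, Measurable (count u Y (B i)) := fun i => h.measurable_count (hB i)
  rw [iIndepFun_iff_charFun_pi fun i => (hc i).aemeasurable]
  intro t
  have hL : Measurable fun ω => WithLp.toLp 2 fun i => count u Y (B i) ω :=
    (WithLp.measurable_toLp 2 _).comp (measurable_pi_lambda _ hc)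
  rw [charFun_apply, integral_map hL.aemeasurable (by fun_prop)]
  have h1 := h.integral_exp_sum_count hB hΛ hd t
  have e : ∀ i, charFun (P.map (count u Y (B i))) (t i) =
      Complex.exp (((Λ.prod Q) (B i)).toReal * (Complex.exp (t i * Complex.I) - 1)) := by
    intro i
    rw [h.map_count (hB i) (hΛ i), charFun_map_cast_poissonMeasure]
    rfl
  simp_rw [e]
  rw [← h1]
  congr with ω

end

end IsMarkedPoisson

/-! ### Decorrelation of functions of Charlier rank two -/

lemma integrable_fun_sub {X : Type*} [MeasurableSpace X] {m : Measure X} {f g : X → ℝ}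
    (hf : Integrable f m) (hg : Integrable g m) : Integrable (fun x => f x - g x) m :=
  hf.sub hg

lemma integrable_pow_poissonMeasure (r : ℝ≥0) (k : ℕ) :
    Integrable (fun n : ℕ => (n : ℝ) ^ k) (poissonMeasure r) := by
  have he : Integrable (fun n : ℕ => Real.exp n) (poissonMeasure r) := by
    rw [integrable_poissonMeasure_iff]
    have h := (Real.summable_pow_div_factorial (r * Real.exp 1)).mul_left (Real.exp (-r))
    refine h.congr fun n => ?_
    rw [mul_pow, ← Real.exp_nat_mul, mul_one, Real.norm_of_nonneg (Real.exp_pos _).le]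
    ring
  refine (he.const_mul (k.factorial : ℝ)).mono' (by fun_prop) (ae_of_all _ fun n => ?_)
  have h := Real.pow_div_factorial_le_exp (n : ℝ) n.cast_nonneg k
  have hk : (0 : ℝ) < k.factorial := by exact_mod_cast k.factorial_pos
  rw [div_le_iff₀ hk] at h
  rw [Real.norm_of_nonneg (by positivity)]
  linarith

lemma integrable_poissonMeasure_of_linear_growth {f : ℕ → ℝ} {K : ℝ}
    (hf : ∀ n : ℕ, |f n| ≤ K * (1 + n)) (r : ℝ≥0) : Integrable f (poissonMeasure r) := by
  have h1 := integrable_pow_poissonMeasure r 1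
  simp only [pow_one] at h1
  exact (((integrable_const (1 : ℝ)).add h1).const_mul K).mono' (by fun_prop) (ae_of_all _ hf)

lemma integral_comp_add_poissonMeasure {f : ℕ → ℝ} {K : ℝ} (hf : ∀ n : ℕ, |f n| ≤ K * (1 + n))
    (r a : ℝ≥0) :
    ∫ n, f n ∂(poissonMeasure (r + a)) =
      ∫ m, ∫ l, f (m + l) ∂(poissonMeasure a) ∂(poissonMeasure r) := by
  have hi := integrable_poissonMeasure_of_linear_growth hf (r + a)
  rw [← poissonMeasure_conv_poissonMeasure] at hi ⊢
  exact integral_conv hi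

section SecondDifference

variable {f : ℕ → ℝ} {K : ℝ}

lemma abs_diff_sub_diff_zero_le (hf : ∀ n, |f (n + 2) - 2 * f (n + 1) + f n| ≤ K) (m : ℕ) :
    |f (m + 1) - f m - (f 1 - f 0)| ≤ K * m := by
  induction m with
  | zero => simp
  | succ m ih =>
    have h := hf m
    rw [abs_le] at h ih ⊢
    push_cast
    constructor <;> linarith [h.1, h.2, ih.1, ih.2]

lemma abs_sub_linear_le (hf : ∀ n, |f (n + 2) - 2 * f (n + 1) + f n| ≤ K) (m : ℕ) :
    |f m - f 0 - m * (f 1 - f 0)| ≤ K * (m * (m - 1)) := by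
  have hK : 0 ≤ K := (abs_nonneg _).trans (hf 0)
  induction m with
  | zero => simp
  | succ m ih =>
    have h := abs_diff_sub_diff_zero_le hf m
    have hm : 0 ≤ K * m := by positivity
    rw [abs_le] at h ih ⊢
    push_cast
    constructor <;> nlinarith [h.1, h.2, ih.1, ih.2]

/-- A function with bounded second difference, whose mean and whose mean difference vanish, has
second moment of order `r ^ 2` under the Poisson law with small parameter `r`. -/
lemma integral_sq_poissonMeasure_le (hf : ∀ n, |f (n + 2) - 2 * f (n + 1) + f n| ≤ K) {r : ℝ≥0}
    (hfi : Integrable f (poissonMeasure r))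
    (hfi' : Integrable (fun n => f (n + 1)) (poissonMeasure r))
    (h0 : ∫ n, f n ∂(poissonMeasure r) = 0)
    (h1 : ∫ n, (f (n + 1) - f n) ∂(poissonMeasure r) = 0) :
    ∫ n, f n ^ 2 ∂(poissonMeasure r) ≤ 3 * K ^ 2 * r ^ 2 * (6 * r ^ 2 + 5 * r + 2) := by
  have hK : 0 ≤ K := (abs_nonneg _).trans (hf 0)
  have hr : (0 : ℝ) ≤ r := r.2
  -- the factorial moments that are needed
  have i1 := integrable_descFactorial_poissonMeasure r 1
  have i2 := integrable_descFactorial_poissonMeasure r 2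
  have i3 := integrable_descFactorial_poissonMeasure r 3
  have i4 := integrable_descFactorial_poissonMeasure r 4
  have m1 := integral_descFactorial_poissonMeasure r 1
  have m2 := integral_descFactorial_poissonMeasure r 2
  have m3 := integral_descFactorial_poissonMeasure r 3
  have m4 := integral_descFactorial_poissonMeasure r 4
  have d1 : ∀ n : ℕ, (n.descFactorial 1 : ℝ) = n := fun n => by simp
  have d2 : ∀ n : ℕ, (n.descFactorial 2 : ℝ) = n * (n - 1) := fun n => by
    rw [Nat.cast_descFactorial_two]
  have d3 : ∀ n : ℕ, (n.descFactorial 3 : ℝ) = n * (n - 1) * (n - 2) := fun n => by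
    rcases n with _ | _ | n
    · simp
    · simp [Nat.descFactorial]
    · rw [Nat.descFactorial_succ, Nat.cast_mul, d2]
      push_cast [Nat.add_sub_cancel]
      ring
  have d4 : ∀ n : ℕ, (n.descFactorial 4 : ℝ) = n * (n - 1) * (n - 2) * (n - 3) := fun n => by
    rcases n with _ | _ | _ | n
    · simp
    · simp [Nat.descFactorial]
    · simp [Nat.descFactorial]
    · rw [Nat.descFactorial_succ, Nat.cast_mul, d3]
      push_cast [Nat.add_sub_cancel]
      ring
  simp only [d1, d2, d3, d4, pow_one] at i1 i2 i3 i4 m1 m2 m3 m4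
  have hd : |f 1 - f 0| ≤ K * r := by
    have e : ∫ n : ℕ, (f (n + 1) - f n - (f 1 - f 0)) ∂(poissonMeasure r) = -(f 1 - f 0) := by
      rw [integral_sub (integrable_fun_sub hfi' hfi) (integrable_const _)]
      rw [h1]
      simp
    rw [← abs_neg, ← e, ← m1, ← integral_const_mul, ← Real.norm_eq_abs]
    exact norm_integral_le_of_norm_le (i1.const_mul K)
      (ae_of_all _ fun n => abs_diff_sub_diff_zero_le hf n)
  have hz : |f 0| ≤ 2 * K * r ^ 2 := by
    have e : ∫ n : ℕ, (f n - f 0 - n * (f 1 - f 0)) ∂(poissonMeasure r) =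
        -f 0 - r * (f 1 - f 0) := by
      rw [integral_sub (integrable_fun_sub hfi (integrable_const _)) (i1.mul_const _),
        integral_sub hfi (integrable_const _), h0, integral_mul_const, m1]
      simp
    have h2 : |∫ n : ℕ, (f n - f 0 - n * (f 1 - f 0)) ∂(poissonMeasure r)| ≤ K * r ^ 2 := by
      rw [← m2, ← integral_const_mul, ← Real.norm_eq_abs]
      exact norm_integral_le_of_norm_le (i2.const_mul K)
        (ae_of_all _ fun n => abs_sub_linear_le hf n)
    rw [e] at h2
    have h3 : |r * (f 1 - f 0)| ≤ r * (K * r) := by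
      rw [abs_mul, abs_of_nonneg hr]
      exact mul_le_mul_of_nonneg_left hd hr
    rw [abs_le] at h2 h3 ⊢
    constructor <;> nlinarith [h2.1, h2.2, h3.1, h3.2]
  have hpt : ∀ n : ℕ, f n ^ 2 ≤ 3 * K ^ 2 * (4 * r ^ 4 + r ^ 2 * (n * (n - 1) + n) +
      (n * (n - 1) * (n - 2) * (n - 3) + 4 * (n * (n - 1) * (n - 2)) + 2 * (n * (n - 1)))) := by
    intro n
    have hn : (0 : ℝ) ≤ n := n.cast_nonneg
    have hn2 : (0 : ℝ) ≤ n * (n - 1) := by rw [← d2]; positivity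
    have h2 := abs_sub_linear_le hf n
    have h3 : |n * (f 1 - f 0)| ≤ n * (K * r) := by
      rw [abs_mul, abs_of_nonneg hn]
      exact mul_le_mul_of_nonneg_left hd hn
    have h4 : |f n| ≤ 2 * K * r ^ 2 + n * (K * r) + K * (n * (n - 1)) := by
      rw [abs_le] at h2 h3 hz ⊢
      constructor <;> linarith [h2.1, h2.2, h3.1, h3.2, hz.1, hz.2]
    have h5 : f n ^ 2 ≤ (2 * K * r ^ 2 + n * (K * r) + K * (n * (n - 1))) ^ 2 := by
      rw [← sq_abs]
      exact pow_le_pow_left₀ (abs_nonneg _) h4 2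
    have h6 : ∀ x y z : ℝ, (x + y + z) ^ 2 ≤ 3 * (x ^ 2 + y ^ 2 + z ^ 2) := fun x y z => by
      nlinarith [sq_nonneg (x - y), sq_nonneg (y - z), sq_nonneg (x - z)]
    refine h5.trans ((h6 _ _ _).trans (le_of_eq ?_))
    ring
  have hi : Integrable (fun n : ℕ => 3 * K ^ 2 * (4 * r ^ 4 + r ^ 2 * (n * (n - 1) + n) +
      (n * (n - 1) * (n - 2) * (n - 3) + 4 * (n * (n - 1) * (n - 2)) + 2 * (n * (n - 1)))))
      (poissonMeasure r) :=
    (((integrable_const _).add ((i2.add i1).const_mul _)).add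
      ((i4.add (i3.const_mul 4)).add (i2.const_mul 2))).const_mul _
  refine (integral_mono_of_nonneg (ae_of_all _ fun n => sq_nonneg (f n)) hi
    (ae_of_all _ hpt)).trans (le_of_eq ?_)
  rw [integral_const_mul, integral_add ((integrable_const _).fun_add ((i2.fun_add i1).const_mul _))
    ((i4.fun_add (i3.const_mul 4)).fun_add (i2.const_mul 2)), integral_add (integrable_const _)
    ((i2.fun_add i1).const_mul _), integral_const, integral_const_mul, integral_add i2 i1,
    integral_add (i4.fun_add (i3.const_mul 4)) (i2.const_mul 2), integral_add i4 (i3.const_mul 4),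
    integral_const_mul, integral_const_mul, m1, m2, m3, m4]
  simp
  ring

end SecondDifference

/-- If the common part of two Poisson variables has parameter `r`, functions of them with
vanishing mean and mean difference have covariance of order `r ^ 2`. -/
lemma integral_sq_integral_poissonMeasure_le {h : ℕ → ℝ} {C K : ℝ}
    (hC : ∀ n : ℕ, |h n| ≤ C * (1 + n)) (hK : ∀ n, |h (n + 2) - 2 * h (n + 1) + h n| ≤ K)
    {a r : ℝ≥0} (h0 : ∫ n, h n ∂(poissonMeasure (r + a)) = 0)
    (h1 : ∫ n, (h (n + 1) - h n) ∂(poissonMeasure (r + a)) = 0) :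
    ∫ m, (∫ l, h (m + l) ∂(poissonMeasure a)) ^ 2 ∂(poissonMeasure r) ≤
      3 * K ^ 2 * r ^ 2 * (6 * r ^ 2 + 5 * r + 2) := by
  have hC0 : 0 ≤ C := by
    have := (abs_nonneg _).trans (hC 0)
    simpa using this
  have hC' : ∀ n : ℕ, |h (n + 1)| ≤ (2 * C) * (1 + n) := fun n => by
    refine (hC (n + 1)).trans ?_
    push_cast
    nlinarith [(n.cast_nonneg : (0 : ℝ) ≤ n)]
  have hlin : ∀ m : ℕ, ∀ n : ℕ, |h (m + n)| ≤ (C * (1 + m)) * (1 + n) := fun m n => by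
    refine (hC (m + n)).trans ?_
    push_cast
    nlinarith [mul_nonneg (mul_nonneg hC0 (m.cast_nonneg : (0 : ℝ) ≤ m))
      (n.cast_nonneg : (0 : ℝ) ≤ n)]
  have hli : ∀ m, Integrable (fun l => h (m + l)) (poissonMeasure a) := fun m =>
    integrable_poissonMeasure_of_linear_growth (hlin m) a
  have hint : ∀ r', Integrable h (poissonMeasure r') :=
    integrable_poissonMeasure_of_linear_growth hC
  have hint' : ∀ r', Integrable (fun n => h (n + 1)) (poissonMeasure r') :=
    integrable_poissonMeasure_of_linear_growth hC'
  have i1 := integrable_pow_poissonMeasure a 1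
  simp only [pow_one] at i1
  -- the averaged function has linear growth again
  have hψ : ∀ m : ℕ, |∫ l, h (m + l) ∂(poissonMeasure a)| ≤
      (C * ∫ l : ℕ, (1 + (l : ℝ)) ∂(poissonMeasure a)) * (1 + m) := fun m => by
    rw [mul_right_comm, ← integral_const_mul, ← Real.norm_eq_abs]
    exact norm_integral_le_of_norm_le (((integrable_const (1 : ℝ)).add i1).const_mul _)
      (ae_of_all _ fun l => hlin m l)
  have hψi := integrable_poissonMeasure_of_linear_growth hψ r
  have hshift : ∀ m l : ℕ, h (m + 1 + l) = h (m + l + 1) := fun m l => by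
    congr 1; omega
  have hψi' : Integrable (fun m => ∫ l, h (m + 1 + l) ∂(poissonMeasure a)) (poissonMeasure r) := by
    refine integrable_poissonMeasure_of_linear_growth
      (K := 2 * (C * ∫ l : ℕ, (1 + (l : ℝ)) ∂(poissonMeasure a))) (fun m => ?_) r
    refine (hψ (m + 1)).trans ?_
    have : 0 ≤ C * ∫ l : ℕ, (1 + (l : ℝ)) ∂(poissonMeasure a) :=
      mul_nonneg hC0 (integral_nonneg fun l => by positivity)
    push_cast
    nlinarith [mul_nonneg this (m.cast_nonneg : (0 : ℝ) ≤ m)]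
  refine integral_sq_poissonMeasure_le (f := fun m => ∫ l, h (m + l) ∂(poissonMeasure a))
    (fun m => ?_) hψi hψi' ?_ ?_
  · have e : ∫ l, h (m + 2 + l) ∂(poissonMeasure a) - 2 * ∫ l, h (m + 1 + l) ∂(poissonMeasure a) +
        ∫ l, h (m + l) ∂(poissonMeasure a) =
        ∫ l, (h (m + l + 2) - 2 * h (m + l + 1) + h (m + l)) ∂(poissonMeasure a) := by
      have e2 : ∀ l, h (m + 2 + l) = h (m + l + 2) := fun l => by congr 1; omega
      have j2 := hli (m + 2)
      have j1 := hli (m + 1)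
      simp only [e2, hshift] at j1 j2 ⊢
      rw [integral_add (integrable_fun_sub j2 (j1.const_mul 2)) (hli m), integral_sub j2 (j1.const_mul 2),
        integral_const_mul]
    rw [e, ← Real.norm_eq_abs]
    refine (norm_integral_le_of_norm_le_const (ae_of_all _ fun l => hK _)).trans ?_
    simp
  · rw [← integral_comp_add_poissonMeasure hC, h0]
  · have hDi : ∀ n : ℕ, |h (n + 1) - h n| ≤ (3 * C) * (1 + n) := fun n => by
      have a1 := hC n
      have a2 := hC' n
      rw [abs_le] at a1 a2 ⊢
      constructor <;> linarith [a1.1, a1.2, a2.1, a2.2]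
    rw [integral_comp_add_poissonMeasure hDi] at h1
    rw [← h1]
    congr with m
    have j1 := hli (m + 1)
    simp only [hshift] at j1 ⊢
    rw [integral_sub j1 (hli m)]

/-! ### Integer-valued counts of the marked process -/

namespace IsMarkedPoisson

variable {Ω E F : Type*} [MeasurableSpace Ω] [MeasurableSpace E] [MeasurableSpace F]
  {P : Measure Ω} {Λ : Measure E} {Q : Measure F} {u : ℕ → Ω → E} {Y : ℕ → Ω → F}

/-- The number of points of the marked process in `B`, as a natural number. -/
noncomputable def natCount (u : ℕ → Ω → E) (Y : ℕ → Ω → F) (B : Set (E × F)) (ω : Ω) : ℕ :=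
  ⌊count u Y B ω⌋₊

variable (h : IsMarkedPoisson P Λ Q u Y)
include h

lemma measurable_natCount {B : Set (E × F)} (hB : MeasurableSet B) :
    Measurable (natCount u Y B) :=
  Nat.measurable_floor.comp (h.measurable_count hB)

variable [IsProbabilityMeasure P] [SigmaFinite Λ]

lemma map_natCount {B : Set (E × F)} (hB : MeasurableSet B) (hΛ : (Λ.prod Q) B < ∞) :
    P.map (natCount u Y B) = poissonMeasure ((Λ.prod Q) B).toNNReal := by
  have e : natCount u Y B = Nat.floor ∘ count u Y B := rfl
  rw [e, ← Measure.map_map Nat.measurable_floor (h.measurable_count hB), h.map_count hB hΛ,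
    Measure.map_map Nat.measurable_floor (by fun_prop)]
  have e2 : (Nat.floor ∘ fun n : ℕ => (n : ℝ)) = id := by
    funext n
    simp
  rw [e2, Measure.map_id]

lemma ae_summable_indicator {B : Set (E × F)} (hB : MeasurableSet B) (hΛ : (Λ.prod Q) B < ∞) :
    ∀ᵐ ω ∂P, Summable fun j => B.indicator (fun _ => (1 : ℝ)) (u j ω, Y j ω) := by
  have := h.isProbabilityMeasure_mark
  exact (h.ae_summable (measurable_const.indicator hB)
    ((integrable_indicator_iff hB).mpr (integrableOn_const hΛ.ne))).mono fun ω hω => hω.of_norm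

lemma ae_natCount_eq {B : Set (E × F)} (hB : MeasurableSet B) (hΛ : (Λ.prod Q) B < ∞) :
    ∀ᵐ ω ∂P, (natCount u Y B ω : ℝ) = count u Y B ω := by
  have hs : MeasurableSet {x : ℝ | (⌊x⌋₊ : ℝ) = x} :=
    measurableSet_eq_fun (by fun_prop) measurable_id
  have h1 : ∀ᵐ x ∂(P.map (count u Y B)), (⌊x⌋₊ : ℝ) = x := by
    rw [h.map_count hB hΛ, ae_map_iff (by fun_prop) hs]
    simp
  exact ae_of_ae_map (h.measurable_count hB).aemeasurable h1

lemma ae_natCount_union {B C : Set (E × F)} (hB : MeasurableSet B) (hC : MeasurableSet C)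
    (hΛB : (Λ.prod Q) B < ∞) (hΛC : (Λ.prod Q) C < ∞) (hd : Disjoint B C) :
    ∀ᵐ ω ∂P, natCount u Y (B ∪ C) ω = natCount u Y B ω + natCount u Y C ω := by
  filter_upwards [h.ae_natCount_eq hB hΛB, h.ae_natCount_eq hC hΛC,
    h.ae_summable_indicator hB hΛB, h.ae_summable_indicator hC hΛC] with ω h1 h2 s1 s2
  have e : count u Y (B ∪ C) ω = count u Y B ω + count u Y C ω := by
    unfold count
    rw [← s1.tsum_add s2]
    refine tsum_congr fun j => ?_
    rw [Set.indicator_union_of_disjoint hd]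
  rw [natCount, e, ← h1, ← h2, ← Nat.cast_add, Nat.floor_natCast]

lemma memLp_two_natCount {B : Set (E × F)} (hB : MeasurableSet B) (hΛ : (Λ.prod Q) B < ∞)
    {f : ℕ → ℝ} {C : ℝ} (hC : ∀ n : ℕ, |f n| ≤ C * (1 + n)) :
    MemLp (fun ω => f (natCount u Y B ω)) 2 P := by
  have hf : Measurable f := measurable_of_countable f
  have hm := h.measurable_natCount hB
  have hfm : Measurable fun ω => f (natCount u Y B ω) := hf.comp hm
  rw [memLp_two_iff_integrable_sq hfm.aestronglyMeasurable]
  have h1 : Integrable (fun n => f n ^ 2) (P.map (natCount u Y B)) := by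
    rw [h.map_natCount hB hΛ]
    have i1 := integrable_pow_poissonMeasure ((Λ.prod Q) B).toNNReal 1
    have i2 := integrable_pow_poissonMeasure ((Λ.prod Q) B).toNNReal 2
    refine ((((integrable_const (1 : ℝ)).add (i1.const_mul 2)).add i2).const_mul (C ^ 2)).mono'
      (by fun_prop) (ae_of_all _ fun n => ?_)
    rw [Real.norm_of_nonneg (sq_nonneg _), ← sq_abs]
    refine (pow_le_pow_left₀ (abs_nonneg _) (hC n) 2).trans (le_of_eq ?_)
    simp only [Pi.add_apply]
    ring
  exact h1.comp_measurable hm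

lemma integral_natCount {B : Set (E × F)} (hB : MeasurableSet B) (hΛ : (Λ.prod Q) B < ∞)
    (f : ℕ → ℝ) :
    ∫ ω, f (natCount u Y B ω) ∂P = ∫ n, f n ∂(poissonMeasure ((Λ.prod Q) B).toNNReal) := by
  rw [← h.map_natCount hB hΛ, integral_map (h.measurable_natCount hB).aemeasurable
    (measurable_of_countable f).aestronglyMeasurable]

/-- The mixed moment of functions of the numbers of points in two overlapping sets, by
conditioning on the number of common points. -/
lemma integral_mul_natCount {A B C : Set (E × F)} (hA : MeasurableSet A) (hB : MeasurableSet B)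
    (hC : MeasurableSet C) (hΛA : (Λ.prod Q) A < ∞) (hΛB : (Λ.prod Q) B < ∞)
    (hΛC : (Λ.prod Q) C < ∞) (hAB : Disjoint A B) (hCA : Disjoint C A) (hCB : Disjoint C B)
    {f : ℕ → ℝ} {K : ℝ} (hf : ∀ n : ℕ, |f n| ≤ K * (1 + n)) :
    ∫ ω, f (natCount u Y (C ∪ A) ω) * f (natCount u Y (C ∪ B) ω) ∂P =
      ∫ m, (∫ l, f (m + l) ∂(poissonMeasure ((Λ.prod Q) A).toNNReal)) *
        (∫ l, f (m + l) ∂(poissonMeasure ((Λ.prod Q) B).toNNReal))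
        ∂(poissonMeasure ((Λ.prod Q) C).toNNReal) := by
  have hmA := h.measurable_natCount hA
  have hmB := h.measurable_natCount hB
  have hmC := h.measurable_natCount hC
  have hΛCA : (Λ.prod Q) (C ∪ A) < ∞ := (measure_union_le _ _).trans_lt (by simp [hΛA, hΛC])
  have hΛCB : (Λ.prod Q) (C ∪ B) < ∞ := (measure_union_le _ _).trans_lt (by simp [hΛB, hΛC])
  have hi := (h.memLp_two_natCount (hC.union hA) hΛCA hf).integrable_mul
    (h.memLp_two_natCount (hC.union hB) hΛCB hf)
  have e : ∀ᵐ ω ∂P, f (natCount u Y (C ∪ A) ω) * f (natCount u Y (C ∪ B) ω) =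
      f (natCount u Y C ω + natCount u Y A ω) * f (natCount u Y C ω + natCount u Y B ω) := by
    filter_upwards [h.ae_natCount_union hC hA hΛC hΛA hCA,
      h.ae_natCount_union hC hB hΛC hΛB hCB] with ω h1 h2
    rw [h1, h2]
  have hi2 := hi.congr e
  rw [integral_congr_ae e]
  -- the three counts are independent
  have hind := h.iIndepFun_count (ι := Fin 3) (B := ![A, B, C])
    (by intro i; fin_cases i <;> assumption) (by intro i; fin_cases i <;> assumption)
    (by
      intro i j hij
      fin_cases i <;> fin_cases j <;>
        first | exact absurd rfl hij | assumption | exact Disjoint.symm (by assumption))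
  have hind2 := hind.comp (fun _ x => ⌊x⌋₊) fun _ => Nat.measurable_floor
  have hmeas : ∀ i : Fin 3, Measurable
      ((fun x : ℝ => ⌊x⌋₊) ∘ count u Y ((![A, B, C] : Fin 3 → Set (E × F)) i)) := by
    intro i
    fin_cases i
    exacts [hmA, hmB, hmC]
  have hABi : IndepFun (natCount u Y A) (natCount u Y B) P :=
    hind2.indepFun (i := 0) (j := 1) (by decide)
  have hABC : IndepFun (fun ω => (natCount u Y A ω, natCount u Y B ω)) (natCount u Y C) P :=
    hind2.indepFun_prodMk hmeas 0 1 2 (by decide) (by decide)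
  have hmap := (indepFun_iff_map_prod_eq_prod_map_map (hmA.prodMk hmB).aemeasurable
    hmC.aemeasurable).mp hABC
  rw [(indepFun_iff_map_prod_eq_prod_map_map hmA.aemeasurable hmB.aemeasurable).mp hABi,
    h.map_natCount hA hΛA, h.map_natCount hB hΛB, h.map_natCount hC hΛC] at hmap
  have hg : Measurable fun z : (ℕ × ℕ) × ℕ => f (z.2 + z.1.1) * f (z.2 + z.1.2) :=
    measurable_of_countable _
  have hm3 := ((hmA.prodMk hmB).prodMk hmC).aemeasurable (μ := P)
  have hi3 : Integrable (fun z : (ℕ × ℕ) × ℕ => f (z.2 + z.1.1) * f (z.2 + z.1.2))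
      (P.map fun ω => ((natCount u Y A ω, natCount u Y B ω), natCount u Y C ω)) := by
    rw [integrable_map_measure hg.aestronglyMeasurable hm3]
    exact hi2
  have e2 := integral_map hm3 hg.aestronglyMeasurable
  rw [← e2, hmap, integral_prod_symm _ (hmap ▸ hi3)]
  congr with m
  exact integral_prod_mul (fun l => f (m + l)) fun l => f (m + l)

end IsMarkedPoisson

/-! ### Random closed sets -/

section Fell

variable {E : Type*}

lemma measurableSet_setOf_disjoint [TopologicalSpace E] {K : Set E} (hK : IsCompact K) :
    MeasurableSet {F : Closeds E | Disjoint (F : Set E) K} :=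
  MeasurableSpace.measurableSet_generateFrom
    (TopologicalSpace.isOpen_generateFrom_of_mem (Or.inr ⟨K, hK, rfl⟩))

/-- Membership is jointly measurable in the point and the closed set: `t ∉ F` if and only if `t` is
an interior point of a closed ball, from a countable family, that misses `F`. -/
lemma measurableSet_setOf_mem [MetricSpace E] [ProperSpace E] [MeasurableSpace E] [BorelSpace E] :
    MeasurableSet {z : E × Closeds E | z.1 ∈ z.2} := by
  rcases isEmpty_or_nonempty E with hE | hE
  · have : {z : E × Closeds E | z.1 ∈ z.2} = ∅ := Set.eq_empty_of_forall_notMem fun z =>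
      hE.elim z.1
    rw [this]
    exact MeasurableSet.empty
  have e : {z : E × Closeds E | z.1 ∈ z.2}ᶜ = ⋃ (i : ℕ) (q : ℚ),
      Metric.ball (denseSeq E i) q ×ˢ
        {F : Closeds E | Disjoint (F : Set E) (Metric.closedBall (denseSeq E i) q)} := by
    ext ⟨t, F⟩
    simp only [Set.mem_compl_iff, Set.mem_ofPred_eq, Set.mem_iUnion, Set.mem_prod]
    constructor
    · intro ht
      obtain ⟨ε, hε, hball⟩ := Metric.isOpen_iff.mp F.isClosed.isOpen_compl t ht
      obtain ⟨q, hq0, hq⟩ := exists_rat_btwn (half_pos hε)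
      obtain ⟨_, hd, ⟨i, rfl⟩⟩ := Metric.dense_iff.mp (denseRange_denseSeq E) t q hq0
      rw [Metric.mem_ball, dist_comm] at hd
      refine ⟨i, q, hd, Set.disjoint_left.mpr fun y hyF hy => hball ?_ hyF⟩
      rw [Metric.mem_closedBall] at hy
      rw [Metric.mem_ball]
      have := dist_triangle y (denseSeq E i) t
      rw [dist_comm (denseSeq E i) t] at this
      linarith
    · rintro ⟨i, q, ht, hd⟩ htF
      exact Set.disjoint_left.mp hd htF (Metric.ball_subset_closedBall ht)
  rw [← MeasurableSet.compl_iff, e]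
  exact MeasurableSet.iUnion fun i => MeasurableSet.iUnion fun q =>
    Metric.isOpen_ball.measurableSet.prod
      (measurableSet_setOf_disjoint (isCompact_closedBall _ _))

lemma measurable_measure_inter [MetricSpace E] [ProperSpace E] [MeasurableSpace E] [BorelSpace E]
    (m : Measure E) [SFinite m] {A : Set E} (hA : MeasurableSet A) :
    Measurable fun F : Closeds E => m ((F : Set E) ∩ A) :=
  measurable_measure_prodMk_right (μ := m)
    (measurableSet_setOf_mem.inter (measurable_fst hA))

end Fell

/-! ### Weighted integrals of measurable random fields -/

section RandomField

variable {Ω T : Type*} [MeasurableSpace Ω] [MeasurableSpace T] {P : Measure Ω}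
  [IsProbabilityMeasure P] {m : Measure T} [SFinite m] {W : Ω × T → ℝ} {φ : T → ℝ}

lemma integrable_mul_field (hW : Measurable W) (hφ : Integrable φ m) {C : ℝ}
    (hWi : ∀ t, Integrable (fun ω => W (ω, t)) P) (hC : ∀ t, ∫ ω, |W (ω, t)| ∂P ≤ C) :
    Integrable (fun z : Ω × T => φ z.2 * W z) (P.prod m) := by
  have hm : AEStronglyMeasurable (fun z : Ω × T => φ z.2 * W z) (P.prod m) :=
    hφ.1.comp_snd.mul hW.aestronglyMeasurable
  rw [integrable_prod_iff' hm]
  refine ⟨ae_of_all _ fun t => (hWi t).const_mul (φ t), ?_⟩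
  refine (hφ.norm.mul_const C).mono' (hm.norm.prod_swap.integral_prod_right') (ae_of_all _ fun t => ?_)
  simp only [norm_mul]
  rw [integral_const_mul, Real.norm_of_nonneg
    (mul_nonneg (norm_nonneg _) (integral_nonneg fun ω => norm_nonneg _))]
  exact mul_le_mul_of_nonneg_left (hC t) (norm_nonneg _)

lemma integral_integral_mul_field (hW : Measurable W) (hφ : Integrable φ m) {C w : ℝ}
    (hWi : ∀ t, Integrable (fun ω => W (ω, t)) P) (hC : ∀ t, ∫ ω, |W (ω, t)| ∂P ≤ C)
    (hw : ∀ t, ∫ ω, W (ω, t) ∂P = w) :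
    ∫ ω, ∫ t, φ t * W (ω, t) ∂m ∂P = w * ∫ t, φ t ∂m := by
  rw [integral_integral_swap (integrable_mul_field hW hφ hWi hC), ← integral_const_mul]
  congr with t
  rw [integral_const_mul, hw, mul_comm]

/-- The second moment of the weighted integral of a random field, in terms of a bound `c` for its
correlations. -/
lemma lintegral_sq_integral_mul_field_le (hW : Measurable W) (hφ : Integrable φ m)
    {C : ℝ} (hWi : ∀ t, MemLp (fun ω => W (ω, t)) 2 P)
    (hC : ∀ t, ∫ ω, W (ω, t) ^ 2 ∂P ≤ C) {c : T → T → ℝ≥0∞}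
    (hc : ∀ s t, ‖∫ ω, W (ω, s) * W (ω, t) ∂P‖ₑ ≤ c s t) :
    ∫⁻ ω, ‖∫ t, φ t * W (ω, t) ∂m‖ₑ ^ 2 ∂P ≤
      ∫⁻ z : T × T, ‖φ z.1‖ₑ * ‖φ z.2‖ₑ * c z.1 z.2 ∂(m.prod m) := by
  have hsq : ∀ t, Integrable (fun ω => W (ω, t) ^ 2) P := fun t => (hWi t).integrable_sq
  have hWW : ∀ s t, Integrable (fun ω => W (ω, s) * W (ω, t)) P := fun s t =>
    (hWi s).integrable_mul (hWi t)
  have hb : ∀ s t, ∫ ω, |W (ω, s) * W (ω, t)| ∂P ≤ C := by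
    intro s t
    have h1 : ∫ ω, |W (ω, s) * W (ω, t)| ∂P ≤ ∫ ω, (W (ω, s) ^ 2 + W (ω, t) ^ 2) / 2 ∂P := by
      refine integral_mono (hWW s t).abs (((hsq s).add (hsq t)).div_const 2) fun ω => ?_
      simp only [abs_mul]
      have := two_mul_le_add_sq |W (ω, s)| |W (ω, t)|
      rw [sq_abs, sq_abs] at this
      linarith
    rw [integral_div, integral_add (hsq s) (hsq t)] at h1
    linarith [hC s, hC t]
  have hWm : Measurable fun z : Ω × (T × T) => W (z.1, z.2.1) * W (z.1, z.2.2) :=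
    (hW.comp (measurable_fst.prodMk (measurable_fst.comp measurable_snd))).mul
      (hW.comp (measurable_fst.prodMk (measurable_snd.comp measurable_snd)))
  have hi := integrable_mul_field (P := P) (m := m.prod m)
    (W := fun z : Ω × (T × T) => W (z.1, z.2.1) * W (z.1, z.2.2))
    (φ := fun z : T × T => φ z.1 * φ z.2) hWm (hφ.mul_prod hφ)
    (fun z => hWW z.1 z.2) fun z => hb z.1 z.2
  have e : ∀ ω, ∫ z : T × T, φ z.1 * φ z.2 * (W (ω, z.1) * W (ω, z.2)) ∂(m.prod m) =
      (∫ t, φ t * W (ω, t) ∂m) ^ 2 := fun ω => by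
    rw [sq, ← integral_prod_mul]
    congr with z
    ring
  have hsi := hi.integral_prod_left
  simp only [e] at hsi
  have e2 : ∫⁻ ω, ‖∫ t, φ t * W (ω, t) ∂m‖ₑ ^ 2 ∂P =
      ENNReal.ofReal (∫ ω, (∫ t, φ t * W (ω, t) ∂m) ^ 2 ∂P) := by
    rw [ofReal_integral_eq_lintegral_ofReal hsi (ae_of_all _ fun ω => sq_nonneg _)]
    refine lintegral_congr fun ω => ?_
    rw [Real.enorm_eq_ofReal_abs, ← ENNReal.ofReal_pow (abs_nonneg _), sq_abs]
  have e3 : ∫ ω, (∫ t, φ t * W (ω, t) ∂m) ^ 2 ∂P =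
      ∫ z : T × T, φ z.1 * φ z.2 * ∫ ω, W (ω, z.1) * W (ω, z.2) ∂P ∂(m.prod m) := by
    simp only [← e]
    rw [integral_integral_swap hi]
    simp only [integral_const_mul]
  rw [e2, e3]
  refine (ENNReal.ofReal_le_ofReal (Real.le_norm_self _)).trans ?_
  rw [ofReal_norm]
  refine (enorm_integral_le_lintegral_enorm _).trans (lintegral_mono fun z => ?_)
  simp only [enorm_mul]
  gcongr
  exact hc _ _

end RandomField

/-! ### Grains covering given points -/

/-- The Euclidean space `ℝ^ν`. -/
abbrev Eucl (ν : ℕ) := EuclideanSpace ℝ (Fin ν)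

section Geometry

variable {ν : ℕ}

/-- The pairs (germ, grain) whose translated grain covers the point `t`. -/
def hitSet (t : Eucl ν) : Set (Eucl ν × Closeds (Eucl ν)) := {z | t - z.1 ∈ z.2}

/-- The mean volume of the intersection of the grain with its translate by `-h`. -/
noncomputable def overlap (Q : Measure (Closeds (Eucl ν))) (h : Eucl ν) : ℝ≥0∞ :=
  ∫⁻ F, volume {y : Eucl ν | y ∈ F ∧ y + h ∈ F} ∂Q

/-- The mean volume of the part of the grain at distance more than `r` from the origin. -/
noncomputable def farVolume (Q : Measure (Closeds (Eucl ν))) (r : ℝ) : ℝ≥0∞ :=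
  ∫⁻ F : Closeds (Eucl ν), volume ((F : Set (Eucl ν)) ∩ {t | r < ‖t‖}) ∂Q

/-- The mean volume of the grain. -/
noncomputable def meanVolume (Q : Measure (Closeds (Eucl ν))) : ℝ≥0∞ :=
  ∫⁻ F : Closeds (Eucl ν), volume (F : Set (Eucl ν)) ∂Q

lemma mem_vadd_closeds_iff {x t : Eucl ν} {F : Closeds (Eucl ν)} :
    t ∈ x +ᵥ (F : Set (Eucl ν)) ↔ t - x ∈ F := by
  rw [Set.mem_vadd_set_iff_neg_vadd_mem, vadd_eq_add, neg_add_eq_sub]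
  rfl

lemma measurableSet_hit :
    MeasurableSet {w : Eucl ν × (Eucl ν × Closeds (Eucl ν)) | w.1 - w.2.1 ∈ w.2.2} :=
  ((measurable_fst.sub (measurable_fst.comp measurable_snd)).prodMk
    (measurable_snd.comp measurable_snd)) measurableSet_setOf_mem

lemma measurableSet_hitSet (t : Eucl ν) : MeasurableSet (hitSet t) :=
  measurable_prodMk_left (x := t) measurableSet_hit

lemma measurable_volume_closeds :
    Measurable fun F : Closeds (Eucl ν) => volume (F : Set (Eucl ν)) := by
  simpa using measurable_measure_inter (volume : Measure (Eucl ν)) MeasurableSet.univ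

variable (Q : Measure (Closeds (Eucl ν))) [SFinite Q]

lemma measure_hitSet (t : Eucl ν) : (volume.prod Q) (hitSet t) = meanVolume Q := by
  rw [Measure.prod_apply_symm (measurableSet_hitSet t)]
  refine lintegral_congr fun F => ?_
  exact (Measure.measurePreserving_sub_left volume t).measure_preimage
    F.isClosed.measurableSet.nullMeasurableSet

lemma measure_hitSet_inter (s t : Eucl ν) :
    (volume.prod Q) (hitSet s ∩ hitSet t) = overlap Q (t - s) := by
  rw [Measure.prod_apply_symm ((measurableSet_hitSet s).inter (measurableSet_hitSet t))]
  refine lintegral_congr fun F => ?_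
  have hm : MeasurableSet {y : Eucl ν | y ∈ F ∧ y + (t - s) ∈ F} :=
    F.isClosed.measurableSet.inter
      ((measurable_id.add_const (t - s)) F.isClosed.measurableSet)
  rw [← (Measure.measurePreserving_sub_left volume s).measure_preimage hm.nullMeasurableSet]
  congr 1
  ext x
  simp only [hitSet, Set.mem_preimage, Set.mem_inter_iff, Set.mem_ofPred_eq]
  rw [show s - x + (t - s) = t - x by abel]

omit [SFinite Q] in
lemma overlap_le_meanVolume (h : Eucl ν) : overlap Q h ≤ meanVolume Q :=
  lintegral_mono fun _ => measure_mono fun _ hy => hy.1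

omit [SFinite Q] in
lemma farVolume_le_meanVolume (r : ℝ) : farVolume Q r ≤ meanVolume Q :=
  lintegral_mono fun _ => measure_mono Set.inter_subset_left

omit [SFinite Q] in
/-- If a grain meets its translate by `-h` in `y`, then `y` or `y + h` is far from the origin. -/
lemma overlap_le_farVolume {h : Eucl ν} {r : ℝ} (hr : r < ‖h‖ / 2) :
    overlap Q h ≤ 2 * farVolume Q r := by
  unfold overlap farVolume
  rw [← lintegral_const_mul]
  · refine lintegral_mono fun F => ?_
    have hm : MeasurableSet ((F : Set (Eucl ν)) ∩ {t | r < ‖t‖}) :=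
      F.isClosed.measurableSet.inter (measurableSet_lt measurable_const measurable_norm)
    have hsub : {y : Eucl ν | y ∈ F ∧ y + h ∈ F} ⊆
        ((F : Set (Eucl ν)) ∩ {t | r < ‖t‖}) ∪
          (fun y => y + h) ⁻¹' ((F : Set (Eucl ν)) ∩ {t | r < ‖t‖}) := by
      rintro y ⟨h1, h2⟩
      by_cases hy : r < ‖y‖
      · exact Or.inl ⟨h1, hy⟩
      · refine Or.inr ⟨h2, ?_⟩
        have h3 : ‖h‖ ≤ ‖y + h‖ + ‖y‖ := by
          have := norm_sub_le (y + h) y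
          rwa [add_sub_cancel_left] at this
        simp only [Set.mem_ofPred_eq]
        linarith
    refine (measure_mono hsub).trans ((measure_union_le _ _).trans ?_)
    rw [(measurePreserving_add_right volume h).measure_preimage hm.nullMeasurableSet, two_mul]
  · exact measurable_measure_inter volume (measurableSet_lt measurable_const measurable_norm)

end Geometry

/-! ### One- and two-point properties of the grain field -/

section Model

variable {Ω : Type*} {ν : ℕ} [MeasurableSpace Ω] {P : Measure Ω} {u : ℕ → Ω → Eucl ν}
  {Ξs : ℕ → Ω → Closeds (Eucl ν)} {Ξ : Ω → Closeds (Eucl ν)}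

omit [MeasurableSpace Ω] in
lemma grainField_eq_tsum (ω : Ω) (t : Eucl ν) : grainField u Ξs ω t =
    ∑' j, (hitSet t).indicator (fun _ => (1 : ℝ≥0∞)) (u j ω, Ξs j ω) := by
  classical
  refine tsum_congr fun j => ?_
  simp only [Set.indicator_apply, mem_vadd_closeds_iff]
  rfl

omit [MeasurableSpace Ω] in
lemma toReal_grainField (ω : Ω) (t : Eucl ν) :
    (grainField u Ξs ω t).toReal = IsMarkedPoisson.count u Ξs (hitSet t) ω := by
  classical
  rw [grainField_eq_tsum, ENNReal.tsum_toReal_eq]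
  · refine tsum_congr fun j => ?_
    simp only [Set.indicator_apply]
    split_ifs <;> simp
  · intro j
    simp only [Set.indicator_apply]
    split_ifs <;> simp

namespace IsBooleanModel

variable (hM : IsBooleanModel P u Ξs Ξ)
include hM

/-- The germs with their grains form an independently marked Poisson process. -/
lemma marked : IsMarkedPoisson P volume (P.map Ξ) u Ξs where
  poisson := hM.poisson
  measurable_mark := hM.measurable_grain
  map_mark j := (hM.identDistrib j).map_eq
  iIndep := hM.iIndep
  indep := hM.indep

lemma measurable_grainField : Measurable fun z : Ω × Eucl ν => grainField u Ξs z.1 z.2 := by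
  classical
  simp only [grainField_eq_tsum]
  refine Measurable.tsum fun j => ?_
  have hs : MeasurableSet {z : Ω × Eucl ν | z.2 - u j z.1 ∈ Ξs j z.1} :=
    (measurable_snd.prodMk ((hM.marked.measurable_pair j).comp measurable_fst)) measurableSet_hit
  exact (measurable_const.indicator hs (f := fun _ => (1 : ℝ≥0∞)))

lemma meanVolume_eq : meanVolume (P.map Ξ) =
    ∫⁻ ω, volume (Ξ ω : Set (EuclideanSpace ℝ (Fin ν))) ∂P :=
  lintegral_map measurable_volume_closeds hM.measurable_generic

lemma farVolume_eq (r : ℝ) : farVolume (P.map Ξ) r =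
    ∫⁻ ω, volume ((Ξ ω : Set (EuclideanSpace ℝ (Fin ν))) ∩ {t | r < ‖t‖}) ∂P :=
  lintegral_map (measurable_measure_inter volume
    (measurableSet_lt measurable_const measurable_norm)) hM.measurable_generic

variable [IsProbabilityMeasure P]

lemma ae_grainField_lt_top (hμ : meanVolume (P.map Ξ) < ∞) (t : Eucl ν) :
    ∀ᵐ ω ∂P, grainField u Ξs ω t < ∞ := by
  have := hM.marked.isProbabilityMeasure_mark
  have h1 : ∫⁻ ω, grainField u Ξs ω t ∂P = meanVolume (P.map Ξ) := by
    simp only [grainField_eq_tsum]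
    rw [hM.marked.lintegral_tsum_eq (f := (hitSet t).indicator fun _ => (1 : ℝ≥0∞))
      (measurable_const.indicator (measurableSet_hitSet t)), ← measure_hitSet _ t]
    exact lintegral_indicator_one (measurableSet_hitSet t)
  refine ae_lt_top (hM.measurable_grainField.comp measurable_prodMk_right) ?_
  rw [h1]
  exact hμ.ne

lemma ae_grainField_eq_natCount (hμ : meanVolume (P.map Ξ) < ∞) (t : Eucl ν) :
    ∀ᵐ ω ∂P, grainField u Ξs ω t = (IsMarkedPoisson.natCount u Ξs (hitSet t) ω : ℝ≥0∞) := by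
  have := hM.marked.isProbabilityMeasure_mark
  filter_upwards [hM.ae_grainField_lt_top hμ t, hM.marked.ae_natCount_eq (measurableSet_hitSet t)
    ((measure_hitSet (P.map Ξ) t).trans_lt hμ)] with ω h1 h2
  rw [← toReal_grainField] at h2
  rw [← ENNReal.toReal_eq_toReal_iff' h1.ne (ENNReal.natCast_ne_top _), ← h2,
    ENNReal.toReal_natCast]

/-- A function of `X(s)` and `X(t)` with bounded second difference, vanishing mean and vanishing
mean difference has correlation of the order of the squared overlap. -/
lemma abs_integral_mul_natCount_le (hμ : meanVolume (P.map Ξ) < ∞) {f : ℕ → ℝ} {C K : ℝ}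
    (hC : ∀ n : ℕ, |f n| ≤ C * (1 + n)) (hK : ∀ n, |f (n + 2) - 2 * f (n + 1) + f n| ≤ K)
    (h0 : ∫ n, f n ∂(poissonMeasure (meanVolume (P.map Ξ)).toNNReal) = 0)
    (h1 : ∫ n, (f (n + 1) - f n) ∂(poissonMeasure (meanVolume (P.map Ξ)).toNNReal) = 0)
    (s t : Eucl ν) :
    |∫ ω, f (IsMarkedPoisson.natCount u Ξs (hitSet s) ω) *
      f (IsMarkedPoisson.natCount u Ξs (hitSet t) ω) ∂P| ≤
      3 * K ^ 2 * (6 * (meanVolume (P.map Ξ)).toReal ^ 2 + 5 * (meanVolume (P.map Ξ)).toReal + 2) *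
        (overlap (P.map Ξ) (t - s)).toReal ^ 2 := by
  have := hM.marked.isProbabilityMeasure_mark
  have ms := measurableSet_hitSet s
  have mt := measurableSet_hitSet t
  have hs := measure_hitSet (P.map Ξ) s
  have ht := measure_hitSet (P.map Ξ) t
  have hst := measure_hitSet_inter (P.map Ξ) s t
  have hle := overlap_le_meanVolume (P.map Ξ) (t - s)
  have hA : (volume.prod (P.map Ξ)) (hitSet s \ hitSet t) < ∞ :=
    (measure_mono Set.sdiff_subset).trans_lt (hs.trans_lt hμ)
  have hB : (volume.prod (P.map Ξ)) (hitSet t \ hitSet s) < ∞ :=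
    (measure_mono Set.sdiff_subset).trans_lt (ht.trans_lt hμ)
  have hCC : (volume.prod (P.map Ξ)) (hitSet s ∩ hitSet t) < ∞ := hst.trans_lt (hle.trans_lt hμ)
  have h2 := hM.marked.integral_mul_natCount (ms.diff mt) (mt.diff ms) (ms.inter mt) hA hB hCC
    (Set.disjoint_left.mpr fun z hz hz' => hz.2 hz'.1)
    (Set.disjoint_left.mpr fun z hz hz' => hz'.2 hz.2)
    (Set.disjoint_left.mpr fun z hz hz' => hz'.2 hz.1) hC
  rw [Set.inter_union_sdiff, Set.inter_comm, Set.inter_union_sdiff, Set.inter_comm] at h2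
  rw [h2]
  have sA : ((volume.prod (P.map Ξ)) (hitSet s ∩ hitSet t)).toNNReal +
      ((volume.prod (P.map Ξ)) (hitSet s \ hitSet t)).toNNReal =
        (meanVolume (P.map Ξ)).toNNReal := by
    rw [← ENNReal.toNNReal_add hCC.ne hA.ne, measure_inter_add_sdiff _ mt, hs]
  have sB : ((volume.prod (P.map Ξ)) (hitSet s ∩ hitSet t)).toNNReal +
      ((volume.prod (P.map Ξ)) (hitSet t \ hitSet s)).toNNReal =
        (meanVolume (P.map Ξ)).toNNReal := by
    rw [← ENNReal.toNNReal_add hCC.ne hB.ne, Set.inter_comm, measure_inter_add_sdiff _ ms, ht]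
  have eAB : ((volume.prod (P.map Ξ)) (hitSet t \ hitSet s)).toNNReal =
      ((volume.prod (P.map Ξ)) (hitSet s \ hitSet t)).toNNReal := by
    rw [← sA] at sB
    exact add_left_cancel sB
  rw [← sA] at h0 h1
  rw [eAB]
  simp only [← sq]
  rw [abs_of_nonneg (integral_nonneg fun m => sq_nonneg _)]
  refine (integral_sq_integral_poissonMeasure_le hC hK h0 h1).trans ?_
  rw [hst]
  have hle' : (overlap (P.map Ξ) (t - s)).toReal ≤ (meanVolume (P.map Ξ)).toReal :=
    ENNReal.toReal_mono hμ.ne hle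
  have e : (((overlap (P.map Ξ) (t - s)).toNNReal : ℝ≥0) : ℝ) =
    (overlap (P.map Ξ) (t - s)).toReal := rfl
  rw [e, mul_right_comm]
  have := ENNReal.toReal_nonneg (a := overlap (P.map Ξ) (t - s))
  gcongr

end IsBooleanModel

end Model

/-! ### Scaling of the second moment of short-range fields -/

section Scaling

variable {ν : ℕ}

lemma lintegral_eq_lintegral_smul (f : Eucl ν → ℝ≥0∞) {r : ℝ} (hr : 0 < r) :
    ∫⁻ x, f x = ENNReal.ofReal (r ^ ν) * ∫⁻ x, f (r • x) := by
  have h1 := (Homeomorph.smulOfNeZero r hr.ne').measurableEmbedding.lintegral_map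
    (μ := (volume : Measure (Eucl ν))) f
  have h2 : Measure.map (Homeomorph.smulOfNeZero r hr.ne') (volume : Measure (Eucl ν)) =
      ENNReal.ofReal |(r ^ ν)⁻¹| • volume := by
    have h3 := Measure.map_addHaar_smul (volume : Measure (Eucl ν)) hr.ne'
    rw [finrank_euclideanSpace_fin] at h3
    exact h3
  rw [h2, lintegral_smul_measure] at h1
  simp only [Homeomorph.smulOfNeZero_apply] at h1
  have hp : 0 < r ^ ν := pow_pos hr ν
  rw [← h1, abs_of_pos (inv_pos.mpr hp), smul_eq_mul, ← mul_assoc, ← ENNReal.ofReal_mul hp.le,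
    mul_inv_cancel₀ hp.ne', ENNReal.ofReal_one, one_mul]

/-- The correlation of `|φ|` with its translate by `h`. -/
noncomputable def autocorrelation (φ : Eucl ν → ℝ) (h : Eucl ν) : ℝ≥0∞ :=
  ∫⁻ s, ‖φ s‖ₑ * ‖φ (s + h)‖ₑ

lemma measurable_autocorrelation {φ : Eucl ν → ℝ} (hφ : Measurable φ) :
    Measurable (autocorrelation φ) := by
  have : Measurable fun z : Eucl ν × Eucl ν => ‖φ z.2‖ₑ * ‖φ (z.2 + z.1)‖ₑ :=
    (hφ.comp measurable_snd).enorm.mul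
      (hφ.comp (measurable_snd.add measurable_fst)).enorm
  exact this.lintegral_prod_right'

lemma lintegral_autocorrelation {φ : Eucl ν → ℝ} (hφ : Measurable φ) :
    ∫⁻ h, autocorrelation φ h = (∫⁻ s, ‖φ s‖ₑ) ^ 2 := by
  have hm : Measurable fun z : Eucl ν × Eucl ν => ‖φ z.2‖ₑ * ‖φ (z.2 + z.1)‖ₑ :=
    (hφ.comp measurable_snd).enorm.mul
      (hφ.comp (measurable_snd.add measurable_fst)).enorm
  unfold autocorrelation
  rw [lintegral_lintegral_swap hm.aemeasurable]
  have : ∀ s, ∫⁻ h, ‖φ s‖ₑ * ‖φ (s + h)‖ₑ = ‖φ s‖ₑ * ∫⁻ h, ‖φ h‖ₑ := fun s => by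
    have hs : Measurable fun h => ‖φ (s + h)‖ₑ := (hφ.comp (measurable_const_add s)).enorm
    rw [lintegral_const_mul _ hs,
      lintegral_add_left_eq_self (fun h => ‖φ h‖ₑ) s]
  simp_rw [this]
  rw [lintegral_mul_const _ hφ.enorm, sq]

lemma autocorrelation_le {φ : Eucl ν → ℝ} (hφ : Measurable φ) {B : ℝ} (hB : ∀ s, |φ s| ≤ B)
    (h : Eucl ν) : autocorrelation φ h ≤ ENNReal.ofReal B * ∫⁻ s, ‖φ s‖ₑ := by
  rw [← lintegral_const_mul _ hφ.enorm]
  refine lintegral_mono fun s => ?_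
  simp only [mul_comm (ENNReal.ofReal B)]
  gcongr
  rw [Real.enorm_eq_ofReal_abs]
  exact ENNReal.ofReal_le_ofReal (hB _)

/-- A weighted double integral of a function of the difference, in the variable `h = (t - s) / r`. -/
lemma lintegral_prod_scaled_eq {φ : Eucl ν → ℝ} (hφ : Measurable φ) {G : Eucl ν → ℝ≥0∞}
    (hG : Measurable G) {r : ℝ} (hr : 0 < r) :
    ∫⁻ z : Eucl ν × Eucl ν, ‖φ (r⁻¹ • z.1)‖ₑ * ‖φ (r⁻¹ • z.2)‖ₑ * G (z.2 - z.1)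
        ∂(volume.prod volume) =
      ENNReal.ofReal (r ^ ν) ^ 2 * ∫⁻ h, autocorrelation φ h * G (r • h) := by
  have hφr : ∀ {p : Eucl ν × Eucl ν → Eucl ν}, Measurable p →
      Measurable fun z => ‖φ (r⁻¹ • p z)‖ₑ := fun {p} hp => by
    have h1 : Measurable fun z => r⁻¹ • p z := hp.const_smul r⁻¹
    exact (hφ.comp h1).enorm
  have hGr : Measurable fun h => G (r • h) := by
    have h1 : Measurable fun h : Eucl ν => r • h := measurable_id.const_smul r
    exact hG.comp h1
  have hm : Measurable fun z : Eucl ν × Eucl ν =>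
      ‖φ (r⁻¹ • z.1)‖ₑ * ‖φ (r⁻¹ • z.2)‖ₑ * G (z.2 - z.1) :=
    (hφr measurable_fst).mul (hφr measurable_snd) |>.mul (hG.comp (measurable_snd.sub measurable_fst))
  have hm2 : Measurable fun z : Eucl ν × Eucl ν =>
      ‖φ z.1‖ₑ * ‖φ (z.1 + z.2)‖ₑ * G (r • z.2) :=
    ((hφ.comp measurable_fst).enorm.mul
      (hφ.comp (measurable_fst.add measurable_snd)).enorm).mul (hGr.comp measurable_snd)
  have hrr : ∀ s : Eucl ν, r⁻¹ • r • s = s := fun s => inv_smul_smul₀ hr.ne' s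
  have inner : ∀ s, ∫⁻ t, ‖φ s‖ₑ * ‖φ (r⁻¹ • t)‖ₑ * G (t - r • s) =
      ENNReal.ofReal (r ^ ν) * ∫⁻ h, ‖φ s‖ₑ * ‖φ (s + h)‖ₑ * G (r • h) := fun s => by
    rw [lintegral_eq_lintegral_smul _ hr]
    simp only [hrr, ← smul_sub]
    rw [← lintegral_add_left_eq_self _ s]
    simp only [add_sub_cancel_left]
  rw [lintegral_prod _ hm.aemeasurable, lintegral_eq_lintegral_smul _ hr]
  simp only [hrr, inner]
  rw [lintegral_const_mul _ hm2.lintegral_prod_right', ← mul_assoc, ← sq]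
  congr 1
  rw [lintegral_lintegral_swap hm2.aemeasurable]
  refine lintegral_congr fun h => ?_
  have hs : Measurable fun s => ‖φ s‖ₑ * ‖φ (s + h)‖ₑ :=
    hφ.enorm.mul (hφ.comp (measurable_id.add_const h)).enorm
  exact lintegral_mul_const (G (r • h)) hs

/-- `‖h‖^{-b}`, `b < ν`, is integrable against the autocorrelation of a function in
`L¹ ∩ L^∞`. -/
lemma lintegral_autocorrelation_mul_rpow_lt_top (hν : 1 ≤ ν) {φ : Eucl ν → ℝ} (hφ : Measurable φ)
    {B : ℝ} (hB : ∀ s, |φ s| ≤ B) (hi : Integrable φ) {b : ℝ} (hb0 : 0 ≤ b) (hb : b < ν) :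
    ∫⁻ h, autocorrelation φ h * ENNReal.ofReal (‖h‖ ^ (-b)) < ∞ := by
  have hn : Measurable fun h : Eucl ν => ‖h‖ ^ (-b) := measurable_norm.pow_const _
  have hball : IntegrableOn (fun h : Eucl ν => ‖h‖ ^ (-b)) (Metric.ball 0 1) volume :=
    integrableOn_ball_of_norm_le_rpow (C := 1) (α := b) (by simpa using hν) (by simpa using hb)
      (ae_of_all _ fun x => by
        rw [one_mul, Real.norm_of_nonneg (Real.rpow_nonneg (norm_nonneg _) _)])
      hn.aestronglyMeasurable
  have h1 : ∫⁻ h, autocorrelation φ h * ENNReal.ofReal (‖h‖ ^ (-b)) ≤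
      (∫⁻ h in Metric.ball (0 : Eucl ν) 1, (ENNReal.ofReal B * ∫⁻ s, ‖φ s‖ₑ) *
        ENNReal.ofReal (‖h‖ ^ (-b))) + ∫⁻ h in (Metric.ball (0 : Eucl ν) 1)ᶜ,
          autocorrelation φ h := by
    rw [← lintegral_add_compl _ (measurableSet_ball (x := (0 : Eucl ν)) (ε := 1))]
    gcongr ?_ + ?_
    · refine lintegral_mono fun h => ?_
      gcongr
      exact autocorrelation_le hφ hB h
    · refine setLIntegral_mono (measurable_autocorrelation hφ) fun h hh => ?_
      refine mul_le_of_le_one_right' ?_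
      rw [ENNReal.ofReal_le_one]
      simp only [Set.mem_compl_iff, Metric.mem_ball, dist_zero_right, not_lt] at hh
      exact Real.rpow_le_one_of_one_le_of_nonpos hh (by linarith)
  refine h1.trans_lt (ENNReal.add_lt_top.mpr ⟨?_, ?_⟩)
  · rw [lintegral_const_mul _ hn.ennreal_ofReal]
    refine ENNReal.mul_lt_top (ENNReal.mul_lt_top ENNReal.ofReal_lt_top hi.2) ?_
    exact hball.lintegral_lt_top
  · refine (setLIntegral_le_lintegral _ _).trans_lt ?_
    rw [lintegral_autocorrelation hφ]
    exact ENNReal.pow_lt_top hi.2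

lemma measurable_overlap (Q : Measure (Closeds (Eucl ν))) [SFinite Q] : Measurable (overlap Q) := by
  have hs : MeasurableSet {w : (Eucl ν × Closeds (Eucl ν)) × Eucl ν |
      w.2 ∈ w.1.2 ∧ w.2 + w.1.1 ∈ w.1.2} :=
    ((measurable_snd.prodMk (measurable_snd.comp measurable_fst)) measurableSet_setOf_mem).inter
      (((measurable_snd.add (measurable_fst.comp measurable_fst)).prodMk
        (measurable_snd.comp measurable_fst)) measurableSet_setOf_mem)
  exact (measurable_measure_prodMk_left (ν := (volume : Measure (Eucl ν))) hs).lintegral_prod_right'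

/-- A bounded function that is `O(r^e)`, `e ≤ 0`, at infinity is `O(r^e)` on the half-line. -/
lemma exists_le_rpow_of_isBigO {g : ℝ → ℝ} {e M : ℝ} (he : e ≤ 0) (hM : ∀ r, g r ≤ M)
    (hg : g =O[atTop] fun r : ℝ => r ^ e) : ∃ C, 0 ≤ C ∧ ∀ r, 0 < r → g r ≤ C * r ^ e := by
  obtain ⟨c, hc⟩ := hg.bound
  obtain ⟨R, hR⟩ := eventually_atTop.mp hc
  set R' := max R 1
  have hR' : 0 < R' := lt_max_of_lt_right one_pos
  refine ⟨max |c| (|M| * R' ^ (-e)), le_max_of_le_left (abs_nonneg c), fun r hr => ?_⟩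
  have hre : 0 ≤ r ^ e := Real.rpow_nonneg hr.le e
  rcases le_total R' r with h | h
  · have h2 := hR r ((le_max_left _ _).trans h)
    rw [Real.norm_eq_abs, Real.norm_of_nonneg hre] at h2
    refine (le_abs_self _).trans (h2.trans ?_)
    gcongr
    exact (le_abs_self c).trans (le_max_left _ _)
  · calc g r ≤ |M| := (hM r).trans (le_abs_self _)
      _ = |M| * R' ^ (-e) * R' ^ e := by
        rw [mul_assoc, ← Real.rpow_add hR', neg_add_cancel, Real.rpow_zero, mul_one]
      _ ≤ |M| * R' ^ (-e) * r ^ e := by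
        exact mul_le_mul_of_nonneg_left (Real.rpow_le_rpow_of_nonpos hr h he) (by positivity)
      _ ≤ max |c| (|M| * R' ^ (-e)) * r ^ e := by
        gcongr
        exact le_max_right _ _

/-- If the mean grain volume beyond `r` is `o(r^e)`, `-ν < 2e ≤ 0`, then the weighted integral of
the squared overlap is `o(r^{2ν + 2e})`. -/
lemma tendsto_lintegral_overlap_sq (hν : 1 ≤ ν) (Q : Measure (Closeds (Eucl ν))) [SFinite Q]
    (hμ : meanVolume Q < ∞) {e : ℝ} (he : e ≤ 0) (he' : -(2 * e) < ν)
    (hfar : (fun r => (farVolume Q r).toReal) =o[atTop] fun r : ℝ => r ^ e)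
    {φ : Eucl ν → ℝ} (hφ : Measurable φ) {B : ℝ} (hB : ∀ s, |φ s| ≤ B) (hi : Integrable φ) :
    Tendsto (fun r : ℝ => ENNReal.ofReal (r ^ (-(2 * ν + 2 * e))) *
      ∫⁻ z : Eucl ν × Eucl ν, ‖φ (r⁻¹ • z.1)‖ₑ * ‖φ (r⁻¹ • z.2)‖ₑ * overlap Q (z.2 - z.1) ^ 2
        ∂(volume.prod volume)) atTop (𝓝 0) := by
  have : Nonempty (Fin ν) := ⟨⟨0, hν⟩⟩
  have hov : ∀ h, overlap Q h < ∞ := fun h => (overlap_le_meanVolume Q h).trans_lt hμ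
  have hfv : ∀ r, farVolume Q r < ∞ := fun r => (farVolume_le_meanVolume Q r).trans_lt hμ
  obtain ⟨C, hC0, hC⟩ := exists_le_rpow_of_isBigO he
    (fun r => ENNReal.toReal_mono hμ.ne (farVolume_le_meanVolume Q r)) hfar.isBigO
  have hoF : ∀ {h : Eucl ν} {r : ℝ}, h ≠ 0 → 0 < r →
      (overlap Q (r • h)).toReal ≤ 2 * (farVolume Q (r * (‖h‖ / 4))).toReal := by
    intro h r hh hr
    have hpos : 0 < ‖h‖ := norm_pos_iff.mpr hh
    have h1 : r * (‖h‖ / 4) < ‖r • h‖ / 2 := by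
      rw [norm_smul, Real.norm_of_nonneg hr.le]
      nlinarith
    have h2 := ENNReal.toReal_mono (ENNReal.mul_lt_top ENNReal.ofNat_lt_top (hfv _)).ne
      (overlap_le_farVolume Q h1)
    simpa using h2
  have hG := (measurable_overlap Q).pow_const 2
  -- the integral in the variable `h = (t - s) / r`
  have key : Tendsto (fun r : ℝ => ∫⁻ h, autocorrelation φ h *
      ENNReal.ofReal ((r ^ (-e) * (overlap Q (r • h)).toReal) ^ 2)) atTop (𝓝 0) := by
    have h0 : ∫⁻ _ : Eucl ν, (0 : ℝ≥0∞) = 0 := lintegral_zero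
    rw [← h0]
    refine tendsto_lintegral_filter_of_dominated_convergence
      (fun h => autocorrelation φ h *
        (ENNReal.ofReal ((2 * C * (1 / 4) ^ e) ^ 2) * ENNReal.ofReal (‖h‖ ^ (-(-(2 * e))))))
      ?_ ?_ ?_ ?_
    · refine Eventually.of_forall fun r => (measurable_autocorrelation hφ).mul ?_
      have : Measurable fun h : Eucl ν => overlap Q (r • h) :=
        (measurable_overlap Q).comp (measurable_id.const_smul r)
      exact ((this.ennreal_toReal.const_mul _).pow_const 2).ennreal_ofReal
    · filter_upwards [eventually_gt_atTop 0] with r hr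
      filter_upwards [Measure.ae_ne volume (0 : Eucl ν)] with h hh
      have hpos : 0 < ‖h‖ := norm_pos_iff.mpr hh
      rw [← ENNReal.ofReal_mul (by positivity)]
      gcongr
      have h1 : r ^ (-e) * (overlap Q (r • h)).toReal ≤ 2 * C * (1 / 4) ^ e * ‖h‖ ^ e := by
        calc r ^ (-e) * (overlap Q (r • h)).toReal
            ≤ r ^ (-e) * (2 * (C * (r * (‖h‖ / 4)) ^ e)) := by
              gcongr
              exact (hoF hh hr).trans (by gcongr; exact hC _ (by positivity))
          _ = 2 * C * (1 / 4) ^ e * ‖h‖ ^ e := by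
              rw [Real.mul_rpow hr.le (by positivity), div_eq_mul_one_div,
                Real.mul_rpow hpos.le (by norm_num)]
              have : r ^ (-e) * r ^ e = 1 := by
                rw [← Real.rpow_add hr, neg_add_cancel, Real.rpow_zero]
              linear_combination (2 * C * (1 / 4) ^ e * ‖h‖ ^ e) * this
      calc (r ^ (-e) * (overlap Q (r • h)).toReal) ^ 2
          ≤ (2 * C * (1 / 4) ^ e * ‖h‖ ^ e) ^ 2 := by
            gcongr
        _ = (2 * C * (1 / 4) ^ e) ^ 2 * ‖h‖ ^ (-(-(2 * e))) := by
            rw [mul_pow _ (‖h‖ ^ e), neg_neg, ← Real.rpow_natCast (‖h‖ ^ e),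
              ← Real.rpow_mul hpos.le]
            congr 2
            push_cast
            ring
    · have e1 : ∀ h : Eucl ν, autocorrelation φ h *
          (ENNReal.ofReal ((2 * C * (1 / 4) ^ e) ^ 2) * ENNReal.ofReal (‖h‖ ^ (-(-(2 * e))))) =
          ENNReal.ofReal ((2 * C * (1 / 4) ^ e) ^ 2) *
            (autocorrelation φ h * ENNReal.ofReal (‖h‖ ^ (-(-(2 * e))))) := fun h => by ring
      simp only [e1]
      rw [lintegral_const_mul' _ _ ENNReal.ofReal_ne_top]
      exact (ENNReal.mul_lt_top ENNReal.ofReal_lt_top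
        (lintegral_autocorrelation_mul_rpow_lt_top hν hφ hB hi (by linarith) he')).ne
    · filter_upwards [Measure.ae_ne volume (0 : Eucl ν)] with h hh
      have hpos : 0 < ‖h‖ := norm_pos_iff.mpr hh
      have hlim : Tendsto (fun r : ℝ => r ^ (-e) * (overlap Q (r • h)).toReal) atTop (𝓝 0) := by
        have h1 : Tendsto (fun r : ℝ => (farVolume Q (r * (‖h‖ / 4))).toReal /
            (r * (‖h‖ / 4)) ^ e) atTop (𝓝 0) :=
          hfar.tendsto_div_nhds_zero.comp (tendsto_id.atTop_mul_const (by positivity))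
        have h2 := h1.const_mul (2 * (‖h‖ / 4) ^ e)
        rw [mul_zero] at h2
        refine tendsto_of_tendsto_of_tendsto_of_le_of_le' tendsto_const_nhds h2 ?_ ?_
        · filter_upwards [eventually_gt_atTop 0] with r hr
          positivity
        · filter_upwards [eventually_gt_atTop 0] with r hr
          have h3 : 0 < r ^ e := Real.rpow_pos_of_pos hr e
          have h4 : 0 < (‖h‖ / 4) ^ e := Real.rpow_pos_of_pos (by positivity) e
          rw [Real.mul_rpow hr.le (by positivity), Real.rpow_neg hr.le]
          have h5 := hoF hh hr
          rw [inv_mul_le_iff₀ h3]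
          refine h5.trans (le_of_eq ?_)
          field_simp
      have h2 := (ENNReal.tendsto_ofReal (hlim.pow 2))
      have h3 := ENNReal.Tendsto.const_mul (a := autocorrelation φ h) h2 (Or.inr ?_)
      · simpa using h3
      · exact ((autocorrelation_le hφ hB h).trans_lt
          (ENNReal.mul_lt_top ENNReal.ofReal_lt_top hi.2)).ne
  refine key.congr' ?_
  filter_upwards [eventually_gt_atTop 0] with r hr
  rw [lintegral_prod_scaled_eq hφ hG hr, ← mul_assoc, ← ENNReal.ofReal_pow (by positivity),
    ← ENNReal.ofReal_mul (by positivity), ← lintegral_const_mul']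
  · refine lintegral_congr fun h => ?_
    rw [mul_left_comm]
    congr 1
    rw [mul_pow, ENNReal.ofReal_mul (by positivity), ENNReal.ofReal_pow ENNReal.toReal_nonneg,
      ENNReal.ofReal_toReal (hov _).ne]
    congr 2
    rw [← pow_mul, ← Real.rpow_natCast, ← Real.rpow_natCast, ← Real.rpow_mul hr.le,
      ← Real.rpow_add hr]
    congr 1
    push_cast
    ring
  · exact ENNReal.ofReal_ne_top

end Scaling

/-! ### Linearization of the excursion indicators -/

/-- The probability that a Poisson variable with mean `m` is at least `k`. -/
noncomputable def poissonTail (m : ℝ≥0) (k : ℕ) : ℝ :=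
  ∫ n : ℕ, (if k ≤ n then (1 : ℝ) else 0) ∂(poissonMeasure m)

/-- The probability that a Poisson variable with mean `m` equals `k - 1`; it is the first
coefficient in the Charlier expansion of `n ↦ 1(n ≥ k)`. -/
noncomputable def charlierCoeff (m : ℝ≥0) (k : ℕ) : ℝ :=
  Real.exp (-m) * m ^ (k - 1) / (k - 1).factorial

/-- The function `n ↦ 1(n ≥ k)` minus the terms of order zero and one of its Charlier expansion. -/
noncomputable def charlierRemainder (m : ℝ≥0) (k n : ℕ) : ℝ :=
  (if k ≤ n then (1 : ℝ) else 0) - poissonTail m k - charlierCoeff m k * (n - m)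

section Charlier

variable (m : ℝ≥0) (k : ℕ)

lemma abs_charlierRemainder_le (n : ℕ) : |charlierRemainder m k n| ≤
    (1 + |poissonTail m k| + |charlierCoeff m k| * (1 + m)) * (1 + n) := by
  have hn : (0 : ℝ) ≤ n := n.cast_nonneg
  have hm : (0 : ℝ) ≤ m := m.2
  have h1 : |(if k ≤ n then (1 : ℝ) else 0)| ≤ 1 := by split_ifs <;> simp
  have h2 : |(n : ℝ) - m| ≤ n + m := by
    rw [abs_le]
    constructor <;> linarith
  have h3 : |charlierCoeff m k * (n - m)| ≤ |charlierCoeff m k| * (n + m) := by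
    rw [abs_mul]
    gcongr
  have h4 := abs_nonneg (poissonTail m k)
  have h5 := abs_nonneg (charlierCoeff m k)
  refine (abs_sub _ _).trans ((add_le_add (abs_sub _ _) h3).trans ?_)
  nlinarith [mul_nonneg h4 hn, mul_nonneg (mul_nonneg h5 hn) hm, mul_nonneg h5 hn]

lemma abs_second_diff_charlierRemainder_le (n : ℕ) :
    |charlierRemainder m k (n + 2) - 2 * charlierRemainder m k (n + 1) +
      charlierRemainder m k n| ≤ 2 := by
  have e : charlierRemainder m k (n + 2) - 2 * charlierRemainder m k (n + 1) +
      charlierRemainder m k n = (if k ≤ n + 2 then (1 : ℝ) else 0) -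
        2 * (if k ≤ n + 1 then (1 : ℝ) else 0) + (if k ≤ n then (1 : ℝ) else 0) := by
    unfold charlierRemainder
    push_cast
    ring
  rw [e, abs_le]
  constructor <;> split_ifs <;> norm_num

lemma integrable_indicator_poissonMeasure :
    Integrable (fun n : ℕ => if k ≤ n then (1 : ℝ) else 0) (poissonMeasure m) :=
  Integrable.of_bound (by fun_prop) 1 (ae_of_all _ fun n => by split_ifs <;> simp)

lemma integral_charlierRemainder :
    ∫ n, charlierRemainder m k n ∂(poissonMeasure m) = 0 := by
  have i1 := integrable_pow_poissonMeasure m 1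
  have m1 := integral_descFactorial_poissonMeasure m 1
  simp only [pow_one, Nat.descFactorial_one] at i1 m1
  unfold charlierRemainder
  rw [integral_sub (integrable_fun_sub (integrable_indicator_poissonMeasure m k)
      (integrable_const _)) ((integrable_fun_sub i1 (integrable_const _)).const_mul _),
    integral_sub (integrable_indicator_poissonMeasure m k) (integrable_const _),
    integral_const_mul, integral_sub i1 (integrable_const _), m1]
  simp [poissonTail]

variable {k} in
lemma integral_diff_charlierRemainder (hk : 1 ≤ k) :
    ∫ n, (charlierRemainder m k (n + 1) - charlierRemainder m k n) ∂(poissonMeasure m) = 0 := by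
  have e : ∀ n, charlierRemainder m k (n + 1) - charlierRemainder m k n =
      ({k - 1} : Set ℕ).indicator (fun _ => (1 : ℝ)) n - charlierCoeff m k := by
    intro n
    have h1 : (if k ≤ n + 1 then (1 : ℝ) else 0) - (if k ≤ n then (1 : ℝ) else 0) =
        ({k - 1} : Set ℕ).indicator (fun _ => (1 : ℝ)) n := by
      classical
      rw [Set.indicator_apply]
      simp only [Set.mem_singleton_iff]
      split_ifs <;> first | omega | norm_num
    unfold charlierRemainder
    rw [← h1]
    push_cast
    ring
  simp_rw [e]
  have hi : Integrable (({k - 1} : Set ℕ).indicator fun _ => (1 : ℝ)) (poissonMeasure m) :=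
    (integrable_indicator_iff (by measurability)).mpr (integrableOn_const (by finiteness))
  rw [integral_sub hi (integrable_const _), integral_indicator_const _ (by measurability),
    poissonMeasure_real_singleton]
  simp [charlierCoeff]

end Charlier

section Model

variable {Ω : Type*} {ν : ℕ} [MeasurableSpace Ω] {P : Measure Ω} [IsProbabilityMeasure P]
  {u : ℕ → Ω → Eucl ν} {Ξs : ℕ → Ω → Closeds (Eucl ν)} {Ξ : Ω → Closeds (Eucl ν)}

namespace IsBooleanModel

variable (hM : IsBooleanModel P u Ξs Ξ)
include hM

omit [IsProbabilityMeasure P] in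
lemma measurable_excursion (k : ℕ) :
    Measurable fun z : Ω × Eucl ν => excursion u Ξs k z.1 z.2 := by
  have hs : MeasurableSet {z : Ω × Eucl ν | (k : ℝ≥0∞) ≤ grainField u Ξs z.1 z.2} :=
    measurableSet_le measurable_const hM.measurable_grainField
  exact measurable_const.indicator hs (f := fun _ => (1 : ℝ))

omit [IsProbabilityMeasure P] in
lemma measurable_toReal_grainField :
    Measurable fun z : Ω × Eucl ν => (grainField u Ξs z.1 z.2).toReal :=
  hM.measurable_grainField.ennreal_toReal

omit [IsProbabilityMeasure P] in
lemma coe_meanVolume : ((meanVolume (P.map Ξ)).toNNReal : ℝ) = meanGrainVolume P Ξ := by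
  rw [meanGrainVolume, ← hM.meanVolume_eq]
  rfl

variable (hμ : meanVolume (P.map Ξ) < ∞)
include hμ

lemma hitSet_lt_top (t : Eucl ν) : (volume.prod (P.map Ξ)) (hitSet t) < ∞ := by
  have := hM.marked.isProbabilityMeasure_mark
  rwa [measure_hitSet]

lemma ae_toReal_grainField (t : Eucl ν) : ∀ᵐ ω ∂P, (grainField u Ξs ω t).toReal =
    IsMarkedPoisson.natCount u Ξs (hitSet t) ω := by
  filter_upwards [hM.ae_grainField_eq_natCount hμ t] with ω h
  rw [h, ENNReal.toReal_natCast]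

lemma ae_excursion (k : ℕ) (t : Eucl ν) : ∀ᵐ ω ∂P, excursion u Ξs k ω t =
    if k ≤ IsMarkedPoisson.natCount u Ξs (hitSet t) ω then 1 else 0 := by
  classical
  filter_upwards [hM.ae_grainField_eq_natCount hμ t] with ω h
  rw [excursion, Set.indicator_apply]
  simp only [Set.mem_ofPred_eq, h, Nat.cast_le]

/-- The one-point law of the grain field is Poisson. -/
lemma integral_comp_natCount (f : ℕ → ℝ) (t : Eucl ν) :
    ∫ ω, f (IsMarkedPoisson.natCount u Ξs (hitSet t) ω) ∂P =
      ∫ n, f n ∂(poissonMeasure (meanVolume (P.map Ξ)).toNNReal) := by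
  have := hM.marked.isProbabilityMeasure_mark
  rw [hM.marked.integral_natCount (measurableSet_hitSet t) (hM.hitSet_lt_top hμ t),
    measure_hitSet]

lemma integrable_grainField (t : Eucl ν) :
    Integrable (fun ω => (grainField u Ξs ω t).toReal) P := by
  have h := (hM.marked.memLp_two_natCount (measurableSet_hitSet t) (hM.hitSet_lt_top hμ t)
    (f := fun n => (n : ℝ)) (C := 1) fun n => by
      rw [abs_of_nonneg n.cast_nonneg]
      linarith).integrable one_le_two
  refine h.congr ?_
  filter_upwards [hM.ae_toReal_grainField hμ t] with ω hω
  exact hω.symm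

lemma integral_grainField (t : Eucl ν) :
    ∫ ω, (grainField u Ξs ω t).toReal ∂P = meanGrainVolume P Ξ := by
  rw [integral_congr_ae (hM.ae_toReal_grainField hμ t),
    hM.integral_comp_natCount hμ (fun n => (n : ℝ)), ← hM.coe_meanVolume]
  simpa using integral_descFactorial_poissonMeasure (meanVolume (P.map Ξ)).toNNReal 1

lemma integrable_mul_grainField {φ : Eucl ν → ℝ} (hφ : Integrable φ) :
    Integrable (fun z : Ω × Eucl ν => φ z.2 * (grainField u Ξs z.1 z.2).toReal)
      (P.prod volume) :=
  integrable_mul_field hM.measurable_toReal_grainField hφ (fun t => hM.integrable_grainField hμ t)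
    (C := meanGrainVolume P Ξ) fun t => by
      simp only [ENNReal.abs_toReal]
      exact (hM.integral_grainField hμ t).le

lemma integral_mul_grainField {φ : Eucl ν → ℝ} (hφ : Integrable φ) :
    ∫ ω, (∫ t, φ t * (grainField u Ξs ω t).toReal) ∂P = meanGrainVolume P Ξ * ∫ t, φ t :=
  integral_integral_mul_field hM.measurable_toReal_grainField hφ
    (fun t => hM.integrable_grainField hμ t) (C := meanGrainVolume P Ξ) (fun t => by
      simp only [ENNReal.abs_toReal]
      exact (hM.integral_grainField hμ t).le) fun t => hM.integral_grainField hμ t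

omit [MeasurableSpace Ω] [IsProbabilityMeasure P] hM hμ in
lemma abs_excursion_le (k : ℕ) (ω : Ω) (t : Eucl ν) : |excursion u Ξs k ω t| ≤ 1 := by
  classical
  rw [excursion, Set.indicator_apply]
  split_ifs <;> simp

omit hμ in
lemma integrable_excursion (k : ℕ) (t : Eucl ν) :
    Integrable (fun ω => excursion u Ξs k ω t) P :=
  Integrable.of_bound ((hM.measurable_excursion k).comp measurable_prodMk_right).aestronglyMeasurable
    1 (ae_of_all _ fun ω => abs_excursion_le k ω t)

omit hμ in
lemma integral_abs_excursion_le (k : ℕ) (t : Eucl ν) :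
    ∫ ω, |excursion u Ξs k ω t| ∂P ≤ 1 := by
  refine (integral_mono (hM.integrable_excursion k t).abs (integrable_const (1 : ℝ))
    fun ω => abs_excursion_le k ω t).trans ?_
  simp

lemma integral_excursion (k : ℕ) (t : Eucl ν) : ∫ ω, excursion u Ξs k ω t ∂P =
    poissonTail (meanVolume (P.map Ξ)).toNNReal k := by
  rw [integral_congr_ae (hM.ae_excursion hμ k t),
    hM.integral_comp_natCount hμ (fun n => if k ≤ n then (1 : ℝ) else 0)]
  rfl

omit hμ in
lemma integrable_mul_excursion (k : ℕ) {φ : Eucl ν → ℝ} (hφ : Integrable φ) :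
    Integrable (fun z : Ω × Eucl ν => φ z.2 * excursion u Ξs k z.1 z.2) (P.prod volume) :=
  integrable_mul_field (hM.measurable_excursion k) hφ (fun t => hM.integrable_excursion k t)
    fun t => hM.integral_abs_excursion_le k t

lemma integral_mul_excursion (k : ℕ) {φ : Eucl ν → ℝ} (hφ : Integrable φ) :
    ∫ ω, (∫ t, φ t * excursion u Ξs k ω t) ∂P =
      poissonTail (meanVolume (P.map Ξ)).toNNReal k * ∫ t, φ t :=
  integral_integral_mul_field (hM.measurable_excursion k) hφ
    (fun t => hM.integrable_excursion k t) (fun t => hM.integral_abs_excursion_le k t)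
    fun t => hM.integral_excursion hμ k t

/-- The centred integral of the excursion indicator differs from a multiple of the centred
integral of the field by a term whose second moment is controlled by the squared overlap. -/
lemma lintegral_sq_linearization_le {k : ℕ} (hk : 1 ≤ k) :
    ∃ K : ℝ, 0 ≤ K ∧ ∀ φ : Eucl ν → ℝ, Integrable φ →
      ∫⁻ ω, ‖((∫ t, φ t * excursion u Ξs k ω t) -
          ∫ ω', (∫ t, φ t * excursion u Ξs k ω' t) ∂P) -
        charlierCoeff (meanVolume (P.map Ξ)).toNNReal k *
          ((∫ t, φ t * (grainField u Ξs ω t).toReal) -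
            ∫ ω', (∫ t, φ t * (grainField u Ξs ω' t).toReal) ∂P)‖ₑ ^ 2 ∂P ≤
        ∫⁻ z : Eucl ν × Eucl ν, ‖φ z.1‖ₑ * ‖φ z.2‖ₑ *
          (ENNReal.ofReal K * overlap (P.map Ξ) (z.2 - z.1) ^ 2) ∂(volume.prod volume) := by
  set m := (meanVolume (P.map Ξ)).toNNReal with hm
  set q := charlierCoeff m k with hq
  set p := poissonTail m k with hp
  let W : Ω × Eucl ν → ℝ := fun z => excursion u Ξs k z.1 z.2 - p -
    q * ((grainField u Ξs z.1 z.2).toReal - meanGrainVolume P Ξ)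
  have hW : Measurable W := ((hM.measurable_excursion k).sub_const p).sub
    ((hM.measurable_toReal_grainField.sub_const _).const_mul q)
  have hWN : ∀ t, ∀ᵐ ω ∂P, W (ω, t) =
      charlierRemainder m k (IsMarkedPoisson.natCount u Ξs (hitSet t) ω) := fun t => by
    filter_upwards [hM.ae_excursion hμ k t, hM.ae_toReal_grainField hμ t] with ω h1 h2
    simp only [W, h1, h2, charlierRemainder, ← hM.coe_meanVolume]
    rfl
  have hL : ∀ t, MemLp (fun ω => W (ω, t)) 2 P := fun t =>
    (memLp_congr_ae (hWN t)).mpr (hM.marked.memLp_two_natCount (measurableSet_hitSet t)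
      (hM.hitSet_lt_top hμ t) (abs_charlierRemainder_le m k))
  have hsq : ∀ t, ∫ ω, W (ω, t) ^ 2 ∂P ≤
      ∫ n, charlierRemainder m k n ^ 2 ∂(poissonMeasure m) := fun t => by
    rw [← hM.integral_comp_natCount hμ (fun n => charlierRemainder m k n ^ 2) t]
    refine (integral_congr_ae ?_).le
    filter_upwards [hWN t] with ω h
    rw [h]
  refine ⟨3 * 2 ^ 2 * (6 * (meanVolume (P.map Ξ)).toReal ^ 2 +
    5 * (meanVolume (P.map Ξ)).toReal + 2), ?_, fun φ hφ => ?_⟩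
  · have := ENNReal.toReal_nonneg (a := meanVolume (P.map Ξ))
    positivity
  have hc : ∀ s t, ‖∫ ω, W (ω, s) * W (ω, t) ∂P‖ₑ ≤
      ENNReal.ofReal (3 * 2 ^ 2 * (6 * (meanVolume (P.map Ξ)).toReal ^ 2 +
        5 * (meanVolume (P.map Ξ)).toReal + 2)) * overlap (P.map Ξ) (t - s) ^ 2 := by
    intro s t
    have h1 := hM.abs_integral_mul_natCount_le hμ (abs_charlierRemainder_le m k)
      (abs_second_diff_charlierRemainder_le m k) (integral_charlierRemainder m k)
      (integral_diff_charlierRemainder m hk) s t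
    have h2 : ∫ ω, W (ω, s) * W (ω, t) ∂P =
        ∫ ω, charlierRemainder m k (IsMarkedPoisson.natCount u Ξs (hitSet s) ω) *
          charlierRemainder m k (IsMarkedPoisson.natCount u Ξs (hitSet t) ω) ∂P := by
      refine integral_congr_ae ?_
      filter_upwards [hWN s, hWN t] with ω h1 h2
      rw [h1, h2]
    have hov : overlap (P.map Ξ) (t - s) ≠ ∞ :=
      ((overlap_le_meanVolume (P.map Ξ) (t - s)).trans_lt hμ).ne
    rw [h2, Real.enorm_eq_ofReal_abs]
    refine (ENNReal.ofReal_le_ofReal h1).trans (le_of_eq ?_)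
    rw [ENNReal.ofReal_mul' (by positivity), ENNReal.ofReal_pow ENNReal.toReal_nonneg,
      ENNReal.ofReal_toReal hov]
  refine le_trans (le_of_eq ?_) (lintegral_sq_integral_mul_field_le hW hφ hL hsq hc)
  refine lintegral_congr_ae ?_
  filter_upwards [(hM.integrable_mul_grainField hμ hφ).prod_right_ae,
    (hM.integrable_mul_excursion k hφ).prod_right_ae] with ω h1 h2
  have e : ∫ t, φ t * W (ω, t) = (∫ t, φ t * excursion u Ξs k ω t) - p * (∫ t, φ t) -
      q * ((∫ t, φ t * (grainField u Ξs ω t).toReal) - meanGrainVolume P Ξ * ∫ t, φ t) := by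
    have e1 : ∀ t, φ t * W (ω, t) = φ t * excursion u Ξs k ω t - p * φ t -
        q * (φ t * (grainField u Ξs ω t).toReal - meanGrainVolume P Ξ * φ t) := fun t => by
      simp only [W]
      ring
    simp_rw [e1]
    rw [integral_sub (integrable_fun_sub h2 (hφ.const_mul p))
      ((integrable_fun_sub h1 (hφ.const_mul _)).const_mul q), integral_sub h2 (hφ.const_mul p),
      integral_const_mul, integral_const_mul, integral_sub h1 (hφ.const_mul _),
      integral_const_mul]
  rw [e, hM.integral_mul_grainField hμ hφ, hM.integral_mul_excursion hμ k hφ]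

end IsBooleanModel

end Model

/-! ### Regularly varying tails -/

/-- The function `e^{iz} - 1 - iz`, the exponent of a centred Poisson variable with jumps `z`. -/
noncomputable def centredExp (z : ℝ) : ℂ := Complex.exp (Complex.I * z) - 1 - Complex.I * z

lemma hasDerivAt_centredExp (z : ℝ) :
    HasDerivAt centredExp (Complex.I * (Complex.exp (Complex.I * z) - 1)) z := by
  have h1 : HasDerivAt (fun x : ℝ => Complex.I * (x : ℂ)) Complex.I z := by
    simpa using (Complex.ofRealCLM.hasDerivAt (x := z)).const_mul Complex.I
  have h2 := (h1.cexp.sub_const 1).sub h1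
  convert! h2 using 1
  ring

lemma norm_exp_I_mul_sub_one_le (z : ℝ) : ‖Complex.exp (Complex.I * z) - 1‖ ≤ min 2 |z| := by
  refine le_min ?_ Real.norm_exp_I_mul_ofReal_sub_one_le
  refine (norm_sub_le _ _).trans ?_
  rw [Complex.norm_exp_I_mul_ofReal, norm_one]
  norm_num

/-- `e^{iz} - 1 - iz` is Lipschitz with constant `min 2 r` on `[-r, r]`. -/
lemma norm_centredExp_sub_le {r x y : ℝ} (hx : |x| ≤ r) (hy : |y| ≤ r) :
    ‖centredExp x - centredExp y‖ ≤ min 2 r * |x - y| := by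
  have h := Convex.norm_image_sub_le_of_norm_hasDerivWithin_le (f := centredExp)
    (s := Set.Icc (-r) r) (C := min 2 r) (x := y) (y := x)
    (fun z _ => (hasDerivAt_centredExp z).hasDerivWithinAt) (fun z hz => ?_) (convex_Icc _ _)
    (abs_le.mp hy) (abs_le.mp hx)
  · exact h
  · rw [norm_mul, Complex.norm_I, one_mul]
    exact (norm_exp_I_mul_sub_one_le z).trans (min_le_min_left _ (abs_le.mpr hz))

lemma centredExp_zero : centredExp 0 = 0 := by simp [centredExp]

lemma norm_centredExp_le (x : ℝ) : ‖centredExp x‖ ≤ 2 * |x| := by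
  have h := norm_centredExp_sub_le (r := |x|) (x := x) (y := 0) le_rfl (by simp)
  rw [centredExp_zero, sub_zero, sub_zero] at h
  exact h.trans (mul_le_mul_of_nonneg_right (min_le_left _ _) (abs_nonneg _))

lemma continuous_centredExp : Continuous centredExp := by
  unfold centredExp
  fun_prop

lemma integrableOn_min_mul_rpow {α M : ℝ} (hM : 0 ≤ M) (hα₁ : 1 < α) (hα₂ : α < 2) :
    IntegrableOn (fun x : ℝ => min 2 (M * x) * x ^ (-α)) (Set.Ioi 0) := by
  have hm : Measurable fun x : ℝ => min 2 (M * x) * x ^ (-α) :=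
    (measurable_const.min (measurable_id.const_mul M)).mul (measurable_id.pow_const _)
  rw [← Set.Ioc_union_Ioi_eq_Ioi zero_le_one]
  refine IntegrableOn.union ?_ ?_
  · have h1 : IntegrableOn (fun x : ℝ => M * x ^ (1 - α)) (Set.Ioc 0 1) := by
      have := (intervalIntegral.intervalIntegrable_rpow' (a := 0) (b := 1) (r := 1 - α)
        (by linarith)).const_mul M
      rwa [intervalIntegrable_iff_integrableOn_Ioc_of_le zero_le_one] at this
    refine h1.mono' hm.aestronglyMeasurable ((ae_restrict_mem measurableSet_Ioc).mono ?_)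
    intro x hx
    have hx0 : 0 < x := hx.1
    rw [Real.norm_of_nonneg (mul_nonneg (le_min zero_le_two (by positivity)) (by positivity)),
      sub_eq_add_neg, Real.rpow_add hx0, Real.rpow_one, ← mul_assoc]
    gcongr
    exact min_le_right _ _
  · have h1 : IntegrableOn (fun x : ℝ => 2 * x ^ (-α)) (Set.Ioi 1) :=
      (integrableOn_Ioi_rpow_of_lt (by linarith) one_pos).const_mul 2
    refine h1.mono' hm.aestronglyMeasurable ((ae_restrict_mem measurableSet_Ioi).mono ?_)
    intro x hx
    have hx0 : 0 < x := one_pos.trans hx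
    rw [Real.norm_of_nonneg (mul_nonneg (le_min zero_le_two (by positivity)) (by positivity))]
    gcongr
    exact min_le_left _ _

section Tail

variable {S : Type*} [MeasurableSpace S] {Q : Measure S} {R : S → ℝ} {α c : ℝ}

/-- Rescaled tails converge to the power law. -/
lemma tendsto_scaled_tail (hc : 0 < c)
    (htail : (fun x : ℝ => Q.real {s | x < R s}) ~[atTop] fun x : ℝ => c * x ^ (-α)) {x : ℝ}
    (hx : 0 < x) :
    Tendsto (fun a : ℝ => a ^ α * Q.real {s | a * x < R s}) atTop (𝓝 (c * x ^ (-α))) := by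
  have h1 := (isEquivalent_iff_tendsto_one (by
    filter_upwards [eventually_gt_atTop 0] with y hy
    positivity)).mp htail
  have h2 := (h1.comp (tendsto_id.atTop_mul_const hx)).mul_const (c * x ^ (-α))
  rw [one_mul] at h2
  refine h2.congr' ?_
  filter_upwards [eventually_gt_atTop 0] with a ha
  simp only [Function.comp_apply, Pi.div_apply, id_eq]
  rw [Real.mul_rpow ha.le hx.le, Real.rpow_neg ha.le]
  have h3 : 0 < a ^ α := Real.rpow_pos_of_pos ha α
  have h4 : 0 < x ^ (-α) := Real.rpow_pos_of_pos hx _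
  field_simp

lemma scaled_tail_le {C : ℝ} (hC : ∀ x, 0 < x → Q.real {s | x < R s} ≤ C * x ^ (-α)) {a x : ℝ}
    (ha : 0 < a) (hx : 0 < x) : a ^ α * Q.real {s | a * x < R s} ≤ C * x ^ (-α) := by
  have h3 : 0 < a ^ α := Real.rpow_pos_of_pos ha α
  have h := mul_le_mul_of_nonneg_left (hC (a * x) (mul_pos ha hx)) h3.le
  refine h.trans (le_of_eq ?_)
  rw [Real.mul_rpow ha.le hx.le, Real.rpow_neg ha.le]
  field_simp

variable [IsProbabilityMeasure Q]

lemma measurable_tail (Q : Measure S) [IsProbabilityMeasure Q] (R : S → ℝ) :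
    Measurable fun x : ℝ => Q.real {s | x < R s} := by
  have h : Antitone fun x : ℝ => Q.real {s | x < R s} := fun x y hxy =>
    measureReal_mono fun s hs => lt_of_le_of_lt hxy hs
  exact h.measurable

/-- The tail asymptotics yield a bound on the whole half-line. -/
lemma exists_tail_le (hα : 0 < α)
    (htail : (fun x : ℝ => Q.real {s | x < R s}) ~[atTop] fun x : ℝ => c * x ^ (-α)) :
    ∃ C, 0 ≤ C ∧ ∀ x, 0 < x → Q.real {s | x < R s} ≤ C * x ^ (-α) :=
  exists_le_rpow_of_isBigO (by linarith) (fun x => measureReal_le_one)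
    (htail.isBigO.trans (isBigO_const_mul_self c _ _))

lemma integrable_of_tail (hR : Measurable R) (hR0 : ∀ s, 0 ≤ R s) (hα₁ : 1 < α) {C : ℝ}
    (hC : ∀ x, 0 < x → Q.real {s | x < R s} ≤ C * x ^ (-α)) : Integrable R Q := by
  refine ⟨hR.aestronglyMeasurable, ?_⟩
  rw [hasFiniteIntegral_iff_ofReal (ae_of_all _ hR0),
    lintegral_eq_lintegral_meas_lt Q (ae_of_all _ hR0) hR.aemeasurable,
    ← Set.Ioc_union_Ioi_eq_Ioi zero_le_one]
  refine (lintegral_union_le _ _ _).trans_lt (ENNReal.add_lt_top.mpr ⟨?_, ?_⟩)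
  · refine (setLIntegral_mono measurable_const fun x _ => prob_le_one).trans_lt ?_
    simp
  · have h1 : IntegrableOn (fun x : ℝ => C * x ^ (-α)) (Set.Ioi 1) :=
      (integrableOn_Ioi_rpow_of_lt (by linarith) one_pos).const_mul C
    refine lt_of_le_of_lt (setLIntegral_mono' measurableSet_Ioi fun x hx => ?_)
      h1.lintegral_lt_top
    rw [← ofReal_measureReal]
    exact ENNReal.ofReal_le_ofReal (hC x (one_pos.trans hx))

/-- Integration by parts against the tail: `E Ψ(yR/a) = ∫₀^∞ y Ψ'(yx) P(R > ax) dx`. -/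
lemma integral_centredExp_eq (hR : Measurable R) (hR0 : ∀ s, 0 ≤ R s) (hRi : Integrable R Q)
    {a : ℝ} (ha : 0 < a) (y : ℝ) :
    ∫ s, centredExp (y * (R s / a)) ∂Q = ∫ x in Set.Ioi (0 : ℝ),
      (Complex.I * y * (Complex.exp (Complex.I * y * x) - 1)) *
        (Q.real {s | a * x < R s} : ℂ) := by
  let g : ℝ → ℂ := fun x => Complex.I * y * (Complex.exp (Complex.I * y * x) - 1)
  have hg : Measurable g := by fun_prop
  have hgb : ∀ x, ‖g x‖ ≤ 2 * |y| := fun x => by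
    have h := (norm_exp_I_mul_sub_one_le (y * x)).trans (min_le_left _ _)
    push_cast at h
    rw [← mul_assoc] at h
    simp only [g, norm_mul, Complex.norm_I, Complex.norm_real, one_mul, Real.norm_eq_abs]
    rw [mul_comm]
    gcongr
  have hs : MeasurableSet {z : S × ℝ | a * z.2 < R z.1} :=
    measurableSet_lt (measurable_snd.const_mul a) (hR.comp measurable_fst)
  have hm : Measurable ({z : S × ℝ | a * z.2 < R z.1}.indicator fun z => g z.2) :=
    (hg.comp measurable_snd).indicator hs
  -- for fixed `s` the section is supported in `(0, R s / a)`
  have hsec : ∀ s, ∀ x, {z : S × ℝ | a * z.2 < R z.1}.indicator (fun z => g z.2) (s, x) =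
      (Set.Iio (R s / a)).indicator g x := fun s x => by
    classical
    simp only [Set.indicator_apply, Set.mem_ofPred_eq, Set.mem_Iio, lt_div_iff₀ ha, mul_comm x]
  have hsup : ∀ s, Set.Iio (R s / a) ∩ Set.Ioi 0 = Set.Ioo 0 (R s / a) := fun s => by
    ext x
    simp [and_comm]
  have hint : Integrable ({z : S × ℝ | a * z.2 < R z.1}.indicator fun z => g z.2)
      (Q.prod (volume.restrict (Set.Ioi 0))) := by
    refine ⟨hm.aestronglyMeasurable, ?_⟩
    rw [HasFiniteIntegral, lintegral_prod _ hm.enorm.aemeasurable]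
    have hle : ∀ s, ∫⁻ x in Set.Ioi (0 : ℝ),
        ‖{z : S × ℝ | a * z.2 < R z.1}.indicator (fun z => g z.2) (s, x)‖ₑ ≤
          ENNReal.ofReal (2 * |y|) * ENNReal.ofReal (R s / a) := fun s => by
      simp only [hsec, enorm_indicator_eq_indicator_enorm]
      rw [lintegral_indicator measurableSet_Iio, Measure.restrict_restrict measurableSet_Iio, hsup]
      have h2 : ∀ x, ‖g x‖ₑ ≤ ENNReal.ofReal (2 * |y|) := fun x => by
        rw [← ofReal_norm]
        exact ENNReal.ofReal_le_ofReal (hgb x)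
      refine (lintegral_mono h2).trans (le_of_eq ?_)
      rw [setLIntegral_const, Real.volume_Ioo, sub_zero]
    refine (lintegral_mono hle).trans_lt ?_
    rw [lintegral_const_mul _ (hR.div_const a).ennreal_ofReal]
    exact ENNReal.mul_lt_top ENNReal.ofReal_lt_top (hRi.div_const a).lintegral_lt_top
  have h1 : ∀ s, ∫ x in Set.Ioi (0 : ℝ),
      {z : S × ℝ | a * z.2 < R z.1}.indicator (fun z => g z.2) (s, x) =
        centredExp (y * (R s / a)) := fun s => by
    have hR' : 0 ≤ R s / a := div_nonneg (hR0 s) ha.le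
    simp only [hsec]
    rw [integral_indicator measurableSet_Iio, Measure.restrict_restrict measurableSet_Iio, hsup,
      ← integral_Ioc_eq_integral_Ioo, ← intervalIntegral.integral_of_le hR']
    have hd : ∀ x : ℝ, HasDerivAt (fun x : ℝ => centredExp (y * x)) (g x) x := fun x => by
      have h := (hasDerivAt_centredExp (y * x)).scomp x ((hasDerivAt_id x).const_mul y)
      convert! h using 1
      simp only [g, mul_one, Complex.real_smul]
      push_cast
      ring_nf
    have hgc : Continuous g := by fun_prop
    rw [intervalIntegral.integral_eq_sub_of_hasDerivAt (fun x _ => hd x)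
      (hgc.intervalIntegrable _ _), mul_zero, centredExp_zero, sub_zero]
  have h2 : ∀ x, ∫ s, {z : S × ℝ | a * z.2 < R z.1}.indicator (fun z => g z.2) (s, x) ∂Q =
      g x * (Q.real {s | a * x < R s} : ℂ) := fun x => by
    have e : ∀ s, {z : S × ℝ | a * z.2 < R z.1}.indicator (fun z => g z.2) (s, x) =
        {s | a * x < R s}.indicator (fun _ => g x) s := fun s => by
      classical
      simp only [Set.indicator_apply, Set.mem_ofPred_eq]
    simp_rw [e]
    rw [integral_indicator_const _ (measurableSet_lt measurable_const hR), Complex.real_smul,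
      mul_comm]
  have h3 := integral_integral_swap (f := fun s x =>
    {z : S × ℝ | a * z.2 < R z.1}.indicator (fun z => g z.2) (s, x)) hint
  simp only [h1, h2] at h3
  exact h3

/-- The truncated moments `a^α E[min(2, MR/a) R/a]` are bounded. -/
lemma exists_truncated_moment_le (hR : Measurable R) (hR0 : ∀ s, 0 ≤ R s) {M : ℝ} (hM : 0 ≤ M)
    (hα₁ : 1 < α) (hα₂ : α < 2) {C : ℝ}
    (hC : ∀ x, 0 < x → Q.real {s | x < R s} ≤ C * x ^ (-α)) :
    ∃ D : ℝ≥0∞, D < ∞ ∧ ∀ a : ℝ, 0 < a → ENNReal.ofReal (a ^ α) *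
      ∫⁻ s, ENNReal.ofReal (min 2 (M * (R s / a)) * (R s / a)) ∂Q ≤ D := by
  have hmin : ∀ x : ℝ, 0 ≤ x → 0 ≤ min 2 (M * x) := fun x hx => le_min zero_le_two (by positivity)
  refine ⟨∫⁻ x in Set.Ioi (0 : ℝ), ENNReal.ofReal (4 * C * (min 2 (M * x) * x ^ (-α))),
    ((integrableOn_min_mul_rpow hM hα₁ hα₂).const_mul (4 * C)).lintegral_lt_top, fun a ha => ?_⟩
  have hs : MeasurableSet {z : S × ℝ | a * z.2 < R z.1} :=
    measurableSet_lt (measurable_snd.const_mul a) (hR.comp measurable_fst)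
  have hmm : Measurable fun x : ℝ => ENNReal.ofReal (4 * min 2 (M * x)) :=
    ((measurable_const.min (measurable_id.const_mul M)).const_mul 4).ennreal_ofReal
  have hm : Measurable ({z : S × ℝ | a * z.2 < R z.1}.indicator
      fun z => ENNReal.ofReal (4 * min 2 (M * z.2))) :=
    (hmm.comp measurable_snd).indicator hs
  -- `y min(2, My) ≤ ∫₀^y 4 min(2, Mx) dx`, by restriction to `x > y / 2`
  have h1 : ∀ s, ENNReal.ofReal (min 2 (M * (R s / a)) * (R s / a)) ≤
      ∫⁻ x in Set.Ioi (0 : ℝ), {z : S × ℝ | a * z.2 < R z.1}.indicator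
        (fun z => ENNReal.ofReal (4 * min 2 (M * z.2))) (s, x) := fun s => by
    classical
    set y := R s / a with hy
    have hy0 : 0 ≤ y := div_nonneg (hR0 s) ha.le
    calc ENNReal.ofReal (min 2 (M * y) * y)
        = ∫⁻ _ in Set.Ioo (y / 2) y, ENNReal.ofReal (2 * min 2 (M * y)) := by
          rw [setLIntegral_const, Real.volume_Ioo, ← ENNReal.ofReal_mul (by
            have := hmin y hy0
            positivity)]
          congr 1
          ring
      _ ≤ ∫⁻ x in Set.Ioo (y / 2) y, {z : S × ℝ | a * z.2 < R z.1}.indicator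
            (fun z => ENNReal.ofReal (4 * min 2 (M * z.2))) (s, x) := by
          refine setLIntegral_mono' measurableSet_Ioo fun x hx => ?_
          have hlt : a * x < R s := by
            have := hx.2
            rw [hy, lt_div_iff₀ ha] at this
            linarith
          rw [Set.indicator_of_mem (by exact hlt)]
          refine ENNReal.ofReal_le_ofReal ?_
          have h5 : M * y ≤ 2 * (M * x) := by nlinarith [hx.1]
          rcases le_total 2 (M * x) with h6 | h6
          · rw [min_eq_left h6]
            linarith [min_le_left 2 (M * y)]
          · rw [min_eq_right h6]
            linarith [min_le_right 2 (M * y)]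
      _ ≤ _ := lintegral_mono_set fun x hx => (div_nonneg hy0 zero_le_two).trans_lt hx.1
  have h2 : ∀ x, ∫⁻ s, {z : S × ℝ | a * z.2 < R z.1}.indicator
      (fun z => ENNReal.ofReal (4 * min 2 (M * z.2))) (s, x) ∂Q =
        ENNReal.ofReal (4 * min 2 (M * x)) * Q {s | a * x < R s} := fun x => by
    classical
    rw [← lintegral_indicator_const (measurableSet_lt measurable_const hR)]
    refine lintegral_congr fun s => ?_
    simp only [Set.indicator_apply, Set.mem_ofPred_eq]
  calc ENNReal.ofReal (a ^ α) * ∫⁻ s, ENNReal.ofReal (min 2 (M * (R s / a)) * (R s / a)) ∂Q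
      ≤ ENNReal.ofReal (a ^ α) * ∫⁻ s, (∫⁻ x in Set.Ioi (0 : ℝ),
          {z : S × ℝ | a * z.2 < R z.1}.indicator
            (fun z => ENNReal.ofReal (4 * min 2 (M * z.2))) (s, x)) ∂Q := by
        gcongr with s
        exact h1 s
    _ = ∫⁻ x in Set.Ioi (0 : ℝ), ENNReal.ofReal (a ^ α) *
          (ENNReal.ofReal (4 * min 2 (M * x)) * Q {s | a * x < R s}) := by
        rw [lintegral_lintegral_swap (f := fun s x => {z : S × ℝ | a * z.2 < R z.1}.indicator
          (fun z => ENNReal.ofReal (4 * min 2 (M * z.2))) (s, x)) hm.aemeasurable,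
          lintegral_const_mul' _ _ ENNReal.ofReal_ne_top]
        simp only [h2]
    _ ≤ _ := by
        refine setLIntegral_mono' measurableSet_Ioi fun x hx => ?_
        have hx0 : (0 : ℝ) < x := hx
        have h4 := hmin x hx0.le
        rw [← ofReal_measureReal, ← ENNReal.ofReal_mul (by positivity),
          ← ENNReal.ofReal_mul (by positivity)]
        refine ENNReal.ofReal_le_ofReal ?_
        have h5 := mul_le_mul_of_nonneg_left (scaled_tail_le hC ha hx0)
          (mul_nonneg zero_le_four h4)
        linarith

end Tail

/-! ### Continuity of translation in `L¹` -/

section Translation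

variable {ν : ℕ}

/-- The `L¹` distance between `f` and its translate by `h`. -/
noncomputable def translationModulus (f : Eucl ν → ℝ) (h : Eucl ν) : ℝ≥0∞ :=
  ∫⁻ s, ‖f (s + h) - f s‖ₑ

variable {f g : Eucl ν → ℝ}

lemma translationModulus_le (hf : Integrable f) (h : Eucl ν) :
    translationModulus f h ≤ 2 * ∫⁻ s, ‖f s‖ₑ := by
  unfold translationModulus
  refine (lintegral_mono fun s => enorm_sub_le).trans ?_
  rw [lintegral_add_right' _ hf.1.enorm, lintegral_add_right_eq_self (fun s => ‖f s‖ₑ) h, two_mul]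

lemma translationModulus_le_add (hf : Integrable f) (hg : Integrable g) (h : Eucl ν) :
    translationModulus f h ≤ translationModulus g h + 2 * ∫⁻ s, ‖f s - g s‖ₑ := by
  have h1 := translationModulus_le (integrable_fun_sub hf hg) h
  have hgm : AEMeasurable (fun s => ‖g (s + h) - g s‖ₑ) :=
    ((hg.comp_add_right h).1.sub hg.1).enorm
  refine le_trans ?_ (add_le_add_right h1 (translationModulus g h))
  unfold translationModulus
  rw [← lintegral_add_left' hgm]
  refine lintegral_mono fun s => ?_
  calc ‖f (s + h) - f s‖ₑ = ‖(g (s + h) - g s) + (f (s + h) - g (s + h) - (f s - g s))‖ₑ := by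
        congr 1
        ring
    _ ≤ _ := enorm_add_le _ _

lemma tendsto_translationModulus_of_hasCompactSupport (hg : Continuous g)
    (hc : HasCompactSupport g) : Tendsto (translationModulus g) (𝓝 0) (𝓝 0) := by
  obtain ⟨C, hC⟩ := hg.bounded_above_of_compact_support hc
  obtain ⟨r, hr⟩ := hc.isCompact.isBounded.subset_closedBall (0 : Eucl ν)
  have hzero : ∀ s : Eucl ν, r < ‖s‖ → g s = 0 := fun s hs =>
    image_eq_zero_of_notMem_tsupport fun h => by
      have := hr h
      rw [mem_closedBall_zero_iff] at this
      linarith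
  have key := tendsto_lintegral_filter_of_dominated_convergence (μ := volume) (l := 𝓝 (0 : Eucl ν))
    (F := fun h s => ‖g (s + h) - g s‖ₑ) (f := fun _ => 0)
    ((Metric.closedBall (0 : Eucl ν) (r + 1)).indicator fun _ => ENNReal.ofReal (C + C))
    (Eventually.of_forall fun h => by fun_prop) ?_ ?_ ?_
  · rw [lintegral_zero] at key
    exact key
  · filter_upwards [Metric.closedBall_mem_nhds (0 : Eucl ν) one_pos] with h hh
    refine ae_of_all _ fun s => ?_
    rw [mem_closedBall_zero_iff] at hh
    by_cases hs : s ∈ Metric.closedBall (0 : Eucl ν) (r + 1)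
    · rw [Set.indicator_of_mem hs, ← ofReal_norm]
      exact ENNReal.ofReal_le_ofReal ((norm_sub_le _ _).trans (add_le_add (hC _) (hC _)))
    · rw [mem_closedBall_zero_iff, not_le] at hs
      have h1 : ‖s‖ ≤ ‖s + h‖ + ‖h‖ := by
        have := norm_sub_le (s + h) h
        rwa [add_sub_cancel_right] at this
      rw [hzero s (by linarith), hzero (s + h) (by linarith)]
      simp
  · rw [lintegral_indicator measurableSet_closedBall, setLIntegral_const]
    exact ENNReal.mul_ne_top ENNReal.ofReal_ne_top measure_closedBall_lt_top.ne
  · refine ae_of_all _ fun s => ?_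
    have h1 : Continuous fun h : Eucl ν => ‖g (s + h) - g s‖ₑ := by fun_prop
    simpa using h1.tendsto 0

lemma tendsto_translationModulus (hf : Integrable f) :
    Tendsto (translationModulus f) (𝓝 0) (𝓝 0) := by
  rw [ENNReal.tendsto_nhds_zero]
  intro ε hε
  have hε3 : ε / 4 ≠ 0 := (ENNReal.div_pos hε.ne' (by norm_num)).ne'
  obtain ⟨g, hc, hle, hg, hgi⟩ := hf.exists_hasCompactSupport_lintegral_sub_le hε3
  have h2 := (ENNReal.tendsto_nhds_zero.mp (tendsto_translationModulus_of_hasCompactSupport hg hc))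
    (ε / 2) (ENNReal.div_pos hε.ne' (by norm_num))
  filter_upwards [h2] with h hh
  refine (translationModulus_le_add hf hgi h).trans ((add_le_add hh (mul_le_mul_right hle 2)).trans ?_)
  have e : 2 * (ε / 4) = ε / 2 := by
    rw [show (4 : ℝ≥0∞) = 2 * 2 by norm_num, ← mul_div_assoc,
      ENNReal.mul_div_mul_left _ _ (by norm_num) (by norm_num)]
  rw [e, ENNReal.add_halves]

end Translation

/-! ### The grain field as a Poisson shot noise -/

section GrainIntegral

variable {ν : ℕ} {f : Eucl ν → ℝ}

/-- The integral of `f` over the translated grain `x + F`. -/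
noncomputable def grainIntegral (f : Eucl ν → ℝ) (z : Eucl ν × Closeds (Eucl ν)) : ℝ :=
  ∫ y in (z.2 : Set (Eucl ν)), f (z.1 + y)

lemma measurableSet_grain : MeasurableSet
    {w : (Eucl ν × Closeds (Eucl ν)) × Eucl ν | w.2 ∈ w.1.2} :=
  (measurable_snd.prodMk (measurable_snd.comp measurable_fst)) measurableSet_setOf_mem

lemma measurable_grainIntegral (hf : Measurable f) : Measurable (grainIntegral f) := by
  have hm : Measurable ({w : (Eucl ν × Closeds (Eucl ν)) × Eucl ν | w.2 ∈ w.1.2}.indicator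
      fun w => f (w.1.1 + w.2)) :=
    (hf.comp (by fun_prop)).indicator measurableSet_grain
  have h := hm.stronglyMeasurable.integral_prod_right' (ν := (volume : Measure (Eucl ν)))
  have e : grainIntegral f = fun z => ∫ y, {w : (Eucl ν × Closeds (Eucl ν)) × Eucl ν |
      w.2 ∈ w.1.2}.indicator (fun w => f (w.1.1 + w.2)) (z, y) := by
    funext z
    rw [grainIntegral, ← integral_indicator z.2.isClosed.measurableSet]
    rfl
  rw [e]
  exact h.measurable

lemma measurable_lintegral_grain {h : Eucl ν × Eucl ν → ℝ≥0∞} (hh : Measurable h) :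
    Measurable fun z : Eucl ν × Closeds (Eucl ν) => ∫⁻ y in (z.2 : Set (Eucl ν)), h (z.1, y) := by
  have hm : Measurable ({w : (Eucl ν × Closeds (Eucl ν)) × Eucl ν | w.2 ∈ w.1.2}.indicator
      fun w => h (w.1.1, w.2)) :=
    (hh.comp (by fun_prop)).indicator measurableSet_grain
  have e : (fun z : Eucl ν × Closeds (Eucl ν) => ∫⁻ y in (z.2 : Set (Eucl ν)), h (z.1, y)) =
      fun z => ∫⁻ y, {w : (Eucl ν × Closeds (Eucl ν)) × Eucl ν |
        w.2 ∈ w.1.2}.indicator (fun w => h (w.1.1, w.2)) (z, y) := by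
    funext z
    rw [← lintegral_indicator z.2.isClosed.measurableSet]
    rfl
  rw [e]
  exact hm.lintegral_prod_right' (ν := (volume : Measure (Eucl ν)))

variable (Q : Measure (Closeds (Eucl ν))) [SFinite Q]

lemma lintegral_grain_prod {h : Eucl ν × Eucl ν → ℝ≥0∞} (hh : Measurable h) :
    ∫⁻ z : Eucl ν × Closeds (Eucl ν), (∫⁻ y in (z.2 : Set (Eucl ν)), h (z.1, y))
      ∂(volume.prod Q) =
      ∫⁻ F : Closeds (Eucl ν), (∫⁻ y in (F : Set (Eucl ν)), ∫⁻ x, h (x, y)) ∂Q := by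
  rw [lintegral_prod_symm _ (measurable_lintegral_grain hh).aemeasurable]
  refine lintegral_congr fun F => ?_
  exact lintegral_lintegral_swap (μ := volume) (ν := volume.restrict (F : Set (Eucl ν)))
    (f := fun x y => h (x, y)) hh.aemeasurable

lemma lintegral_grain_norm (hf : Measurable f) :
    ∫⁻ z : Eucl ν × Closeds (Eucl ν), (∫⁻ y in (z.2 : Set (Eucl ν)), ‖f (z.1 + y)‖ₑ)
      ∂(volume.prod Q) = (∫⁻ x, ‖f x‖ₑ) * meanVolume Q := by
  rw [lintegral_grain_prod Q (h := fun p => ‖f (p.1 + p.2)‖ₑ) (by fun_prop), meanVolume,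
    ← lintegral_const_mul _ measurable_volume_closeds]
  refine lintegral_congr fun F => ?_
  simp only [lintegral_add_right_eq_self fun x => ‖f x‖ₑ]
  rw [setLIntegral_const]

variable {Q} in
lemma integrable_grainIntegral (hμ : meanVolume Q < ∞) (hf : Measurable f) (hfi : Integrable f) :
    Integrable (grainIntegral f) (volume.prod Q) := by
  refine ⟨(measurable_grainIntegral hf).aestronglyMeasurable, ?_⟩
  refine lt_of_le_of_lt (lintegral_mono fun z => enorm_integral_le_lintegral_enorm _) ?_
  rw [lintegral_grain_norm Q hf]
  exact ENNReal.mul_lt_top hfi.2 hμ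

end GrainIntegral

section Model

variable {Ω : Type*} {ν : ℕ} [MeasurableSpace Ω] {P : Measure Ω} [IsProbabilityMeasure P]
  {u : ℕ → Ω → Eucl ν} {Ξs : ℕ → Ω → Closeds (Eucl ν)} {Ξ : Ω → Closeds (Eucl ν)}

namespace IsBooleanModel

variable (hM : IsBooleanModel P u Ξs Ξ) (hμ : meanVolume (P.map Ξ) < ∞)
include hM hμ

/-- The integral of `f` against the field is the sum over the grains of the integrals of `f`. -/
lemma ae_integral_mul_grainField_eq {f : Eucl ν → ℝ} (hf : Measurable f) (hfi : Integrable f) :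
    ∀ᵐ ω ∂P, ∫ t, f t * (grainField u Ξs ω t).toReal =
      ∑' j, grainIntegral f (u j ω, Ξs j ω) := by
  classical
  have := hM.marked.isProbabilityMeasure_mark
  have hN : Measurable fun z : Eucl ν × Closeds (Eucl ν) =>
      ∫⁻ y in (z.2 : Set (Eucl ν)), ‖f (z.1 + y)‖ₑ :=
    measurable_lintegral_grain (h := fun p => ‖f (p.1 + p.2)‖ₑ) (by fun_prop)
  have hlt := ae_lt_top (Measurable.tsum fun j => hN.comp (hM.marked.measurable_pair j)) (by
    refine (lt_of_eq_of_lt (hM.marked.lintegral_tsum_eq hN) ?_).ne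
    rw [lintegral_grain_norm _ hf]
    exact ENNReal.mul_lt_top hfi.2 hμ)
  filter_upwards [hlt] with ω hω
  have e1 : ∀ j t, f (u j ω + t) * (hitSet (u j ω + t)).indicator (fun _ => (1 : ℝ))
      (u j ω, Ξs j ω) = (Ξs j ω : Set (Eucl ν)).indicator (fun t => f (u j ω + t)) t := by
    intro j t
    simp only [Set.indicator_apply, hitSet, Set.mem_ofPred_eq, add_sub_cancel_left, mul_ite,
      mul_one, mul_zero]
    rfl
  have e2 : ∀ j, ∫ t, f t * (hitSet t).indicator (fun _ => (1 : ℝ)) (u j ω, Ξs j ω) =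
      grainIntegral f (u j ω, Ξs j ω) := fun j => by
    rw [grainIntegral, ← integral_indicator (Ξs j ω).isClosed.measurableSet,
      ← integral_add_left_eq_self _ (u j ω)]
    simp only [e1]
  have e3 : ∀ j, ∫⁻ t, ‖f t * (hitSet t).indicator (fun _ => (1 : ℝ)) (u j ω, Ξs j ω)‖ₑ =
      ∫⁻ y in (Ξs j ω : Set (Eucl ν)), ‖f (u j ω + y)‖ₑ := fun j => by
    rw [← lintegral_indicator (Ξs j ω).isClosed.measurableSet,
      ← lintegral_add_left_eq_self _ (u j ω)]
    simp only [e1, enorm_indicator_eq_indicator_enorm]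
  have hmeas : ∀ j, AEStronglyMeasurable
      (fun t => f t * (hitSet t).indicator (fun _ => (1 : ℝ)) (u j ω, Ξs j ω)) volume := fun j => by
    have hs : MeasurableSet {t : Eucl ν | t - u j ω ∈ Ξs j ω} :=
      (measurable_id.sub_const (u j ω)) (Ξs j ω).isClosed.measurableSet
    exact (hf.mul (measurable_const.indicator hs (f := fun _ => (1 : ℝ)))).aestronglyMeasurable
  simp only [toReal_grainField, IsMarkedPoisson.count, ← tsum_mul_left]
  rw [integral_tsum hmeas (by simpa only [e3, Function.comp_apply] using hω.ne)]
  simp only [e2]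

/-- The characteristic functional of the centred field. -/
lemma integral_exp_mul_grainField {f : Eucl ν → ℝ} (hf : Measurable f) (hfi : Integrable f) :
    ∫ ω, Complex.exp (((∫ t, f t * (grainField u Ξs ω t).toReal) -
      ∫ ω', (∫ t, f t * (grainField u Ξs ω' t).toReal) ∂P : ℝ) * Complex.I) ∂P =
      Complex.exp (∫ z, centredExp (grainIntegral f z) ∂(volume.prod (P.map Ξ))) := by
  have := hM.marked.isProbabilityMeasure_mark
  have hg := measurable_grainIntegral hf
  have hgi := integrable_grainIntegral hμ hf hfi
  have hae := hM.ae_integral_mul_grainField_eq hμ hf hfi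
  have hmean : ∫ ω', (∫ t, f t * (grainField u Ξs ω' t).toReal) ∂P =
      ∫ z, grainIntegral f z ∂(volume.prod (P.map Ξ)) := by
    rw [integral_congr_ae hae]
    exact (hM.marked.integral_tsum_eq hg hgi).2
  set E := ∫ z, grainIntegral f z ∂(volume.prod (P.map Ξ)) with hE
  have hexp : Integrable (fun z => Complex.exp (grainIntegral f z * Complex.I) - 1)
      (volume.prod (P.map Ξ)) := by
    have hm : Measurable fun z => Complex.exp (grainIntegral f z * Complex.I) - 1 := by fun_prop
    refine hgi.norm.mono' hm.aestronglyMeasurable (ae_of_all _ fun z => ?_)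
    have := (norm_exp_I_mul_sub_one_le (grainIntegral f z)).trans (min_le_right _ _)
    rwa [mul_comm] at this
  rw [hmean]
  calc ∫ ω, Complex.exp (((∫ t, f t * (grainField u Ξs ω t).toReal) - E : ℝ) * Complex.I) ∂P
      = ∫ ω, Complex.exp ((∑' j, grainIntegral f (u j ω, Ξs j ω) : ℝ) * Complex.I) *
          Complex.exp (-(E * Complex.I)) ∂P := by
        refine integral_congr_ae ?_
        filter_upwards [hae] with ω hω
        rw [hω, ← Complex.exp_add, Complex.ofReal_sub]
        ring_nf
    _ = Complex.exp ((∫ z, (Complex.exp (grainIntegral f z * Complex.I) - 1)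
          ∂(volume.prod (P.map Ξ))) - E * Complex.I) := by
        rw [integral_mul_const, hM.marked.integral_exp_tsum hg hgi, ← Complex.exp_add,
          ← sub_eq_add_neg]
    _ = _ := by
        congr 1
        have h1 : (E : ℂ) * Complex.I =
            ∫ z, (grainIntegral f z : ℂ) * Complex.I ∂(volume.prod (P.map Ξ)) := by
          rw [integral_mul_const, integral_complex_ofReal]
        have hc : Integrable (fun z => (grainIntegral f z : ℂ) * Complex.I)
            (volume.prod (P.map Ξ)) := hgi.ofReal.mul_const _
        rw [h1, ← integral_sub hexp hc]
        simp only [centredExp, mul_comm Complex.I]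

end IsBooleanModel

end Model

/-! ### The limit of the characteristic functions -/

section Limit

variable {T S : Type*} [MeasurableSpace T] [MeasurableSpace S] {Λ : Measure T} [SFinite Λ]
  {Q : Measure S} [IsProbabilityMeasure Q] {R : S → ℝ} {ψ : T → ℝ} {α c B : ℝ}

/-- The limit in the idealized model where every grain contributes `ψ(s)` times its volume. -/
lemma tendsto_integral_centredExp_mul (hR : Measurable R) (hR0 : ∀ s, 0 ≤ R s)
    (hα₁ : 1 < α) (hα₂ : α < 2) (hc : 0 < c)
    (htail : (fun x : ℝ => Q.real {s | x < R s}) ~[atTop] fun x : ℝ => c * x ^ (-α))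
    (hψ : Measurable ψ) (hB : ∀ s, |ψ s| ≤ B) (hi : Integrable ψ Λ) :
    Tendsto (fun a : ℝ => ((a ^ α : ℝ) : ℂ) *
      ∫ z : T × S, centredExp (ψ z.1 * (R z.2 / a)) ∂(Λ.prod Q)) atTop
      (𝓝 (Complex.I * c * ∫ s, (ψ s : ℂ) * stableKernel α (ψ s) ∂Λ)) := by
  rcases isEmpty_or_nonempty T with hT | ⟨⟨s₀⟩⟩
  · have h1 : Λ = 0 := Measure.eq_zero_of_isEmpty Λ
    simp [h1]
  have hB0 : 0 ≤ B := (abs_nonneg _).trans (hB s₀)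
  obtain ⟨C, hC0, hC⟩ := exists_tail_le (by linarith) htail
  have hRi := integrable_of_tail hR hR0 hα₁ hC
  let K : T × ℝ → ℂ := fun w =>
    Complex.I * ψ w.1 * (Complex.exp (Complex.I * ψ w.1 * w.2) - 1)
  have hK : Measurable K := by fun_prop
  let μ : Measure (T × ℝ) := Λ.prod (volume.restrict (Set.Ioi 0))
  have hpos : ∀ᵐ w ∂μ, 0 < w.2 :=
    Measure.quasiMeasurePreserving_snd.ae (ae_restrict_mem measurableSet_Ioi)
  have hKle : ∀ w : T × ℝ, 0 < w.2 → ‖K w‖ ≤ |ψ w.1| * min 2 (B * w.2) := fun w hw => by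
    have h := norm_exp_I_mul_sub_one_le (ψ w.1 * w.2)
    push_cast at h
    rw [← mul_assoc] at h
    simp only [K, norm_mul, Complex.norm_I, Complex.norm_real, one_mul, Real.norm_eq_abs]
    refine mul_le_mul_of_nonneg_left (h.trans (min_le_min_left _ ?_)) (abs_nonneg _)
    rw [abs_mul, abs_of_pos hw]
    exact mul_le_mul_of_nonneg_right (hB _) hw.le
  have hbound : Integrable (fun w : T × ℝ => |ψ w.1| * (C * (min 2 (B * w.2) * w.2 ^ (-α)))) μ :=
    hi.abs.mul_prod ((integrableOn_min_mul_rpow hB0 hα₁ hα₂).const_mul C)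
  have hle : ∀ a : ℝ, 0 < a → ∀ w : T × ℝ, 0 < w.2 →
      ‖K w * ((a ^ α * Q.real {s | a * w.2 < R s} : ℝ) : ℂ)‖ ≤
        |ψ w.1| * (C * (min 2 (B * w.2) * w.2 ^ (-α))) := fun a ha w hw => by
    rw [norm_mul, Complex.norm_real, Real.norm_of_nonneg (by positivity)]
    have h1 := hKle w hw
    have h2 := scaled_tail_le hC ha hw
    calc _ ≤ (|ψ w.1| * min 2 (B * w.2)) * (C * w.2 ^ (-α)) := by
          gcongr
      _ = _ := by ring
  have hm : ∀ a : ℝ, AEStronglyMeasurable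
      (fun w : T × ℝ => K w * ((a ^ α * Q.real {s | a * w.2 < R s} : ℝ) : ℂ)) μ := fun a => by
    have h1 : Measurable fun w : T × ℝ => a ^ α * Q.real {s | a * w.2 < R s} :=
      ((measurable_tail Q R).comp (measurable_snd.const_mul a)).const_mul _
    exact (hK.mul (Complex.measurable_ofReal.comp h1)).aestronglyMeasurable
  have hint : ∀ a : ℝ, 0 < a → Integrable
      (fun w : T × ℝ => K w * ((a ^ α * Q.real {s | a * w.2 < R s} : ℝ) : ℂ)) μ := fun a ha =>
    hbound.mono' (hm a) (hpos.mono fun w hw => hle a ha w hw)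
  have hlim := tendsto_integral_filter_of_dominated_convergence (μ := μ) (l := atTop)
    (F := fun (a : ℝ) (w : T × ℝ) => K w * ((a ^ α * Q.real {s | a * w.2 < R s} : ℝ) : ℂ))
    (f := fun w => K w * ((c * w.2 ^ (-α) : ℝ) : ℂ))
    (fun w : T × ℝ => |ψ w.1| * (C * (min 2 (B * w.2) * w.2 ^ (-α))))
    (Eventually.of_forall hm)
    (by
      filter_upwards [eventually_gt_atTop 0] with a ha
      exact hpos.mono fun w hw => hle a ha w hw) hbound
    (hpos.mono fun w hw =>
      ((Complex.continuous_ofReal.tendsto _).comp (tendsto_scaled_tail hc htail hw)).const_mul _)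
  have hlimi : Integrable (fun w : T × ℝ => K w * ((c * w.2 ^ (-α) : ℝ) : ℂ)) μ := by
    have hcm : Measurable fun w : T × ℝ => c * w.2 ^ (-α) :=
      (measurable_snd.pow_const _).const_mul c
    refine (hi.abs.mul_prod ((integrableOn_min_mul_rpow hB0 hα₁ hα₂).const_mul c)).mono'
      (hK.mul (Complex.measurable_ofReal.comp hcm)).aestronglyMeasurable
      (hpos.mono fun w hw => ?_)
    rw [norm_mul, Complex.norm_real, Real.norm_of_nonneg (by positivity)]
    have h1 := hKle w hw
    calc _ ≤ (|ψ w.1| * min 2 (B * w.2)) * (c * w.2 ^ (-α)) := by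
          gcongr
      _ = _ := by ring
  have e1 : ∫ w, K w * ((c * w.2 ^ (-α) : ℝ) : ℂ) ∂μ =
      Complex.I * c * ∫ s, (ψ s : ℂ) * stableKernel α (ψ s) ∂Λ := by
    rw [integral_prod _ hlimi, ← integral_const_mul]
    refine integral_congr_ae (ae_of_all _ fun s => ?_)
    simp only [stableKernel]
    rw [← integral_const_mul, ← integral_const_mul]
    refine integral_congr_ae (ae_of_all _ fun x => ?_)
    simp only [K]
    push_cast
    ring
  rw [← e1]
  refine hlim.congr' ?_
  filter_upwards [eventually_gt_atTop 0] with a ha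
  have hci : Integrable (fun z : T × S => centredExp (ψ z.1 * (R z.2 / a))) (Λ.prod Q) := by
    have hm1 : Measurable fun z : T × S => ψ z.1 * (R z.2 / a) := by fun_prop
    refine ((hi.mul_prod (hRi.div_const a)).norm.const_mul 2).mono'
      (continuous_centredExp.measurable.comp hm1).aestronglyMeasurable (ae_of_all _ fun z => ?_)
    exact norm_centredExp_le _
  rw [integral_prod _ (hint a ha), integral_prod _ hci, ← integral_const_mul]
  refine integral_congr_ae (ae_of_all _ fun s => ?_)
  simp only
  rw [integral_centredExp_eq hR hR0 hRi ha, ← integral_const_mul]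
  refine integral_congr_ae (ae_of_all _ fun x => ?_)
  simp only [K]
  push_cast
  ring

end Limit

section Smear

variable {ν : ℕ} {ψ : Eucl ν → ℝ} {α c B r : ℝ}

/-- The integral of `ψ` over the grain `s + r⁻¹ F`, multiplied by `r ^ ν`. -/
noncomputable def smear (ψ : Eucl ν → ℝ) (r : ℝ) (z : Eucl ν × Closeds (Eucl ν)) : ℝ :=
  ∫ y in (z.2 : Set (Eucl ν)), ψ (z.1 + r⁻¹ • y)

lemma grainIntegral_smul_eq_smear (hr : r ≠ 0) (z : Eucl ν × Closeds (Eucl ν)) :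
    grainIntegral (fun t => ψ (r⁻¹ • t)) (r • z.1, z.2) = smear ψ r z := by
  simp only [grainIntegral, smear, smul_add, inv_smul_smul₀ hr]

lemma measurable_smear (hψ : Measurable ψ) (hr : r ≠ 0) : Measurable (smear ψ r) := by
  have h1 : Measurable fun t => ψ (r⁻¹ • t) := by fun_prop
  have h2 : Measurable fun z : Eucl ν × Closeds (Eucl ν) => (r • z.1, z.2) := by fun_prop
  have h3 := (measurable_grainIntegral h1).comp h2
  have e : smear ψ r = grainIntegral (fun t => ψ (r⁻¹ • t)) ∘ fun z => (r • z.1, z.2) :=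
    funext fun z => (grainIntegral_smul_eq_smear hr z).symm
  rwa [e]

lemma abs_smear_le (hB : ∀ s, |ψ s| ≤ B) (z : Eucl ν × Closeds (Eucl ν))
    (hz : volume (z.2 : Set (Eucl ν)) < ∞) :
    |smear ψ r z| ≤ B * (volume (z.2 : Set (Eucl ν))).toReal :=
  norm_setIntegral_le_of_norm_le_const (f := fun y => ψ (z.1 + r⁻¹ • y)) hz fun _ _ => hB _

/-- For a fixed grain, replacing `ψ (s + r⁻¹ • y)` by `ψ s` costs a translation modulus. -/
lemma lintegral_enorm_smear_sub_le (hψ : Measurable ψ) (hB : ∀ s, |ψ s| ≤ B)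
    (F : Closeds (Eucl ν)) (hF : volume (F : Set (Eucl ν)) < ∞) :
    ∫⁻ s, ‖smear ψ r (s, F) - ψ s * (volume (F : Set (Eucl ν))).toReal‖ₑ ≤
      ∫⁻ y in (F : Set (Eucl ν)), translationModulus ψ (r⁻¹ • y) := by
  have h1 : ∀ s, smear ψ r (s, F) - ψ s * (volume (F : Set (Eucl ν))).toReal =
      ∫ y in (F : Set (Eucl ν)), (ψ (s + r⁻¹ • y) - ψ s) := fun s => by
    have hi : IntegrableOn (fun y => ψ (s + r⁻¹ • y)) (F : Set (Eucl ν)) :=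
      Measure.integrableOn_of_bounded hF.ne 
        (by fun_prop : Measurable fun y => ψ (s + r⁻¹ • y)).aestronglyMeasurable
        (ae_of_all _ fun y => hB _)
    rw [integral_sub hi (integrableOn_const hF.ne), setIntegral_const, smear, smul_eq_mul,
      mul_comm (ψ s)]
    rfl
  calc _ ≤ ∫⁻ s, (∫⁻ y in (F : Set (Eucl ν)), ‖ψ (s + r⁻¹ • y) - ψ s‖ₑ) := by
        refine lintegral_mono fun s => ?_
        rw [h1]
        exact enorm_integral_le_lintegral_enorm _
    _ = _ := lintegral_lintegral_swap (μ := volume) (ν := volume.restrict (F : Set (Eucl ν)))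
        (f := fun s y => ‖ψ (s + r⁻¹ • y) - ψ s‖ₑ) (by fun_prop)

/-- The part of the grain within `ε * r` of the germ sees only small translations, and the rest
is counted by its volume. -/
lemma lintegral_translationModulus_le (hi : Integrable ψ) (hr : 0 < r) {ε : ℝ} {δ : ℝ≥0∞}
    (hδ : ∀ h : Eucl ν, ‖h‖ ≤ ε → translationModulus ψ h ≤ δ) (F : Closeds (Eucl ν)) :
    ∫⁻ y in (F : Set (Eucl ν)), translationModulus ψ (r⁻¹ • y) ≤
      δ * volume (F : Set (Eucl ν)) +
        2 * (∫⁻ s, ‖ψ s‖ₑ) * volume ((F : Set (Eucl ν)) ∩ {t | ε * r < ‖t‖}) := by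
  have hs : MeasurableSet {t : Eucl ν | ε * r < ‖t‖} :=
    measurableSet_lt measurable_const measurable_norm
  have h1 : ∀ y : Eucl ν, translationModulus ψ (r⁻¹ • y) ≤ δ +
      {t : Eucl ν | ε * r < ‖t‖}.indicator (fun _ => 2 * ∫⁻ s, ‖ψ s‖ₑ) y := fun y => by
    by_cases hy : ε * r < ‖y‖
    · rw [Set.indicator_of_mem (by exact hy)]
      exact (translationModulus_le hi _).trans le_add_self
    · refine (hδ _ ?_).trans le_self_add
      rw [norm_smul, norm_inv, Real.norm_of_nonneg hr.le, inv_mul_le_iff₀ hr, mul_comm]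
      exact not_lt.mp hy
  refine (lintegral_mono h1).trans (le_of_eq ?_)
  rw [lintegral_add_left measurable_const, setLIntegral_const, lintegral_indicator hs,
    setLIntegral_const, Measure.restrict_apply hs, Set.inter_comm]

variable {Q : Measure (Closeds (Eucl ν))} [IsProbabilityMeasure Q]

/-- The total error made when the grains are concentrated at their germs. -/
lemma lintegral_enorm_centredExp_smear_sub_le (hμ : meanVolume Q < ∞) (hψ : Measurable ψ)
    (hB : ∀ s, |ψ s| ≤ B) (hi : Integrable ψ) (hr : 0 < r) {ε a : ℝ} (ha : 0 < a) {δ : ℝ≥0∞}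
    (hδ : ∀ h : Eucl ν, ‖h‖ ≤ ε → translationModulus ψ h ≤ δ) :
    ∫⁻ z, ‖centredExp (a⁻¹ * smear ψ r z) -
        centredExp (ψ z.1 * ((volume (z.2 : Set (Eucl ν))).toReal / a))‖ₑ ∂(volume.prod Q) ≤
      δ * (∫⁻ F : Closeds (Eucl ν), ENNReal.ofReal
        (min 2 (B * ((volume (F : Set (Eucl ν))).toReal / a)) *
          ((volume (F : Set (Eucl ν))).toReal / a)) ∂Q) +
      4 * (∫⁻ s, ‖ψ s‖ₑ) * (ENNReal.ofReal a⁻¹ * farVolume Q (ε * r)) := by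
  have hB0 : 0 ≤ B := (abs_nonneg _).trans (hB 0)
  have hRm : Measurable fun F : Closeds (Eucl ν) => (volume (F : Set (Eucl ν))).toReal :=
    measurable_volume_closeds.ennreal_toReal
  have hsm := measurable_smear hψ hr.ne'
  have hRz : Measurable fun z : Eucl ν × Closeds (Eucl ν) =>
      (volume (z.2 : Set (Eucl ν))).toReal := hRm.comp measurable_snd
  have hmeas : Measurable fun z : Eucl ν × Closeds (Eucl ν) => ‖centredExp (a⁻¹ * smear ψ r z) -
      centredExp (ψ z.1 * ((volume (z.2 : Set (Eucl ν))).toReal / a))‖ₑ := by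
    have h1 : Measurable fun z => centredExp (a⁻¹ * smear ψ r z) :=
      continuous_centredExp.measurable.comp (hsm.const_mul _)
    have h2 : Measurable fun z : Eucl ν × Closeds (Eucl ν) =>
        centredExp (ψ z.1 * ((volume (z.2 : Set (Eucl ν))).toReal / a)) :=
      continuous_centredExp.measurable.comp ((hψ.comp measurable_fst).mul (hRz.div_const a))
    exact (h1.sub h2).enorm
  have hfin : ∀ᵐ F : Closeds (Eucl ν) ∂Q, volume (F : Set (Eucl ν)) < ∞ :=
    ae_lt_top measurable_volume_closeds hμ.ne
  have hfarm : Measurable fun F : Closeds (Eucl ν) =>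
      volume ((F : Set (Eucl ν)) ∩ {t | ε * r < ‖t‖}) :=
    measurable_measure_inter volume (measurableSet_lt measurable_const measurable_norm)
  rw [lintegral_prod_symm _ hmeas.aemeasurable, farVolume, ← lintegral_const_mul _ hfarm,
    ← lintegral_const_mul _ (hfarm.const_mul _), ← lintegral_const_mul, ← lintegral_add_right]
  · refine lintegral_mono_ae (hfin.mono fun F hF => ?_)
    set V := (volume (F : Set (Eucl ν))).toReal with hV
    have hV0 : 0 ≤ V := ENNReal.toReal_nonneg
    have hmin0 : 0 ≤ min 2 (B * (V / a)) := le_min zero_le_two (by positivity)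
    have h1 : ∀ s, ‖centredExp (a⁻¹ * smear ψ r (s, F)) - centredExp (ψ s * (V / a))‖ₑ ≤
        ENNReal.ofReal (min 2 (B * (V / a)) * a⁻¹) * ‖smear ψ r (s, F) - ψ s * V‖ₑ := fun s => by
      have h2 : |a⁻¹ * smear ψ r (s, F)| ≤ B * (V / a) := by
        rw [abs_mul, abs_of_pos (inv_pos.mpr ha), inv_mul_eq_div, ← mul_div_assoc]
        exact div_le_div_of_nonneg_right (abs_smear_le hB (s, F) hF) ha.le
      have h3 : |ψ s * (V / a)| ≤ B * (V / a) := by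
        rw [abs_mul, abs_of_nonneg (div_nonneg hV0 ha.le)]
        exact mul_le_mul_of_nonneg_right (hB s) (div_nonneg hV0 ha.le)
      have h4 := norm_centredExp_sub_le h2 h3
      have h5 : |a⁻¹ * smear ψ r (s, F) - ψ s * (V / a)| = a⁻¹ * |smear ψ r (s, F) - ψ s * V| := by
        rw [← abs_of_pos (inv_pos.mpr ha), ← abs_mul, abs_of_pos (inv_pos.mpr ha)]
        congr 1
        ring
      rw [h5, ← mul_assoc] at h4
      rw [← ofReal_norm, Real.enorm_eq_ofReal_abs, ← ENNReal.ofReal_mul (by positivity)]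
      exact ENNReal.ofReal_le_ofReal h4
    have hms : Measurable fun s => ‖smear ψ r (s, F) - ψ s * V‖ₑ :=
      ((hsm.comp measurable_prodMk_right).sub (hψ.mul_const V)).enorm
    refine (lintegral_mono h1).trans ?_
    rw [lintegral_const_mul _ hms]
    refine (mul_le_mul_right ((lintegral_enorm_smear_sub_le hψ hB F hF).trans
      (lintegral_translationModulus_le hi hr hδ F)) _).trans ?_
    rw [mul_add]
    refine add_le_add (le_of_eq ?_) ?_
    · rw [← ENNReal.ofReal_toReal hF.ne, ← hV, mul_left_comm,
        ← ENNReal.ofReal_mul (by positivity)]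
      congr 2
      ring
    · have h6 : ENNReal.ofReal (min 2 (B * (V / a)) * a⁻¹) ≤ 2 * ENNReal.ofReal a⁻¹ := by
        rw [ENNReal.ofReal_mul hmin0]
        refine mul_le_mul_left ((ENNReal.ofReal_le_ofReal (min_le_left _ _)).trans ?_) _
        simp
      calc _ ≤ 2 * ENNReal.ofReal a⁻¹ * (2 * (∫⁻ s, ‖ψ s‖ₑ) *
            volume ((F : Set (Eucl ν)) ∩ {t | ε * r < ‖t‖})) := mul_le_mul_left h6 _
        _ = _ := by
          rw [show (4 : ℝ≥0∞) = 2 * 2 by norm_num]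
          ring
  · exact (hfarm.const_mul _).const_mul _
  · exact (((measurable_const.min ((hRm.div_const a).const_mul B)).mul
      (hRm.div_const a)).ennreal_ofReal)

end Smear

section Scaling

variable {ν : ℕ} {Q : Measure (Closeds (Eucl ν))} {ψ : Eucl ν → ℝ} {α c B e r : ℝ}

lemma tendsto_rpow_mul_farVolume (hμ : meanVolume Q < ∞)
    (hfar : (fun r : ℝ => (farVolume Q r).toReal) =o[atTop] fun r : ℝ => r ^ e) {ε : ℝ}
    (hε : 0 < ε) :
    Tendsto (fun r : ℝ => ENNReal.ofReal (r ^ (-e)) * farVolume Q (ε * r)) atTop (𝓝 0) := by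
  have h1 := (hfar.tendsto_div_nhds_zero.comp (tendsto_id.const_mul_atTop hε)).const_mul (ε ^ e)
  rw [mul_zero] at h1
  have h2 := ENNReal.tendsto_ofReal h1
  rw [ENNReal.ofReal_zero] at h2
  refine h2.congr' ?_
  filter_upwards [eventually_gt_atTop 0] with r hr
  have hfin : farVolume Q (ε * r) ≠ ∞ := ((farVolume_le_meanVolume Q _).trans_lt hμ).ne
  conv_rhs => rw [← ENNReal.ofReal_toReal hfin]
  rw [← ENNReal.ofReal_mul (by positivity)]
  congr 1
  simp only [Function.comp_apply, id_eq]
  rw [Real.mul_rpow hε.le hr.le, Real.rpow_neg hr.le]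
  have h3 : 0 < ε ^ e := Real.rpow_pos_of_pos hε e
  have h4 : 0 < r ^ e := Real.rpow_pos_of_pos hr e
  field_simp

variable [SFinite Q]

lemma map_smul_prod (hr : 0 < r) :
    (volume.prod Q).map (fun z : Eucl ν × Closeds (Eucl ν) => (r • z.1, z.2)) =
      ENNReal.ofReal (r ^ ν)⁻¹ • volume.prod Q := by
  have h1 := Measure.map_prod_map (volume : Measure (Eucl ν)) Q
    (f := fun x => r • x) (g := id) (by fun_prop) measurable_id
  rw [Measure.map_id, Measure.map_addHaar_smul _ hr.ne', Measure.prod_smul_left,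
    finrank_euclideanSpace_fin, abs_of_pos (by positivity)] at h1
  exact h1.symm

lemma integrable_comp_smul_prod {g : Eucl ν × Closeds (Eucl ν) → ℝ}
    (hg : Integrable g (volume.prod Q)) (hr : 0 < r) :
    Integrable (fun z => g (r • z.1, z.2)) (volume.prod Q) := by
  refine Integrable.comp_measurable (f := fun z : Eucl ν × Closeds (Eucl ν) => (r • z.1, z.2))
    (g := g) ?_ (by fun_prop)
  rw [map_smul_prod hr]
  exact hg.smul_measure ENNReal.ofReal_ne_top

lemma integral_comp_smul_prod {g : Eucl ν × Closeds (Eucl ν) → ℂ}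
    (hg : AEStronglyMeasurable g (volume.prod Q)) (hr : 0 < r) :
    ∫ z, g z ∂(volume.prod Q) =
      ((r ^ ν : ℝ) : ℂ) * ∫ z, g (r • z.1, z.2) ∂(volume.prod Q) := by
  have hT : Measurable fun z : Eucl ν × Closeds (Eucl ν) => (r • z.1, z.2) := by fun_prop
  have h1 := integral_map (μ := volume.prod Q) hT.aemeasurable (f := g) (by
    rw [map_smul_prod hr]
    exact hg.smul_measure _)
  have hr' : r ^ ν ≠ 0 := (pow_pos hr ν).ne'
  rw [← h1, map_smul_prod hr, integral_smul_measure, ENNReal.toReal_ofReal (by positivity),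
    Complex.real_smul, ← mul_assoc, ← Complex.ofReal_mul, mul_inv_cancel₀ hr', Complex.ofReal_one,
    one_mul]

lemma integrable_smear (hμ : meanVolume Q < ∞) (hψ : Measurable ψ) (hi : Integrable ψ)
    (hr : 0 < r) : Integrable (smear ψ r) (volume.prod Q) := by
  have h1 : Measurable fun t => ψ (r⁻¹ • t) := by fun_prop
  have h2 : Integrable fun t => ψ (r⁻¹ • t) := hi.comp_smul (inv_ne_zero hr.ne')
  have h3 := integrable_comp_smul_prod (integrable_grainIntegral hμ h1 h2) hr
  simpa only [grainIntegral_smul_eq_smear hr.ne'] using h3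

end Scaling

section Limit

variable {ν : ℕ} {Q : Measure (Closeds (Eucl ν))} [IsProbabilityMeasure Q] {ψ : Eucl ν → ℝ}
  {α c B : ℝ}

lemma integrable_centredExp {T : Type*} [MeasurableSpace T] {μ : Measure T} {f : T → ℝ}
    (hf : Measurable f) (hi : Integrable f μ) : Integrable (fun z => centredExp (f z)) μ :=
  (hi.norm.const_mul 2).mono' (continuous_centredExp.measurable.comp hf).aestronglyMeasurable
    (ae_of_all _ fun _ => norm_centredExp_le _)

/-- The exponent of the characteristic function converges: the difference from the exponent of the
idealized model tends to `0`. -/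
lemma tendsto_integral_centredExp_smear (hν : 1 ≤ ν) (hα₁ : 1 < α) (hα₂ : α < 2) (hc : 0 < c)
    (hμ : meanVolume Q < ∞)
    (htail : (fun x : ℝ => Q.real {F : Closeds (Eucl ν) | x < (volume (F : Set (Eucl ν))).toReal})
      ~[atTop] fun x : ℝ => c * x ^ (-α))
    (hfar : (fun r : ℝ => (farVolume Q r).toReal) =o[atTop] fun r : ℝ => r ^ ((1 - α) * ν / α))
    (hψ : Measurable ψ) (hB : ∀ s, |ψ s| ≤ B) (hi : Integrable ψ) :
    Tendsto (fun r : ℝ => ((r ^ ν : ℝ) : ℂ) *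
      ∫ z, centredExp (r ^ (-(ν / α)) * smear ψ r z) ∂(volume.prod Q)) atTop
      (𝓝 (Complex.I * c * ∫ s, (ψ s : ℂ) * stableKernel α (ψ s))) := by
  have hα0 : 0 < α := by linarith
  have hν0 : (0 : ℝ) < ν := by exact_mod_cast hν
  have hB0 : 0 ≤ B := (abs_nonneg _).trans (hB 0)
  have hRm : Measurable fun F : Closeds (Eucl ν) => (volume (F : Set (Eucl ν))).toReal :=
    measurable_volume_closeds.ennreal_toReal
  have hR0 : ∀ F : Closeds (Eucl ν), 0 ≤ (volume (F : Set (Eucl ν))).toReal :=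
    fun F => ENNReal.toReal_nonneg
  obtain ⟨C, hC0, hC⟩ := exists_tail_le hα0 htail
  have hRi := integrable_of_tail hRm hR0 hα₁ hC
  have hpow : ∀ r : ℝ, 0 < r → (r ^ (ν / α : ℝ)) ^ α = r ^ ν := fun r hr => by
    rw [← Real.rpow_mul hr.le, div_mul_cancel₀ _ hα0.ne', Real.rpow_natCast]
  -- the idealized limit, along `a = r ^ (ν / α)`
  have h1 := (tendsto_integral_centredExp_mul (Λ := (volume : Measure (Eucl ν))) hRm hR0 hα₁ hα₂
    hc htail hψ hB hi).comp (tendsto_rpow_atTop (y := (ν / α : ℝ)) (by positivity))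
  refine tendsto_of_tendsto_of_dist h1 ?_
  obtain ⟨D, hD, hDle⟩ := exists_truncated_moment_le hRm hR0 hB0 hα₁ hα₂ hC
  have hN : ∫⁻ s, ‖ψ s‖ₑ < ∞ := hi.2
  have key : Tendsto (fun r : ℝ => ENNReal.ofReal (r ^ ν) *
      ∫⁻ z, ‖centredExp (r ^ (-(ν / α : ℝ)) * smear ψ r z) - centredExp (ψ z.1 *
        ((volume (z.2 : Set (Eucl ν))).toReal / r ^ (ν / α : ℝ)))‖ₑ ∂(volume.prod Q))
      atTop (𝓝 0) := by
    rw [ENNReal.tendsto_nhds_zero]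
    intro η hη
    obtain ⟨δ, hδ0, hδ⟩ : ∃ δ : ℝ≥0∞, 0 < δ ∧ δ * D ≤ η / 2 := by
      refine ⟨η / 2 / (D + 1), ENNReal.div_pos (ENNReal.half_pos hη.ne').ne'
        (ENNReal.add_lt_top.mpr ⟨hD, ENNReal.one_lt_top⟩).ne, ?_⟩
      calc η / 2 / (D + 1) * D ≤ η / 2 / (D + 1) * (D + 1) := by gcongr; exact le_self_add
        _ = η / 2 := ENNReal.div_mul_cancel (by simp)
            (ENNReal.add_lt_top.mpr ⟨hD, ENNReal.one_lt_top⟩).ne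
    obtain ⟨ε, hε, hεδ⟩ := (Metric.nhds_basis_closedBall.eventually_iff.mp
      (ENNReal.tendsto_nhds_zero.mp (tendsto_translationModulus hi) δ hδ0))
    have hεδ' : ∀ h : Eucl ν, ‖h‖ ≤ ε → translationModulus ψ h ≤ δ := fun h hh =>
      hεδ (mem_closedBall_zero_iff.mpr hh)
    have h2 := ENNReal.Tendsto.const_mul (a := 4 * ∫⁻ s, ‖ψ s‖ₑ)
      (tendsto_rpow_mul_farVolume hμ hfar hε)
      (Or.inr (ENNReal.mul_ne_top (by norm_num) hN.ne))
    rw [mul_zero] at h2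
    filter_upwards [eventually_gt_atTop 0, ENNReal.tendsto_nhds_zero.mp h2 (η / 2)
      (ENNReal.half_pos hη.ne')] with r hr hr2
    have ha : 0 < r ^ (ν / α : ℝ) := Real.rpow_pos_of_pos hr _
    have h3 := lintegral_enorm_centredExp_smear_sub_le hμ hψ hB hi hr ha hεδ'
    have h4 := hDle _ ha
    rw [hpow r hr] at h4
    rw [Real.rpow_neg hr.le]
    refine (mul_le_mul_right h3 _).trans ?_
    rw [mul_add, ← ENNReal.add_halves η]
    refine add_le_add ?_ ?_
    · rw [mul_left_comm]
      exact (mul_le_mul_right h4 δ).trans hδ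
    · refine le_trans (le_of_eq ?_) hr2
      rw [mul_left_comm, ← mul_assoc (ENNReal.ofReal (r ^ ν)), ← ENNReal.ofReal_mul (by positivity),
        ← Real.rpow_natCast, ← Real.rpow_neg hr.le, ← Real.rpow_add hr]
      congr 4
      field_simp
      ring
  have key2 := (ENNReal.tendsto_toReal ENNReal.zero_ne_top).comp key
  rw [ENNReal.toReal_zero] at key2
  refine squeeze_zero' (Eventually.of_forall fun _ => dist_nonneg) ?_ key2
  filter_upwards [eventually_gt_atTop 0, ENNReal.tendsto_nhds_zero.mp key 1 one_pos] with r hr hr1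
  have hf : Integrable (fun z => centredExp (r ^ (-(ν / α : ℝ)) * smear ψ r z))
      (volume.prod Q) := integrable_centredExp ((measurable_smear hψ hr.ne').const_mul _)
    ((integrable_smear hμ hψ hi hr).const_mul _)
  have hg : Integrable (fun z : Eucl ν × Closeds (Eucl ν) => centredExp (ψ z.1 *
      ((volume (z.2 : Set (Eucl ν))).toReal / r ^ (ν / α : ℝ)))) (volume.prod Q) :=
    integrable_centredExp ((hψ.comp measurable_fst).mul
      ((hRm.comp measurable_snd).div_const _)) (hi.mul_prod (hRi.div_const _))
  simp only [Function.comp_apply]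
  rw [hpow r hr, dist_comm, dist_eq_norm, ← mul_sub, ← integral_sub hf hg, ← toReal_enorm]
  refine ENNReal.toReal_mono (hr1.trans_lt ENNReal.one_lt_top).ne ?_
  rw [enorm_mul]
  refine mul_le_mul' (le_of_eq ?_) (enorm_integral_le_lintegral_enorm _)
  rw [← ofReal_norm, Complex.norm_real, Real.norm_of_nonneg (by positivity)]

end Limit

section Model

variable {Ω : Type*} {ν : ℕ} [MeasurableSpace Ω] {P : Measure Ω} [IsProbabilityMeasure P]
  {u : ℕ → Ω → Eucl ν} {Ξs : ℕ → Ω → Closeds (Eucl ν)} {Ξ : Ω → Closeds (Eucl ν)}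

/-- Convergence of the characteristic functions of the normalized integrals of the field. -/
lemma IsBooleanModel.tendsto_integral_exp_fieldIntegral (hM : IsBooleanModel P u Ξs Ξ)
    {α c B : ℝ} (hν : 1 ≤ ν) (hα₁ : 1 < α) (hα₂ : α < 2) (hc : 0 < c)
    (hμ : meanVolume (P.map Ξ) < ∞)
    (htail : (fun x : ℝ => (P.map Ξ).real
        {F : Closeds (Eucl ν) | x < (volume (F : Set (Eucl ν))).toReal})
      ~[atTop] fun x : ℝ => c * x ^ (-α))
    (hfar : (fun r : ℝ => (farVolume (P.map Ξ) r).toReal)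
      =o[atTop] fun r : ℝ => r ^ ((1 - α) * ν / α))
    {ψ : Eucl ν → ℝ} (hψ : Measurable ψ) (hB : ∀ s, |ψ s| ≤ B) (hi : Integrable ψ) :
    Tendsto (fun r : ℝ => ∫ ω, Complex.exp ((r ^ (-(ν / α)) * (fieldIntegral u Ξs ψ r ω -
      ∫ ω', fieldIntegral u Ξs ψ r ω' ∂P) : ℝ) * Complex.I) ∂P) atTop
      (𝓝 (Complex.exp (Complex.I * c * ∫ s, (ψ s : ℂ) * stableKernel α (ψ s)))) := by
  have := hM.marked.isProbabilityMeasure_mark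
  refine ((Complex.continuous_exp.tendsto _).comp
    (tendsto_integral_centredExp_smear hν hα₁ hα₂ hc hμ htail hfar hψ hB hi)).congr' ?_
  filter_upwards [eventually_gt_atTop 0] with r hr
  set q := r ^ (-(ν / α : ℝ)) with hq
  have hm : Measurable fun t : Eucl ν => q * ψ (r⁻¹ • t) := by fun_prop
  have hfi : Integrable fun t : Eucl ν => q * ψ (r⁻¹ • t) :=
    (hi.comp_smul (inv_ne_zero hr.ne')).const_mul q
  have h1 := hM.integral_exp_mul_grainField hμ hm hfi
  simp only [mul_assoc, integral_const_mul, ← mul_sub] at h1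
  have h2 : AEStronglyMeasurable
      (fun z => centredExp (grainIntegral (fun t => q * ψ (r⁻¹ • t)) z))
      (volume.prod (P.map Ξ)) :=
    (continuous_centredExp.measurable.comp (measurable_grainIntegral hm)).aestronglyMeasurable
  rw [integral_comp_smul_prod h2 hr] at h1
  have h3 : ∀ z : Eucl ν × Closeds (Eucl ν),
      grainIntegral (fun t => q * ψ (r⁻¹ • t)) (r • z.1, z.2) = q * smear ψ r z := fun z => by
    rw [← grainIntegral_smul_eq_smear hr.ne']
    simp only [grainIntegral, integral_const_mul]
  simp only [h3] at h1
  exact h1.symm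

end Model

/-! ### Probability measures as limits of characteristic functions -/

/-- If the characteristic functions of a sequence of probability measures converge pointwise to a
function continuous at `0`, then the limit is a characteristic function: the sequence is tight, so
it has a cluster point. -/
lemma exists_charFun_eq_of_tendsto {μ : ℕ → ProbabilityMeasure ℝ} {f : ℝ → ℂ}
    (hf : ContinuousAt f 0)
    (h : ∀ t, Tendsto (fun n => charFun (μ n : Measure ℝ) t) atTop (𝓝 (f t))) :
    ∃ L : ProbabilityMeasure ℝ, ∀ t, charFun (L : Measure ℝ) t = f t := by
  have htight := isTightMeasureSet_of_tendsto_charFun hf h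
  have hcomp : IsCompact (closure (Set.range μ)) := by
    refine isCompact_closure_of_isTightMeasureSet ?_
    convert! htight using 1
    ext ν
    simp
  have hle : ((hyperfilter ℕ).map μ : Filter (ProbabilityMeasure ℝ)) ≤
      𝓟 (closure (Set.range μ)) := by
    rw [le_principal_iff]
    exact mem_map.mpr (univ_mem' fun n => subset_closure ⟨n, rfl⟩)
  obtain ⟨L, -, hL⟩ := isCompact_iff_ultrafilter_le_nhds.mp hcomp _ hle
  refine ⟨L, fun t => ?_⟩
  have hL' : Tendsto μ (hyperfilter ℕ : Filter ℕ) (𝓝 L) := hL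
  rw [ProbabilityMeasure.tendsto_iff_forall_integral_rclike_tendsto ℂ] at hL'
  have h1 := hL' (BoundedContinuousFunction.innerProbChar t)
  simp_rw [← charFun_eq_integral_innerProbChar] at h1
  exact tendsto_nhds_unique h1 ((h t).mono_left Nat.hyperfilter_le_atTop)

/-! ### The stable law -/

section Stable

variable {α c : ℝ}

lemma stableKernel_mul {b : ℝ} (hb : 0 < b) (y : ℝ) :
    stableKernel α (b * y) = ((b ^ (α - 1) : ℝ) : ℂ) * stableKernel α y := by
  have h1 := integral_comp_mul_left_Ioi
    (fun x : ℝ => (Complex.exp (Complex.I * y * x) - 1) * ((x ^ (-α) : ℝ) : ℂ)) 0 hb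
  rw [mul_zero] at h1
  have h2 : ∀ x ∈ Set.Ioi (0 : ℝ),
      (Complex.exp (Complex.I * (b * y : ℝ) * x) - 1) * ((x ^ (-α) : ℝ) : ℂ) =
        ((b ^ α : ℝ) : ℂ) * ((Complex.exp (Complex.I * y * (b * x : ℝ)) - 1) *
          (((b * x) ^ (-α) : ℝ) : ℂ)) := by
    intro x hx
    have e1 : (x ^ (-α) : ℝ) = b ^ α * (b * x) ^ (-α) := by
      rw [Real.mul_rpow hb.le (le_of_lt hx), ← mul_assoc, ← Real.rpow_add hb, add_neg_cancel,
        Real.rpow_zero, one_mul]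
    rw [e1]
    push_cast
    ring_nf
  unfold stableKernel
  rw [setIntegral_congr_fun measurableSet_Ioi h2, integral_const_mul, h1, Complex.real_smul,
    ← mul_assoc, ← Complex.ofReal_mul, Real.rpow_sub_one hb.ne', div_eq_mul_inv]

/-- The exponent of the stable law is homogeneous of degree `α` under positive scaling. -/
lemma mul_stableKernel_mul {b : ℝ} (hb : 0 < b) (y : ℝ) :
    ((b * y : ℝ) : ℂ) * stableKernel α (b * y) =
      ((b ^ α : ℝ) : ℂ) * ((y : ℂ) * stableKernel α y) := by
  rw [stableKernel_mul hb, Real.rpow_sub_one hb.ne']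
  push_cast
  have : (b : ℂ) ≠ 0 := Complex.ofReal_ne_zero.mpr hb.ne'
  field_simp

lemma integrableOn_stableKernel (hα₁ : 1 < α) (hα₂ : α < 2) (y : ℝ) :
    IntegrableOn (fun x : ℝ => (Complex.exp (Complex.I * y * x) - 1) * ((x ^ (-α) : ℝ) : ℂ))
      (Set.Ioi 0) := by
  have hm : Measurable fun x : ℝ =>
      (Complex.exp (Complex.I * y * x) - 1) * ((x ^ (-α) : ℝ) : ℂ) := by
    have h1 : Measurable fun x : ℝ => x ^ (-α) := measurable_id.pow_const _
    have h2 : Measurable fun x : ℝ => Complex.exp (Complex.I * y * x) - 1 := by fun_prop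
    exact h2.mul (Complex.measurable_ofReal.comp h1)
  refine (integrableOn_min_mul_rpow (abs_nonneg y) hα₁ hα₂).mono' hm.aestronglyMeasurable
    ((ae_restrict_mem measurableSet_Ioi).mono fun x hx => ?_)
  have hx0 : (0 : ℝ) < x := hx
  have h := norm_exp_I_mul_sub_one_le (y * x)
  push_cast at h
  rw [← mul_assoc, abs_mul, abs_of_pos hx0] at h
  rw [norm_mul, Complex.norm_real, Real.norm_of_nonneg (by positivity)]
  gcongr

lemma one_sub_cos_le_abs (x : ℝ) : 1 - Real.cos x ≤ |x| := by
  have h1 := (Complex.abs_re_le_norm _).trans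
    ((norm_exp_I_mul_sub_one_le x).trans (min_le_right _ _))
  have h2 : (Complex.exp (Complex.I * x) - 1).re = Real.cos x - 1 := by
    rw [mul_comm, Complex.sub_re, Complex.exp_ofReal_mul_I_re, Complex.one_re]
  rw [h2] at h1
  have := neg_abs_le (Real.cos x - 1)
  linarith

/-- `∫₀^∞ sin(x) x^{-α} dx = α ∫₀^∞ (1 - cos x) x^{-α-1} dx > 0`. -/
lemma integral_sin_mul_rpow_pos (hα₁ : 1 < α) (hα₂ : α < 2) :
    0 < ∫ x in Set.Ioi (0 : ℝ), Real.sin x * x ^ (-α) := by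
  have hcos : ∀ x : ℝ, 0 < x → 1 - Real.cos x ≤ min 2 (1 * x) * x := fun x hx => by
    rw [one_mul]
    have h1 := one_sub_cos_le_abs x
    rw [abs_of_pos hx] at h1
    have h2 := Real.one_sub_sq_div_two_le_cos (x := x)
    rcases le_total 2 x with h | h
    · rw [min_eq_left h]
      linarith
    · rw [min_eq_right h]
      nlinarith
  have hnn : ∀ x : ℝ, 0 ≤ 1 - Real.cos x := fun x => sub_nonneg.mpr (Real.cos_le_one x)
  have hbase := integrableOn_min_mul_rpow zero_le_one hα₁ hα₂
  have hi1 : IntegrableOn (fun x : ℝ => Real.sin x * x ^ (-α)) (Set.Ioi 0) := by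
    have hm : Measurable fun x : ℝ => Real.sin x * x ^ (-α) :=
      Real.measurable_sin.mul (measurable_id.pow_const _)
    refine hbase.mono' hm.aestronglyMeasurable
      ((ae_restrict_mem measurableSet_Ioi).mono fun x hx => ?_)
    have hx0 : (0 : ℝ) < x := hx
    rw [norm_mul, Real.norm_of_nonneg (Real.rpow_pos_of_pos hx0 _).le, one_mul]
    refine mul_le_mul_of_nonneg_right (le_min ?_ ?_) (Real.rpow_pos_of_pos hx0 _).le
    · exact (Real.abs_sin_le_one x).trans one_le_two
    · exact (Real.abs_sin_le_abs).trans (abs_of_pos hx0).le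
  have hle2 : ∀ x : ℝ, 0 < x → (1 - Real.cos x) * x ^ (-α - 1) ≤ min 2 (1 * x) * x ^ (-α) := by
    intro x hx
    rw [Real.rpow_sub_one hx.ne', ← mul_div_assoc, div_le_iff₀ hx]
    have h1 := mul_le_mul_of_nonneg_right (hcos x hx) (Real.rpow_pos_of_pos hx (-α)).le
    linarith
  have hi2 : IntegrableOn (fun x : ℝ => (1 - Real.cos x) * x ^ (-α - 1)) (Set.Ioi 0) := by
    have hm : Measurable fun x : ℝ => (1 - Real.cos x) * x ^ (-α - 1) :=
      (Real.measurable_cos.const_sub 1).mul (measurable_id.pow_const _)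
    refine hbase.mono' hm.aestronglyMeasurable
      ((ae_restrict_mem measurableSet_Ioi).mono fun x hx => ?_)
    have hx0 : (0 : ℝ) < x := hx
    rw [Real.norm_of_nonneg (mul_nonneg (hnn x) (Real.rpow_pos_of_pos hx0 _).le)]
    exact hle2 x hx0
  have hparts := integral_Ioi_mul_deriv_eq_deriv_mul (a := (0 : ℝ)) (a' := 0) (b' := 0)
    (u := fun x => x ^ (-α)) (v := fun x => 1 - Real.cos x)
    (u' := fun x => -α * x ^ (-α - 1)) (v' := Real.sin)
    (fun x hx => Real.hasDerivAt_rpow_const (Or.inl (ne_of_gt hx)))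
    (fun x _ => by simpa using (Real.hasDerivAt_cos x).const_sub 1)
    (hi1.congr_fun (fun x _ => mul_comm _ _) measurableSet_Ioi)
    (IntegrableOn.congr_fun (hi2.const_mul (-α)) (fun x _ => by simp only [Pi.mul_apply]; ring)
      measurableSet_Ioi) ?_ ?_
  · have e1 : ∫ x in Set.Ioi (0 : ℝ), Real.sin x * x ^ (-α) =
        α * ∫ x in Set.Ioi (0 : ℝ), (1 - Real.cos x) * x ^ (-α - 1) := by
      simp only [mul_comm (Real.sin _)]
      rw [hparts, ← integral_const_mul, sub_zero, zero_sub, ← integral_neg]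
      refine integral_congr_ae (ae_of_all _ fun x => ?_)
      simp only
      ring
    rw [e1]
    refine mul_pos (by linarith) ?_
    rw [setIntegral_pos_iff_support_of_nonneg_ae ?_ hi2]
    · refine lt_of_lt_of_le ?_ (measure_mono (?_ : Set.Ioo (0 : ℝ) 1 ⊆ _))
      · simp
      · intro x hx
        refine ⟨?_, hx.1⟩
        have h1 : Real.cos x < 1 := by
          have := Real.cos_lt_cos_of_nonneg_of_le_pi le_rfl
            (hx.2.le.trans (by linarith [Real.pi_gt_three])) hx.1
          rwa [Real.cos_zero] at this
        exact (mul_pos (sub_pos.mpr h1) (Real.rpow_pos_of_pos hx.1 _)).ne'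
    · exact (ae_restrict_mem measurableSet_Ioi).mono fun x hx =>
        mul_nonneg (hnn x) (Real.rpow_pos_of_pos hx _).le
  · -- `x^{-α} (1 - cos x) ≤ x^{2 - α}` near the origin
    have h1 : Tendsto (fun x : ℝ => x ^ (2 - α)) (𝓝[>] 0) (𝓝 0) := by
      have := (Real.continuousAt_rpow_const 0 (2 - α) (Or.inr (by linarith))).tendsto
      rw [Real.zero_rpow (by linarith)] at this
      exact this.mono_left nhdsWithin_le_nhds
    refine squeeze_zero' ?_ ?_ h1
    · filter_upwards [self_mem_nhdsWithin] with x hx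
      exact mul_nonneg (Real.rpow_pos_of_pos hx _).le (hnn x)
    · filter_upwards [self_mem_nhdsWithin] with x hx
      have hx0 : (0 : ℝ) < x := hx
      have e : x ^ (2 - α) = x ^ (-α) * (x * x) := by
        rw [sub_eq_neg_add, Real.rpow_add hx0, Real.rpow_two, sq]
      simp only [Pi.mul_apply]
      rw [e]
      refine mul_le_mul_of_nonneg_left ((hcos x hx0).trans ?_) (Real.rpow_pos_of_pos hx0 _).le
      rw [one_mul]
      exact mul_le_mul_of_nonneg_right (min_le_right _ _) hx0.le
  · have h1 : Tendsto (fun x : ℝ => x ^ (-α) * 2) atTop (𝓝 0) := by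
      simpa using (tendsto_rpow_neg_atTop (y := α) (by linarith)).mul_const 2
    refine squeeze_zero' ?_ ?_ h1
    · filter_upwards [eventually_gt_atTop 0] with x hx
      exact mul_nonneg (Real.rpow_pos_of_pos hx _).le (hnn x)
    · filter_upwards [eventually_gt_atTop 0] with x hx
      refine mul_le_mul_of_nonneg_left ?_ (Real.rpow_pos_of_pos hx _).le
      linarith [Real.neg_one_le_cos x]

lemma im_stableKernel (hα₁ : 1 < α) (hα₂ : α < 2) (y : ℝ) : (stableKernel α y).im =
    ∫ x in Set.Ioi (0 : ℝ), Real.sin (y * x) * x ^ (-α) := by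
  have h1 := integral_im (integrableOn_stableKernel hα₁ hα₂ y)
  simp only [RCLike.im_to_complex] at h1
  rw [stableKernel, ← h1]
  refine integral_congr_ae (ae_of_all _ fun x => ?_)
  simp only
  rw [Complex.im_mul_ofReal, show Complex.I * y * x = ((y * x : ℝ) : ℂ) * Complex.I by
    push_cast; ring, Complex.sub_im, Complex.exp_ofReal_mul_I_im, Complex.one_im, sub_zero]

/-- `Im(y ∫₀^∞ (e^{iyx} - 1) x^{-α} dx) = |y|^α ∫₀^∞ sin(x) x^{-α} dx`. -/
lemma mul_im_stableKernel (hα₁ : 1 < α) (hα₂ : α < 2) (y : ℝ) : y * (stableKernel α y).im =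
    |y| ^ α * ∫ x in Set.Ioi (0 : ℝ), Real.sin x * x ^ (-α) := by
  have hneg : ∀ y, (stableKernel α (-y)).im = -(stableKernel α y).im := fun y => by
    rw [im_stableKernel hα₁ hα₂, im_stableKernel hα₁ hα₂, ← integral_neg]
    simp
  have habs : y * (stableKernel α y).im = |y| * (stableKernel α |y|).im := by
    rcases abs_cases y with ⟨h, -⟩ | ⟨h, -⟩
    · rw [h]
    · rw [h, hneg]
      ring
  rcases (abs_nonneg y).eq_or_lt with h0 | h0
  · rw [habs, ← h0, Real.zero_rpow (by linarith)]
    simp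
  · have h1 := congrArg Complex.im (mul_stableKernel_mul (α := α) h0 1)
    rw [mul_one, Complex.im_ofReal_mul, Complex.ofReal_one, one_mul, Complex.im_ofReal_mul,
      im_stableKernel hα₁ hα₂ 1] at h1
    simp only [one_mul] at h1
    rw [habs, h1]

lemma norm_mul_stableKernel_le (y : ℝ) : ‖(y : ℂ) * stableKernel α y‖ ≤
    |y| ^ α * max ‖stableKernel α 1‖ ‖stableKernel α (-1)‖ := by
  rcases lt_trichotomy y 0 with h | h | h
  · have h1 := mul_stableKernel_mul (α := α) (neg_pos.mpr h) (-1)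
    simp only [neg_mul_neg, mul_one] at h1
    rw [h1, abs_of_neg h, norm_mul, Complex.norm_real,
      Real.norm_of_nonneg (Real.rpow_nonneg (neg_pos.mpr h).le _)]
    refine mul_le_mul_of_nonneg_left ?_ (Real.rpow_nonneg (neg_pos.mpr h).le _)
    simp
  · simp only [h, Complex.ofReal_zero, zero_mul, norm_zero]
    positivity
  · have h1 := mul_stableKernel_mul (α := α) h 1
    simp only [mul_one] at h1
    rw [h1, abs_of_pos h, norm_mul, Complex.norm_real,
      Real.norm_of_nonneg (Real.rpow_nonneg h.le _)]
    refine mul_le_mul_of_nonneg_left ?_ (Real.rpow_nonneg h.le _)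
    simp

variable {ν : ℕ} {φ ψ : Eucl ν → ℝ} {B : ℝ}

lemma stableLogCharFun_congr (h : φ =ᵐ[volume] ψ) (θ : ℝ) :
    stableLogCharFun c α φ θ = stableLogCharFun c α ψ θ := by
  unfold stableLogCharFun
  congr 1
  refine integral_congr_ae ?_
  filter_upwards [h] with s hs
  rw [hs]

lemma stableLogCharFun_zero : stableLogCharFun c α φ 0 = 0 := by
  simp [stableLogCharFun]

lemma stableLogCharFun_mul {b : ℝ} (hb : 0 < b) (θ : ℝ) :
    stableLogCharFun c α φ (b * θ) = ((b ^ α : ℝ) : ℂ) * stableLogCharFun c α φ θ := by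
  simp only [stableLogCharFun, mul_assoc b, mul_stableKernel_mul hb]
  rw [integral_const_mul]
  ring

lemma continuousAt_exp_stableLogCharFun (hα : 0 < α) :
    ContinuousAt (fun θ => Complex.exp (stableLogCharFun c α φ θ)) 0 := by
  refine Complex.continuous_exp.continuousAt.comp ?_
  set K := max ‖stableLogCharFun c α φ 1‖ ‖stableLogCharFun c α φ (-1)‖
  have hle : ∀ θ, ‖stableLogCharFun c α φ θ‖ ≤ |θ| ^ α * K := fun θ => by
    rcases lt_trichotomy θ 0 with h | h | h
    · have h1 := stableLogCharFun_mul (c := c) (α := α) (φ := φ) (neg_pos.mpr h) (-1)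
      rw [neg_mul_neg, mul_one] at h1
      rw [h1, abs_of_neg h, norm_mul, Complex.norm_real,
        Real.norm_of_nonneg (Real.rpow_nonneg (neg_pos.mpr h).le _)]
      exact mul_le_mul_of_nonneg_left (le_max_right _ _) (Real.rpow_nonneg (neg_pos.mpr h).le _)
    · rw [h, stableLogCharFun_zero, norm_zero]
      positivity
    · have h1 := stableLogCharFun_mul (c := c) (α := α) (φ := φ) h 1
      rw [mul_one] at h1
      rw [h1, abs_of_pos h, norm_mul, Complex.norm_real,
        Real.norm_of_nonneg (Real.rpow_nonneg h.le _)]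
      exact mul_le_mul_of_nonneg_left (le_max_left _ _) (Real.rpow_nonneg h.le _)
  have hlim : Tendsto (fun θ : ℝ => |θ| ^ α * K) (𝓝 0) (𝓝 0) := by
    have h1 : Continuous fun θ : ℝ => |θ| ^ α * K :=
      (continuous_abs.rpow_const fun _ => Or.inr hα.le).mul_const K
    have h2 := h1.tendsto 0
    rwa [abs_zero, Real.zero_rpow hα.ne', zero_mul] at h2
  rw [ContinuousAt, stableLogCharFun_zero]
  exact squeeze_zero_norm hle hlim

lemma measurable_stableKernel : Measurable (stableKernel α) := by
  have h1 : Measurable fun w : ℝ × ℝ =>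
      (Complex.exp (Complex.I * w.1 * w.2) - 1) * ((w.2 ^ (-α) : ℝ) : ℂ) := by
    have h2 : Measurable fun w : ℝ × ℝ => w.2 ^ (-α) := measurable_snd.pow_const _
    have h3 : Measurable fun w : ℝ × ℝ => Complex.exp (Complex.I * w.1 * w.2) - 1 := by fun_prop
    exact h3.mul (Complex.measurable_ofReal.comp h2)
  exact (h1.stronglyMeasurable.integral_prod_right' (ν := volume.restrict (Set.Ioi 0))).measurable

lemma integrable_abs_rpow (hα₁ : 1 < α) (hφ : Measurable φ) (hB : ∀ s, |φ s| ≤ B)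
    (hi : Integrable φ) : Integrable fun s => |φ s| ^ α := by
  refine (hi.abs.const_mul (B ^ (α - 1))).mono' (hφ.abs.pow_const α).aestronglyMeasurable
    (ae_of_all _ fun s => ?_)
  rw [Real.norm_of_nonneg (Real.rpow_nonneg (abs_nonneg _) _)]
  rcases (abs_nonneg (φ s)).eq_or_lt with h | h
  · rw [← h, Real.zero_rpow (by linarith), mul_zero]
  · have e : |φ s| ^ α = |φ s| ^ (α - 1) * |φ s| := by
      rw [Real.rpow_sub_one h.ne', div_mul_cancel₀ _ h.ne']
    rw [e]
    exact mul_le_mul_of_nonneg_right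
      (Real.rpow_le_rpow h.le (hB s) (by linarith)) h.le

lemma re_stableLogCharFun_one (hα₁ : 1 < α) (hα₂ : α < 2) (hφ : Measurable φ)
    (hB : ∀ s, |φ s| ≤ B) (hi : Integrable φ) : (stableLogCharFun c α φ 1).re =
      -(c * ((∫ x in Set.Ioi (0 : ℝ), Real.sin x * x ^ (-α)) * ∫ s, |φ s| ^ α)) := by
  have hint : Integrable fun s => (φ s : ℂ) * stableKernel α (φ s) := by
    refine ((integrable_abs_rpow hα₁ hφ hB hi).mul_const _).mono'
      ((Complex.measurable_ofReal.comp hφ).mul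
        (measurable_stableKernel.comp hφ)).aestronglyMeasurable
      (ae_of_all _ fun s => norm_mul_stableKernel_le (φ s))
  have h1 := integral_im hint
  simp only [RCLike.im_to_complex, Complex.im_ofReal_mul, mul_im_stableKernel hα₁ hα₂] at h1
  rw [integral_mul_const] at h1
  simp only [stableLogCharFun, one_mul]
  rw [Complex.mul_re, ← h1, Complex.I_mul_re, Complex.ofReal_im, Complex.I_mul_im,
    Complex.ofReal_re]
  ring

/-- A law with the logarithmic characteristic function of a stable integral is stable; it is not
degenerate because its characteristic function has modulus less than `1`. -/
lemma isAlphaStable_of_isStableIntegralLaw (hα₁ : 1 < α) (hα₂ : α < 2) (hc : 0 < c)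
    (hφ : Measurable φ) (hB : ∀ s, |φ s| ≤ B) (hi : Integrable φ) (hne : ¬ φ =ᵐ[volume] 0)
    {L : ProbabilityMeasure ℝ} (hL : IsStableIntegralLaw c α φ L) :
    IsAlphaStable α (L : Measure ℝ) := by
  have hα0 : 0 < α := by linarith
  refine ⟨fun m hm => ?_, fun a b ha hb => ⟨0, ?_⟩⟩
  · have h1 := congrArg norm (hL 1)
    rw [hm, charFun_dirac, Complex.norm_exp, Complex.norm_exp,
      re_stableLogCharFun_one hα₁ hα₂ hφ hB hi] at h1
    have hpos : 0 < ∫ s, |φ s| ^ α := by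
      rw [integral_pos_iff_support_of_nonneg (fun s => Real.rpow_nonneg (abs_nonneg _) _)
        (integrable_abs_rpow hα₁ hφ hB hi), pos_iff_ne_zero]
      intro h0
      refine hne ?_
      have h2 : ∀ᵐ s, s ∉ Function.support fun s => |φ s| ^ α := measure_eq_zero_iff_ae_notMem.mp h0
      filter_upwards [h2] with s hs
      by_contra h3
      exact hs (Real.rpow_pos_of_pos (abs_pos.mpr h3) α).ne'
    have h4 := mul_pos hc (mul_pos (integral_sin_mul_rpow_pos hα₁ hα₂) hpos)
    have h5 := Real.exp_injective h1
    rw [Complex.re_ofReal_mul, Complex.I_re, mul_zero] at h5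
    linarith
  · have hab : 0 < a ^ α + b ^ α :=
      add_pos (Real.rpow_pos_of_pos ha α) (Real.rpow_pos_of_pos hb α)
    have hk : 0 < (a ^ α + b ^ α) ^ (1 / α) := Real.rpow_pos_of_pos hab _
    simp only [add_zero]
    have : IsProbabilityMeasure ((L : Measure ℝ).map fun x => a * x) :=
      Measure.isProbabilityMeasure_map (by fun_prop)
    have : IsProbabilityMeasure ((L : Measure ℝ).map fun x => b * x) :=
      Measure.isProbabilityMeasure_map (by fun_prop)
    have : IsProbabilityMeasure ((L : Measure ℝ).map fun x => (a ^ α + b ^ α) ^ (1 / α) * x) :=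
      Measure.isProbabilityMeasure_map (by fun_prop)
    refine Measure.ext_of_charFun (funext fun θ => ?_)
    rw [charFun_conv, charFun_map_mul, charFun_map_mul, charFun_map_mul, hL, hL, hL,
      stableLogCharFun_mul ha, stableLogCharFun_mul hb, stableLogCharFun_mul hk, ← Complex.exp_add,
      ← Real.rpow_mul hab.le, one_div_mul_cancel hα0.ne', Real.rpow_one]
    push_cast
    ring_nf

/-- The log-characteristic function of the stable integral of an indicator function. -/
lemma stableLogCharFun_indicator {A : Set (Eucl ν)} (hA : MeasurableSet A) (θ : ℝ) :
    stableLogCharFun c α (A.indicator fun _ => (1 : ℝ)) θ =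
      Complex.I * c * θ * (volume.real A : ℂ) * stableKernel α θ := by
  classical
  have e : ∀ s, ((θ * A.indicator (fun _ => (1 : ℝ)) s : ℝ) : ℂ) *
      stableKernel α (θ * A.indicator (fun _ => (1 : ℝ)) s) =
        A.indicator (fun _ => (θ : ℂ) * stableKernel α θ) s := fun s => by
    simp only [Set.indicator_apply]
    split_ifs <;> simp
  simp only [stableLogCharFun, e]
  rw [integral_indicator_const _ hA, Complex.real_smul]
  ring

end Stable

/-! ### Convergence in distribution of families of real random variables -/

section Distribution

variable {Ω Ω' : Type*} [MeasurableSpace Ω] [MeasurableSpace Ω'] {P : Measure Ω}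
  [IsProbabilityMeasure P]

omit [IsProbabilityMeasure P] in
lemma charFun_map_eq_integral {X : Ω → ℝ} (hX : AEMeasurable X P) (θ : ℝ) :
    charFun (P.map X) θ = ∫ ω, Complex.exp ((θ * X ω : ℝ) * Complex.I) ∂P := by
  rw [charFun_apply_real, integral_map hX (by fun_prop)]
  simp only [Complex.ofReal_mul]

/-- Convergence of the characteristic functions to a function continuous at `0` implies convergence
in distribution, to a law which need not be given beforehand. -/
lemma exists_tendstoInDistribution {X : ℝ → Ω → ℝ} (hX : ∀ r, AEMeasurable (X r) P) {f : ℝ → ℂ}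
    (hf : ContinuousAt f 0)
    (h : ∀ θ : ℝ, Tendsto (fun r => ∫ ω, Complex.exp ((θ * X r ω : ℝ) * Complex.I) ∂P) atTop
      (𝓝 (f θ))) :
    ∃ L : ProbabilityMeasure ℝ, (∀ θ, charFun (L : Measure ℝ) θ = f θ) ∧
      TendstoInDistribution X atTop (fun x : ℝ => x) (fun _ => P) (L : Measure ℝ) := by
  let μ : ℝ → ProbabilityMeasure ℝ := fun r =>
    ⟨P.map (X r), Measure.isProbabilityMeasure_map (hX r)⟩
  have hμ : ∀ θ, Tendsto (fun r => charFun (μ r : Measure ℝ) θ) atTop (𝓝 (f θ)) := fun θ =>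
    (h θ).congr fun r => (charFun_map_eq_integral (hX r) θ).symm
  obtain ⟨L, hL⟩ := exists_charFun_eq_of_tendsto (μ := fun n : ℕ => μ n) hf
    fun θ => (hμ θ).comp tendsto_natCast_atTop_atTop
  refine ⟨L, hL, hX, aemeasurable_id, ?_⟩
  have hlim : Tendsto μ atTop (𝓝 L) := by
    refine tendsto_of_seq_tendsto fun x hx => ?_
    rw [ProbabilityMeasure.tendsto_iff_tendsto_charFun]
    intro θ
    rw [hL]
    exact (hμ θ).comp hx
  have hid : (⟨(L : Measure ℝ).map fun x => x, Measure.isProbabilityMeasure_map aemeasurable_id⟩ :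
      ProbabilityMeasure ℝ) = L := Subtype.ext Measure.map_id
  rw [hid]
  exact hlim

lemma tendstoInDistribution_congr_eventually {X Y : ℝ → Ω → ℝ} {Z : Ω' → ℝ} {μ : Measure Ω'}
    [IsProbabilityMeasure μ] (h : TendstoInDistribution X atTop Z (fun _ => P) μ)
    (hY : ∀ r, AEMeasurable (Y r) P) (hXY : ∀ᶠ r in atTop, X r = Y r) :
    TendstoInDistribution Y atTop Z (fun _ => P) μ := by
  refine tendstoInDistribution_of_tendstoInMeasure_sub Y Z h (fun ε hε => ?_) hY
  refine tendsto_const_nhds.congr' ?_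
  filter_upwards [hXY] with r hr
  simp [hr, hε.ne']

/-- Slutsky's theorem with the remainder small in mean square. -/
lemma tendstoInDistribution_of_lintegral_sq {X Y : ℝ → Ω → ℝ} {Z : Ω' → ℝ} {μ : Measure Ω'}
    [IsProbabilityMeasure μ] (h : TendstoInDistribution X atTop Z (fun _ => P) μ)
    (hY : ∀ r, AEMeasurable (Y r) P)
    (hXY : Tendsto (fun r => ∫⁻ ω, ‖Y r ω - X r ω‖ₑ ^ 2 ∂P) atTop (𝓝 0)) :
    TendstoInDistribution Y atTop Z (fun _ => P) μ := by
  refine tendstoInDistribution_of_tendstoInMeasure_sub Y Z h ?_ hY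
  refine tendstoInMeasure_of_tendsto_eLpNorm (p := 2) two_ne_zero
    (fun r => ((hY r).sub (h.forall_aemeasurable r)).aestronglyMeasurable)
    aestronglyMeasurable_const ?_
  have h1 := (ENNReal.continuous_rpow_const (y := 1 / 2)).tendsto 0 |>.comp hXY
  rw [ENNReal.zero_rpow_of_pos (by norm_num)] at h1
  refine h1.congr fun r => ?_
  rw [eLpNorm_eq_lintegral_rpow_enorm_toReal two_ne_zero (by norm_num)]
  simp

end Distribution

section Weights

variable {ν : ℕ}

/-- A function in `L¹ ∩ L^∞` has a measurable version that is bounded everywhere. -/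
lemma exists_bounded_version {φ : Eucl ν → ℝ} (h1 : MemLp φ 1 volume) (h2 : MemLp φ ∞ volume) :
    ∃ (ψ : Eucl ν → ℝ) (B : ℝ), Measurable ψ ∧ (∀ s, |ψ s| ≤ B) ∧ Integrable ψ ∧
      φ =ᵐ[volume] ψ := by
  classical
  have hφ := h1.1.aemeasurable
  set B := (eLpNormEssSup φ volume).toReal with hB
  have hlt : eLpNormEssSup φ volume < ∞ := by
    have := h2.2
    rwa [eLpNorm_exponent_top] at this
  have hB0 : 0 ≤ B := ENNReal.toReal_nonneg
  have hset : MeasurableSet {s | |hφ.mk φ s| ≤ B} :=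
    measurableSet_le hφ.measurable_mk.abs measurable_const
  have hae : φ =ᵐ[volume] {s | |hφ.mk φ s| ≤ B}.indicator (hφ.mk φ) := by
    filter_upwards [hφ.ae_eq_mk, ae_le_eLpNormEssSup (f := φ) (μ := volume)] with s hs hs2
    have h3 : |hφ.mk φ s| ≤ B := by
      rw [← hs, hB, ← Real.norm_eq_abs, ← toReal_enorm]
      exact ENNReal.toReal_mono hlt.ne hs2
    rw [Set.indicator_of_mem (by exact h3), hs]
  refine ⟨_, B, hφ.measurable_mk.indicator hset, fun s => ?_,
    (memLp_one_iff_integrable.mp h1).congr hae, hae⟩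
  rw [Set.indicator_apply]
  split_ifs with h
  · exact h
  · simpa using hB0

lemma scaledIntegral_congr {φ ψ : Eucl ν → ℝ} (h : φ =ᵐ[volume] ψ) (Y : Eucl ν → ℝ) {r : ℝ}
    (hr : r ≠ 0) : scaledIntegral Y φ r = scaledIntegral Y ψ r := by
  refine integral_congr_ae ?_
  have h1 := (Measure.quasiMeasurePreserving_smul (μ := (volume : Measure (Eucl ν)))
    (inv_ne_zero hr)).ae_eq_comp h
  filter_upwards [h1] with t ht
  simp only [Function.comp_apply] at ht
  rw [ht]

end Weights

section Model

variable {Ω : Type*} {ν : ℕ} [MeasurableSpace Ω] {P : Measure Ω} [IsProbabilityMeasure P]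
  {u : ℕ → Ω → Eucl ν} {Ξs : ℕ → Ω → Closeds (Eucl ν)} {Ξ : Ω → Closeds (Eucl ν)} {α c : ℝ}

namespace IsBooleanModel

variable (hM : IsBooleanModel P u Ξs Ξ)
include hM

/-! ### Consequences of the tail assumption -/

omit [IsProbabilityMeasure P] hM in
lemma ae_volume_lt_top [IsFiniteMeasure P] (hα : 0 < α)
    (htail : (fun x : ℝ => P.real {ω | ENNReal.ofReal x < volume (Ξ ω : Set (Eucl ν))})
      ~[atTop] fun x : ℝ => c * x ^ (-α)) :
    ∀ᵐ ω ∂P, volume (Ξ ω : Set (Eucl ν)) < ∞ := by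
  have h0 : Tendsto (fun x : ℝ => c * x ^ (-α)) atTop (𝓝 0) := by
    simpa using (tendsto_rpow_neg_atTop hα).const_mul c
  have h1 := htail.symm.tendsto_nhds h0
  have h2 : P.real {ω | volume (Ξ ω : Set (Eucl ν)) = ∞} ≤ 0 :=
    ge_of_tendsto' h1 fun x => measureReal_mono fun ω (hω : _ = _) => by
      simp [hω]
  have h3 : P {ω | volume (Ξ ω : Set (Eucl ν)) = ∞} = 0 :=
    (measureReal_eq_zero_iff).mp (le_antisymm h2 measureReal_nonneg)
  filter_upwards [measure_eq_zero_iff_ae_notMem.mp h3] with ω hω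
  exact lt_top_iff_ne_top.mpr hω

lemma tail_isEquivalent (hα : 0 < α)
    (htail : (fun x : ℝ => P.real {ω | ENNReal.ofReal x < volume (Ξ ω : Set (Eucl ν))})
      ~[atTop] fun x : ℝ => c * x ^ (-α)) :
    (fun x : ℝ => (P.map Ξ).real {F : Closeds (Eucl ν) | x < (volume (F : Set (Eucl ν))).toReal})
      ~[atTop] fun x : ℝ => c * x ^ (-α) := by
  refine htail.congr_left ?_
  filter_upwards [eventually_ge_atTop 0] with x hx
  rw [map_measureReal_apply hM.measurable_generic
    (measurableSet_lt measurable_const measurable_volume_closeds.ennreal_toReal)]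
  refine measureReal_congr ?_
  filter_upwards [ae_volume_lt_top hα htail] with ω hω
  exact propext (ENNReal.ofReal_lt_iff_lt_toReal hx hω.ne)

lemma meanVolume_lt_top (hα₁ : 1 < α)
    (htail : (fun x : ℝ => P.real {ω | ENNReal.ofReal x < volume (Ξ ω : Set (Eucl ν))})
      ~[atTop] fun x : ℝ => c * x ^ (-α)) :
    meanVolume (P.map Ξ) < ∞ := by
  have := hM.marked.isProbabilityMeasure_mark
  have hα0 : 0 < α := by linarith
  obtain ⟨C, -, hC⟩ := exists_tail_le hα0 (hM.tail_isEquivalent hα0 htail)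
  have h1 := integrable_of_tail measurable_volume_closeds.ennreal_toReal
    (fun _ => ENNReal.toReal_nonneg) hα₁ hC
  refine lt_of_eq_of_lt (lintegral_congr_ae ?_) h1.lintegral_lt_top
  have h2 : MeasurableSet {F : Closeds (Eucl ν) | volume (F : Set (Eucl ν)) < ∞} :=
    measurableSet_lt measurable_volume_closeds measurable_const
  have h3 : ∀ᵐ F : Closeds (Eucl ν) ∂(P.map Ξ), volume (F : Set (Eucl ν)) < ∞ :=
    (ae_map_iff hM.measurable_generic.aemeasurable h2).mpr (ae_volume_lt_top hα0 htail)
  filter_upwards [h3] with F hF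
  exact (ENNReal.ofReal_toReal hF.ne).symm

/-! ### Limit theorems for the integrals -/

section Field

variable (hμ : meanVolume (P.map Ξ) < ∞) {φ : Eucl ν → ℝ}

include hμ in
lemma integrable_fieldIntegral (hi : Integrable φ) {r : ℝ} (hr : r ≠ 0) :
    Integrable (fieldIntegral u Ξs φ r) P :=
  (hM.integrable_mul_grainField hμ (hi.comp_smul (inv_ne_zero hr))).integral_prod_left

lemma integrable_excursionIntegral (k : ℕ) (hi : Integrable φ) {r : ℝ} (hr : r ≠ 0) :
    Integrable (excursionIntegral u Ξs k φ r) P :=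
  (hM.integrable_mul_excursion k (hi.comp_smul (inv_ne_zero hr))).integral_prod_left

omit [IsProbabilityMeasure P] hM in
/-- The factor `r ^ (-(ν / α))` vanishes at `r = 0`, where `φ (r⁻¹ • ·)` need not be integrable. -/
lemma aemeasurable_normalized {X : ℝ → Ω → ℝ} {y : ℝ} (hy : y ≠ 0) (b : ℝ → ℝ)
    (hX : ∀ r, r ≠ 0 → AEMeasurable (X r) P) (r : ℝ) :
    AEMeasurable (fun ω => r ^ y * (X r ω - b r)) P := by
  rcases eq_or_ne r 0 with h | h
  · subst h
    simp only [Real.zero_rpow hy, zero_mul]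
    exact aemeasurable_const
  · exact ((hX r h).sub_const _).const_mul _

include hμ in
/-- The normalized integrals of the excursion indicator and of the field are asymptotically
proportional in mean square. -/
lemma tendsto_lintegral_sq_normalized (hν : 1 ≤ ν) (hα₁ : 1 < α) (hα₂ : α < 2)
    (hfar : (fun r : ℝ => (farVolume (P.map Ξ) r).toReal)
      =o[atTop] fun r : ℝ => r ^ ((1 - α) * ν / α))
    (hφ : Measurable φ) {B : ℝ} (hB : ∀ s, |φ s| ≤ B) (hi : Integrable φ) {k : ℕ} (hk : 1 ≤ k) :
    Tendsto (fun r : ℝ => ∫⁻ ω, ‖r ^ (-(ν / α : ℝ)) * (excursionIntegral u Ξs k φ r ω -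
        ∫ ω', excursionIntegral u Ξs k φ r ω' ∂P) -
      charlierCoeff (meanVolume (P.map Ξ)).toNNReal k * (r ^ (-(ν / α : ℝ)) *
        (fieldIntegral u Ξs φ r ω - ∫ ω', fieldIntegral u Ξs φ r ω' ∂P))‖ₑ ^ 2 ∂P)
      atTop (𝓝 0) := by
  have := hM.marked.isProbabilityMeasure_mark
  have hα0 : 0 < α := by linarith
  have hν0 : (0 : ℝ) < ν := by exact_mod_cast hν
  obtain ⟨K, hK0, hK⟩ := hM.lintegral_sq_linearization_le hμ hk
  have he : (1 - α) * ν / α ≤ 0 :=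
    div_nonpos_of_nonpos_of_nonneg (mul_nonpos_of_nonpos_of_nonneg (by linarith) hν0.le) hα0.le
  have he' : -(2 * ((1 - α) * ν / α)) < ν := by
    have : -(2 * ((1 - α) * ν / α)) = 2 * (α - 1) * ν / α := by ring
    rw [this, div_lt_iff₀ hα0]
    nlinarith
  have h1 := ENNReal.Tendsto.const_mul (a := ENNReal.ofReal K)
    (tendsto_lintegral_overlap_sq hν (P.map Ξ) hμ he he' hfar hφ hB hi)
    (Or.inr ENNReal.ofReal_ne_top)
  rw [mul_zero] at h1
  refine tendsto_of_tendsto_of_tendsto_of_le_of_le' tendsto_const_nhds h1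
    (Eventually.of_forall fun _ => zero_le) ?_
  filter_upwards [eventually_gt_atTop 0] with r hr
  have h2 := hK _ (hi.comp_smul (inv_ne_zero hr.ne'))
  set q := charlierCoeff (meanVolume (P.map Ξ)).toNNReal k
  set m₁ := ∫ ω', excursionIntegral u Ξs k φ r ω' ∂P
  set m₂ := ∫ ω', fieldIntegral u Ξs φ r ω' ∂P
  have e1 : ∀ ω, ‖r ^ (-(ν / α : ℝ)) * (excursionIntegral u Ξs k φ r ω - m₁) -
      q * (r ^ (-(ν / α : ℝ)) * (fieldIntegral u Ξs φ r ω - m₂))‖ₑ ^ 2 =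
        ENNReal.ofReal (r ^ (-(2 * ν + 2 * ((1 - α) * ν / α)))) *
          ‖(excursionIntegral u Ξs k φ r ω - m₁) - q * (fieldIntegral u Ξs φ r ω - m₂)‖ₑ ^ 2 := by
    intro ω
    have e2 : r ^ (-(ν / α : ℝ)) * (excursionIntegral u Ξs k φ r ω - m₁) -
      q * (r ^ (-(ν / α : ℝ)) * (fieldIntegral u Ξs φ r ω - m₂)) = r ^ (-(ν / α : ℝ)) *
        ((excursionIntegral u Ξs k φ r ω - m₁) - q * (fieldIntegral u Ξs φ r ω - m₂)) := by ring
    have e3 : (-(2 * ν + 2 * ((1 - α) * ν / α)) : ℝ) = -(ν / α) + -(ν / α) := by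
      field_simp
      ring
    rw [e2, enorm_mul, mul_pow, e3, Real.rpow_add hr, ENNReal.ofReal_mul (by positivity), ← sq,
      Real.enorm_of_nonneg (by positivity)]
  simp only [e1]
  rw [lintegral_const_mul' _ _ ENNReal.ofReal_ne_top, mul_left_comm]
  refine mul_le_mul_right (h2.trans (le_of_eq ?_)) _
  rw [← lintegral_const_mul' _ _ ENNReal.ofReal_ne_top]
  refine lintegral_congr fun z => ?_
  ring

end Field

/-- The limit theorems for the integrals of the field and of the excursion indicators. -/
theorem exists_stable_limit (hν : 1 ≤ ν) (hα₁ : 1 < α) (hα₂ : α < 2) (hc : 0 < c)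
    (htail : (fun x : ℝ => P.real {ω | ENNReal.ofReal x < volume (Ξ ω : Set (Eucl ν))})
      ~[atTop] fun x : ℝ => c * x ^ (-α))
    (hspread : (fun r : ℝ => (∫⁻ ω, volume ((Ξ ω : Set (Eucl ν)) ∩ {t | r < ‖t‖}) ∂P).toReal)
      =o[atTop] fun r : ℝ => r ^ ((1 - α) * ν / α))
    {φ : Eucl ν → ℝ} (h1 : MemLp φ 1 volume) (h2 : MemLp φ ∞ volume) :
    ∃ L : ProbabilityMeasure ℝ, IsStableIntegralLaw c α φ L ∧
      (¬ φ =ᵐ[volume] 0 → IsAlphaStable α (L : Measure ℝ)) ∧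
      TendstoInDistribution
        (fun (r : ℝ) ω => r ^ (-(ν / α : ℝ)) *
          (fieldIntegral u Ξs φ r ω - ∫ ω', fieldIntegral u Ξs φ r ω' ∂P))
        atTop (fun x : ℝ => x) (fun _ => P) (L : Measure ℝ) ∧
      ∀ k : ℕ, 1 ≤ k →
        TendstoInDistribution
          (fun (r : ℝ) ω => r ^ (-(ν / α : ℝ)) *
            (excursionIntegral u Ξs k φ r ω - ∫ ω', excursionIntegral u Ξs k φ r ω' ∂P))
          atTop
          (fun x : ℝ => Real.exp (-meanGrainVolume P Ξ) * meanGrainVolume P Ξ ^ (k - 1) /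
            (Nat.factorial (k - 1) : ℝ) * x)
          (fun _ => P) (L : Measure ℝ) := by
  have hα0 : 0 < α := by linarith
  have hν0 : (0 : ℝ) < ν := by exact_mod_cast hν
  have hμ := hM.meanVolume_lt_top hα₁ htail
  have htail' := hM.tail_isEquivalent hα0 htail
  have hfar : (fun r : ℝ => (farVolume (P.map Ξ) r).toReal)
      =o[atTop] fun r : ℝ => r ^ ((1 - α) * ν / α) := by
    simpa only [hM.farVolume_eq] using hspread
  obtain ⟨ψ, B, hψ, hB, hi, hae⟩ := exists_bounded_version h1 h2
  have hiφ : Integrable φ := memLp_one_iff_integrable.mp h1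
  have hy : (-(ν / α : ℝ)) ≠ 0 := (neg_lt_zero.mpr (div_pos hν0 hα0)).ne
  have hfi : ∀ r : ℝ, r ≠ 0 → fieldIntegral u Ξs φ r = fieldIntegral u Ξs ψ r := fun r hr =>
    funext fun ω => scaledIntegral_congr hae _ hr
  have hei : ∀ (k : ℕ) (r : ℝ), r ≠ 0 →
      excursionIntegral u Ξs k φ r = excursionIntegral u Ξs k ψ r := fun k r hr =>
    funext fun ω => scaledIntegral_congr hae _ hr
  have hXm := aemeasurable_normalized (P := P) (X := fieldIntegral u Ξs φ) hy
    (fun r => ∫ ω', fieldIntegral u Ξs φ r ω' ∂P)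
    fun r hr => (hM.integrable_fieldIntegral hμ hiφ hr).aemeasurable
  obtain ⟨L, hL, hlim⟩ := exists_tendstoInDistribution hXm
    (continuousAt_exp_stableLogCharFun (c := c) (φ := φ) hα0) (fun θ => by
      have h3 := hM.tendsto_integral_exp_fieldIntegral hν hα₁ hα₂ hc hμ htail' hfar
        (hψ.const_mul θ) (B := |θ| * B) (fun s => by
          rw [abs_mul]
          exact mul_le_mul_of_nonneg_left (hB s) (abs_nonneg _)) (hi.const_mul θ)
      rw [stableLogCharFun_congr hae]
      refine h3.congr' ?_
      filter_upwards [eventually_gt_atTop 0] with r hr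
      have e : ∀ ω, fieldIntegral u Ξs (fun s => θ * ψ s) r ω =
          θ * fieldIntegral u Ξs ψ r ω := fun ω => by
        simp only [fieldIntegral, scaledIntegral, mul_assoc, integral_const_mul]
      simp only [e, integral_const_mul, ← mul_sub, hfi r hr.ne']
      refine integral_congr_ae (ae_of_all _ fun ω => ?_)
      simp only
      rw [mul_left_comm])
  refine ⟨L, hL, fun hne => ?_, hlim, fun k hk => ?_⟩
  · refine isAlphaStable_of_isStableIntegralLaw hα₁ hα₂ hc hψ hB hi
      (fun h0 => hne (hae.trans h0)) fun θ => ?_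
    rw [hL, stableLogCharFun_congr hae]
  · have hq : Real.exp (-meanGrainVolume P Ξ) * meanGrainVolume P Ξ ^ (k - 1) /
        (Nat.factorial (k - 1) : ℝ) = charlierCoeff (meanVolume (P.map Ξ)).toNNReal k := by
      rw [charlierCoeff, hM.coe_meanVolume]
    rw [hq]
    set q := charlierCoeff (meanVolume (P.map Ξ)).toNNReal k
    have h3 := hlim.continuous_comp (continuous_const_mul q)
    refine tendstoInDistribution_of_lintegral_sq h3
      (aemeasurable_normalized hy (fun r => ∫ ω', excursionIntegral u Ξs k φ r ω' ∂P)
        fun r hr => (hM.integrable_excursionIntegral k hiφ hr).aemeasurable) ?_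
    refine (hM.tendsto_lintegral_sq_normalized hμ hν hα₁ hα₂ hfar hψ hB hi hk).congr' ?_
    filter_upwards [eventually_gt_atTop 0] with r hr
    simp only [Function.comp_apply, hfi r hr.ne', hei k r hr.ne']
    rfl

/-! ### The volume fraction -/

omit [MeasurableSpace Ω] [IsProbabilityMeasure P] hM in
lemma booleanSet_eq (ω : Ω) : booleanSet u Ξs ω = {t | ((1 : ℕ) : ℝ≥0∞) ≤ grainField u Ξs ω t} := by
  classical
  ext t
  simp only [booleanSet, Set.mem_iUnion, Set.mem_ofPred_eq, Nat.cast_one, grainField]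
  constructor
  · rintro ⟨j, hj⟩
    refine le_trans (le_of_eq ?_) (ENNReal.le_tsum j)
    rw [Set.indicator_of_mem hj]
  · intro h
    by_contra! h0
    have h1 : ∀ j, (u j ω +ᵥ (Ξs j ω : Set (Eucl ν))).indicator (fun _ => (1 : ℝ≥0∞)) t = 0 :=
      fun j => Set.indicator_of_notMem (h0 j) _
    simp [h1] at h

omit [IsProbabilityMeasure P] in
lemma measurableSet_booleanSet (ω : Ω) : MeasurableSet (booleanSet u Ξs ω) := by
  rw [booleanSet_eq]
  exact measurableSet_le measurable_const (hM.measurable_grainField.comp measurable_prodMk_left)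

omit [IsProbabilityMeasure P] in
lemma real_booleanSet_inter {D : Set (Eucl ν)} (hD : MeasurableSet D) (ω : Ω) :
    volume.real (booleanSet u Ξs ω ∩ D) =
      ∫ t, D.indicator (fun _ => (1 : ℝ)) t * excursion u Ξs 1 ω t := by
  classical
  have e : ∀ t, D.indicator (fun _ => (1 : ℝ)) t * excursion u Ξs 1 ω t =
      (booleanSet u Ξs ω ∩ D).indicator 1 t := fun t => by
    simp only [excursion, ← booleanSet_eq, Set.indicator_apply, Set.mem_inter_iff, Pi.one_apply]
    split_ifs <;> simp_all
  simp only [e]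
  rw [integral_indicator_one ((hM.measurableSet_booleanSet ω).inter hD)]

lemma volumeFraction_eq (hμ : meanVolume (P.map Ξ) < ∞) :
    volumeFraction P u Ξs = poissonTail (meanVolume (P.map Ξ)).toNNReal 1 := by
  set D : Set (Eucl ν) := {t | ∀ i, 0 < t i ∧ t i ≤ 1} with hDdef
  have hD : MeasurableSet D := by
    have : D = ⋂ i, {t : Eucl ν | 0 < t i ∧ t i ≤ 1} := by
      ext t
      simp [hDdef]
    rw [this]
    refine MeasurableSet.iInter fun i => ?_
    have hi : Measurable fun t : Eucl ν => t i := by fun_prop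
    exact (measurableSet_lt measurable_const hi).inter (measurableSet_le hi measurable_const)
  have hvol : volume D = 1 := by
    have h1 := PiLp.volume_preserving_ofLp (Fin ν)
    have h2 : D = (fun t : Eucl ν => (t : Fin ν → ℝ)) ⁻¹'
        (Set.univ.pi fun _ => Set.Ioc (0 : ℝ) 1) := by
      ext t
      simp [hDdef]
    have h3 := h1.measure_preimage
      (MeasurableSet.univ_pi fun _ : Fin ν => measurableSet_Ioc (a := (0 : ℝ)) (b := 1)).nullMeasurableSet
    rw [Real.volume_pi_Ioc] at h3
    rw [h2]
    simpa using h3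
  have hi : Integrable (D.indicator fun _ => (1 : ℝ)) :=
    (integrable_indicator_iff hD).mpr (integrableOn_const (by simp [hvol]))
  have e : ∀ ω, volume.real (booleanSet u Ξs ω ∩ {t | ∀ i, 0 < t i ∧ t i ≤ 1}) =
      ∫ t, D.indicator (fun _ => (1 : ℝ)) t * excursion u Ξs 1 ω t :=
    hM.real_booleanSet_inter hD
  simp only [volumeFraction, e]
  rw [hM.integral_mul_excursion hμ 1 hi, integral_indicator_const _ hD, measureReal_def, hvol]
  simp

omit [IsProbabilityMeasure P] in
lemma sampleVolumeFraction_eq {A : Set (Eucl ν)} (hA : MeasurableSet A) {r : ℝ} (hr : r ≠ 0)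
    (ω : Ω) : sampleVolumeFraction u Ξs A r ω =
      excursionIntegral u Ξs 1 (A.indicator fun _ => (1 : ℝ)) r ω / volume.real (r • A) := by
  classical
  rw [sampleVolumeFraction, hM.real_booleanSet_inter (hA.const_smul₀ r), excursionIntegral,
    scaledIntegral]
  congr 2
  funext t
  simp only [Set.indicator_apply, Set.mem_smul_set_iff_inv_smul_mem₀ hr]

end IsBooleanModel

end Model

/-- The limit theorem for the sample volume fraction, from the one for the excursion set `{X ≥ 1}`,
which is the Boolean set. -/
theorem IsBooleanModel.tendstoInDistribution_sampleVolumeFraction {Ω : Type*} {ν : ℕ}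
    [MeasurableSpace Ω] {P : Measure Ω} [IsProbabilityMeasure P] {u : ℕ → Ω → Eucl ν}
    {Ξs : ℕ → Ω → Closeds (Eucl ν)} {Ξ : Ω → Closeds (Eucl ν)} (hM : IsBooleanModel P u Ξs Ξ)
    (hμ : meanVolume (P.map Ξ) < ∞) {α : ℝ} (hν : 1 ≤ ν) (hα₁ : 1 < α) {A : Set (Eucl ν)}
    (hA : MeasurableSet A) (hA0 : 0 < volume A) (hA1 : volume A < ∞) {L : ProbabilityMeasure ℝ}
    (h : TendstoInDistribution
      (fun (r : ℝ) ω => r ^ (-(ν / α : ℝ)) *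
        (excursionIntegral u Ξs 1 (A.indicator fun _ => (1 : ℝ)) r ω -
          ∫ ω', excursionIntegral u Ξs 1 (A.indicator fun _ => (1 : ℝ)) r ω' ∂P))
      atTop
      (fun x : ℝ => Real.exp (-meanGrainVolume P Ξ) * meanGrainVolume P Ξ ^ (1 - 1) /
        (Nat.factorial (1 - 1) : ℝ) * x)
      (fun _ => P) (L : Measure ℝ)) :
    TendstoInDistribution
      (fun (r : ℝ) ω => r ^ ((ν : ℝ) - ν / α) *
        (sampleVolumeFraction u Ξs A r ω - volumeFraction P u Ξs))
      atTop (fun x : ℝ => Real.exp (-meanGrainVolume P Ξ) * x / volume.real A)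
      (fun _ => P) (L : Measure ℝ) := by
  have hα0 : 0 < α := by linarith
  have hν0 : (0 : ℝ) < ν := by exact_mod_cast hν
  have hV : 0 < volume.real A := ENNReal.toReal_pos hA0.ne' hA1.ne
  have hi : Integrable (A.indicator fun _ => (1 : ℝ)) :=
    (integrable_indicator_iff hA).mpr (integrableOn_const hA1.ne)
  have hy : (ν : ℝ) - ν / α ≠ 0 := by
    refine (sub_pos.mpr ?_).ne'
    rw [div_lt_iff₀ hα0]
    nlinarith
  have h1 := h.continuous_comp (continuous_id.div_const (volume.real A))
  have e1 : ((fun x : ℝ => id x / volume.real A) ∘ fun x : ℝ =>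
      Real.exp (-meanGrainVolume P Ξ) * meanGrainVolume P Ξ ^ (1 - 1) /
        (Nat.factorial (1 - 1) : ℝ) * x) =
      fun x : ℝ => Real.exp (-meanGrainVolume P Ξ) * x / volume.real A := by
    funext x
    simp
  rw [e1] at h1
  refine tendstoInDistribution_congr_eventually h1
    (IsBooleanModel.aemeasurable_normalized hy (fun _ => volumeFraction P u Ξs) fun r hr => ?_) ?_
  · rw [funext (hM.sampleVolumeFraction_eq hA hr)]
    exact (hM.integrable_excursionIntegral 1 hi hr).aemeasurable.div_const _
  · filter_upwards [eventually_gt_atTop 0] with r hr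
    have hvol : volume.real (r • A) = r ^ ν * volume.real A := by
      rw [measureReal_def, Measure.addHaar_smul, finrank_euclideanSpace_fin, ENNReal.toReal_mul,
        ENNReal.toReal_ofReal (abs_nonneg _), abs_of_pos (by positivity), measureReal_def]
    have hmean : ∫ ω', excursionIntegral u Ξs 1 (A.indicator fun _ => (1 : ℝ)) r ω' ∂P =
        volumeFraction P u Ξs * (r ^ ν * volume.real A) := by
      have h2 := hM.integral_mul_excursion hμ 1 (hi.comp_smul (inv_ne_zero hr.ne'))
      rw [hM.volumeFraction_eq hμ]
      refine h2.trans ?_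
      rw [Measure.integral_comp_inv_smul, integral_indicator_const _ hA,
        finrank_euclideanSpace_fin, abs_of_pos (by positivity)]
      simp
    have hr0 : r ^ ν ≠ 0 := (pow_pos hr ν).ne'
    funext ω
    simp only [Function.comp_apply, id_eq]
    rw [hmean, hM.sampleVolumeFraction_eq hA hr.ne', hvol, sub_eq_add_neg (ν : ℝ),
      Real.rpow_add hr, Real.rpow_natCast]
    field_simp

theorem theorem1 {Ω : Type*} [MeasurableSpace Ω] (P : Measure Ω) [IsProbabilityMeasure P]
    (ν : ℕ) (hν : 1 ≤ ν)
    (u : ℕ → Ω → EuclideanSpace ℝ (Fin ν))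
    (Ξs : ℕ → Ω → Closeds (EuclideanSpace ℝ (Fin ν)))
    (Ξ : Ω → Closeds (EuclideanSpace ℝ (Fin ν)))
    (hmodel : IsBooleanModel P u Ξs Ξ)
    (α c : ℝ) (hα₁ : 1 < α) (hα₂ : α < 2) (hc : 0 < c)
    (htail : (fun x : ℝ =>
        P.real {ω | ENNReal.ofReal x < volume (Ξ ω : Set (EuclideanSpace ℝ (Fin ν)))})
      ~[atTop] fun x : ℝ => c * x ^ (-α))
    (hspread : (fun r : ℝ =>
        (∫⁻ ω, volume ((Ξ ω : Set (EuclideanSpace ℝ (Fin ν))) ∩ {t | r < ‖t‖}) ∂P).toReal)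
      =o[atTop] fun r : ℝ => r ^ ((1 - α) * ν / α)) :
    -- the objects in the limit theorems are well defined
    (∀ t, ∀ᵐ ω ∂P, grainField u Ξs ω t < ∞) ∧
    (∀ φ : EuclideanSpace ℝ (Fin ν) → ℝ, MemLp φ 1 volume → MemLp φ ∞ volume → ∀ r : ℝ, 0 < r →
      (∀ᵐ ω ∂P, Integrable fun t => φ (r⁻¹ • t) * (grainField u Ξs ω t).toReal) ∧
      Integrable (fieldIntegral u Ξs φ r) P ∧
      ∀ k : ℕ, 1 ≤ k →
        (∀ᵐ ω ∂P, Integrable fun t => φ (r⁻¹ • t) * excursion u Ξs k ω t) ∧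
        Integrable (excursionIntegral u Ξs k φ r) P) ∧
    -- limits of the integrals of the field and of its excursion indicators
    (∀ φ : EuclideanSpace ℝ (Fin ν) → ℝ, MemLp φ 1 volume → MemLp φ ∞ volume →
      ∃ L : ProbabilityMeasure ℝ, IsStableIntegralLaw c α φ L ∧
        (¬ φ =ᵐ[volume] 0 → IsAlphaStable α (L : Measure ℝ)) ∧
        TendstoInDistribution
          (fun (r : ℝ) ω => r ^ (-(ν / α)) *
            (fieldIntegral u Ξs φ r ω - ∫ ω', fieldIntegral u Ξs φ r ω' ∂P))
          atTop (fun x : ℝ => x) (fun _ => P) (L : Measure ℝ) ∧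
        ∀ k : ℕ, 1 ≤ k →
          TendstoInDistribution
            (fun (r : ℝ) ω => r ^ (-(ν / α)) *
              (excursionIntegral u Ξs k φ r ω - ∫ ω', excursionIntegral u Ξs k φ r ω' ∂P))
            atTop
            (fun x : ℝ => Real.exp (-meanGrainVolume P Ξ) * meanGrainVolume P Ξ ^ (k - 1) /
              (Nat.factorial (k - 1) : ℝ) * x)
            (fun _ => P) (L : Measure ℝ)) ∧
    -- limit of the sample volume fraction
    (∀ A : Set (EuclideanSpace ℝ (Fin ν)), Bornology.IsBounded A → MeasurableSet A →
      0 < volume A →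
      ∃ L : ProbabilityMeasure ℝ, IsStableIntegralLaw c α (A.indicator fun _ => (1 : ℝ)) L ∧
        IsAlphaStable α (L : Measure ℝ) ∧
        (∀ θ : ℝ, charFun (L : Measure ℝ) θ =
          Complex.exp (Complex.I * c * θ * (volume.real A : ℂ) * stableKernel α θ)) ∧
        TendstoInDistribution
          (fun (r : ℝ) ω => r ^ ((ν : ℝ) - ν / α) *
            (sampleVolumeFraction u Ξs A r ω - volumeFraction P u Ξs))
          atTop (fun x : ℝ => Real.exp (-meanGrainVolume P Ξ) * x / volume.real A)
          (fun _ => P) (L : Measure ℝ)) := by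
  have hα0 : 0 < α := by linarith
  have hμ := hmodel.meanVolume_lt_top hα₁ htail
  have hmain := fun (φ : EuclideanSpace ℝ (Fin ν) → ℝ) (h1 : MemLp φ 1 volume)
    (h2 : MemLp φ ∞ volume) => hmodel.exists_stable_limit hν hα₁ hα₂ hc htail hspread h1 h2
  refine ⟨hmodel.ae_grainField_lt_top hμ, fun φ h1 _ r hr => ?_, hmain, fun A hAb hA hA0 => ?_⟩
  · have hi : Integrable φ := memLp_one_iff_integrable.mp h1
    have hir := hi.comp_smul (inv_ne_zero hr.ne')
    exact ⟨(hmodel.integrable_mul_grainField hμ hir).prod_right_ae,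
      hmodel.integrable_fieldIntegral hμ hi hr.ne', fun k _ =>
      ⟨(hmodel.integrable_mul_excursion k hir).prod_right_ae,
        hmodel.integrable_excursionIntegral k hi hr.ne'⟩⟩
  · have hA1 : volume A < ∞ := hAb.measure_lt_top
    obtain ⟨L, hL, hstable, -, hexc⟩ := hmain (A.indicator fun _ => (1 : ℝ))
      (memLp_indicator_const 1 hA 1 (Or.inr hA1.ne)) (memLp_indicator_const ∞ hA 1 (Or.inr hA1.ne))
    refine ⟨L, hL, hstable fun h0 => ?_, fun θ => ?_,
      hmodel.tendstoInDistribution_sampleVolumeFraction hμ hν hα₁ hA hA0 hA1 (hexc 1 le_rfl)⟩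
    · have h1 : ∀ᵐ t, t ∉ A := by
        filter_upwards [h0] with t ht htA
        rw [Set.indicator_of_mem htA] at ht
        exact one_ne_zero ht
      exact hA0.ne' (measure_eq_zero_iff_ae_notMem.mpr h1)
    · rw [hL, stableLogCharFun_indicator hA]
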